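/- Let $K$ be an algebraically closed field and let $n\ge 3$, $d\ge 1$ and $k\ge 3$ be integers. A degree $d$ tree in $\mathbb{P}^n=\mathbb{P}^n_K$ is a connected nodal curve of degree $d$ and arithmetic genus $0$ whose irreducible components are lines. An ordering $L_1,\dots,L_d$ of the components of a tree is admissible if $L_1\cup\cdots\cup L_i$ is connected for all $i$; its type is the map $\tau:\{2,\dots,d\}\to\{1,\dots,d-1\}$ such that $\tau(i)$ is the unique $j<i$ with $L_i\cap L_j\ne\emptyset$. For a map $\tau:\{2,\dots,d\}\to\{1,\dots,d-1\}$ with $\tau(i)<i$ for all $i$, let $T(n,d,\tau)$ be the irreducible variety of all degree $d$ trees $Y\subset\mathbb{P}^n$ that have an admissible ordering of type $\tau$. Fix such a $\tau$. Then for a general pair $(W,Y)$, where $W\subset\mathbb{P}^n$ is a degree $k$ hypersurface and $Y\in T(n,d,\tau)$ (that is, for all pairs in a suitable non-empty Zariski open subset of $|\mathcal{O}_{\mathbb{P}^n}(k)|\times T(n,d,\tau)$), the following holds for every integer $t$, where $\mathcal{I}_{W\cap Y,W}$ is the ideal sheaf of the scheme $W\cap Y$ in $W$ and $\binom{a}{b}=0$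 for integers $a<b$: 1. If $d\le\binom{n+t-k}{n-1}$, then $h^1(W,\mathcal{I}_{W\cap Y,W}(t))=0$. 2. If $d\ge\binom{n+t+k-2}{n-1}$, then $h^0(W,\mathcal{I}_{W\cap Y,W}(t))=0$. -/

import Mathlib

/-! Trees of lines in `ℙⁿ`, their types, Čech cohomology of twisted ideal sheaves on a hypersurface
of `ℙⁿ`, and the meaning of "general".  Throughout, `ℙⁿ` is the space of lines through the origin in
`Fin (n + 1) → K`, with homogeneous coordinate ring `MvPolynomial (Fin (n + 1)) K`. -/

namespace TreesOfLines

universe u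

noncomputable section

/-! ### Cohomology of twisted ideal sheaves on a hypersurface -/

section Cohomology

variable {K : Type u} [Field K] {n : ℕ}

/-- The homogeneous coordinate ring `K[x₀, …, xₙ] / (F)` of the hypersurface `W = {F = 0}`. -/
abbrev CoordRing (F : MvPolynomial (Fin (n + 1)) K) : Type u :=
  MvPolynomial (Fin (n + 1)) K ⧸ Ideal.span {F}

/-- The class of a polynomial in the coordinate ring of `W`. -/
abbrev toCoord (F : MvPolynomial (Fin (n + 1)) K) :
    MvPolynomial (Fin (n + 1)) K →ₐ[K] CoordRing F :=
  Ideal.Quotient.mkₐ K (Ideal.span {F})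

/-- The monomial `x_σ = x_{σ 0} ⋯ x_{σ p}`; the open set `D₊(x_σ)` is the intersection of the standard
affine open sets `D₊(x_{σ 0}), …, D₊(x_{σ p})`. -/
def coverMonomial {p : ℕ} (σ : Fin (p + 1) → Fin (n + 1)) : MvPolynomial (Fin (n + 1)) K :=
  ∏ a, MvPolynomial.X (σ a)

/-- The localized ring `(K[x₀, …, xₙ] / (F))_{x_σ}`. Its degree `t` elements are the sections of
`𝓞_W(t)` on `W ∩ D₊(x_σ)`. -/
def LocalRing (F : MvPolynomial (Fin (n + 1)) K) {p : ℕ} (σ : Fin (p + 1) → Fin (n + 1)) :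
    Type u :=
  Localization.Away (toCoord F (coverMonomial σ))

instance (F : MvPolynomial (Fin (n + 1)) K) {p : ℕ} (σ : Fin (p + 1) → Fin (n + 1)) :
    CommRing (LocalRing F σ) :=
  inferInstanceAs (CommRing (Localization.Away (toCoord F (coverMonomial σ))))

instance (F : MvPolynomial (Fin (n + 1)) K) {p : ℕ} (σ : Fin (p + 1) → Fin (n + 1)) :
    Algebra (CoordRing F) (LocalRing F σ) :=
  inferInstanceAs (Algebra (CoordRing F) (Localization.Away (toCoord F (coverMonomial σ))))

instance (F : MvPolynomial (Fin (n + 1)) K) {p : ℕ} (σ : Fin (p + 1) → Fin (n + 1)) :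
    Algebra K (LocalRing F σ) :=
  inferInstanceAs (Algebra K (Localization.Away (toCoord F (coverMonomial σ))))

instance (F : MvPolynomial (Fin (n + 1)) K) {p : ℕ} (σ : Fin (p + 1) → Fin (n + 1)) :
    IsScalarTower K (CoordRing F) (LocalRing F σ) :=
  inferInstanceAs (IsScalarTower K (CoordRing F)
    (Localization.Away (toCoord F (coverMonomial σ))))

instance (F : MvPolynomial (Fin (n + 1)) K) {p : ℕ} (σ : Fin (p + 1) → Fin (n + 1)) :
    IsLocalization.Away (toCoord F (coverMonomial σ)) (LocalRing F σ) :=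
  inferInstanceAs (IsLocalization.Away (toCoord F (coverMonomial σ))
    (Localization.Away (toCoord F (coverMonomial σ))))

/-- The class of a polynomial in the localized ring. -/
abbrev toLocal (F : MvPolynomial (Fin (n + 1)) K) {p : ℕ} (σ : Fin (p + 1) → Fin (n + 1)) :
    MvPolynomial (Fin (n + 1)) K →ₐ[K] LocalRing F σ :=
  (IsScalarTower.toAlgHom K (CoordRing F) (LocalRing F σ)).comp (toCoord F)

/-- Let `Z ⊆ W` be the closed subscheme of `W = {F = 0}` with homogeneous ideal `I`. These are the
sections of the twisted ideal sheaf `𝓘_{Z,W}(t)` on `W ∩ D₊(x_σ)`: the fractions `f / x_σ ^ a` with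
`f ∈ I` homogeneous of degree `t + a * deg x_σ`. -/
def idealSections (F : MvPolynomial (Fin (n + 1)) K) (I : Ideal (MvPolynomial (Fin (n + 1)) K))
    (t : ℤ) {p : ℕ} (σ : Fin (p + 1) → Fin (n + 1)) : Submodule K (LocalRing F σ) where
  carrier := {s | ∃ (a m : ℕ) (f : MvPolynomial (Fin (n + 1)) K), f ∈ I ∧ f.IsHomogeneous m ∧
    (m : ℤ) = t + a * (p + 1) ∧ s * toLocal F σ (coverMonomial σ) ^ a = toLocal F σ f}
  zero_mem' := by
    refine ⟨t.natAbs, (t + t.natAbs * (p + 1)).toNat, 0, I.zero_mem,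
      MvPolynomial.isHomogeneous_zero _ _ _, ?_, by rw [zero_mul, map_zero]⟩
    apply Int.toNat_of_nonneg
    have h1 : -t ≤ (t.natAbs : ℤ) := by omega
    have h2 : (0 : ℤ) ≤ t.natAbs * p := by positivity
    linarith
  add_mem' := by
    rintro s s' ⟨a, m, f, hf, hfm, hm, hs⟩ ⟨a', m', f', hf', hfm', hm', hs'⟩
    have hx : (coverMonomial σ : MvPolynomial (Fin (n + 1)) K).IsHomogeneous (p + 1) := by
      simpa [coverMonomial] using MvPolynomial.IsHomogeneous.prod Finset.univ
        (fun a => (MvPolynomial.X (σ a) : MvPolynomial (Fin (n + 1)) K)) (fun _ => 1)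
        (fun a _ => MvPolynomial.isHomogeneous_X K (σ a))
    refine ⟨a + a', m + a' * (p + 1), f * coverMonomial σ ^ a' + f' * coverMonomial σ ^ a,
      I.add_mem (I.mul_mem_right _ hf) (I.mul_mem_right _ hf'), ?_, ?_, ?_⟩
    · refine (hfm.mul (by simpa [mul_comm] using hx.pow a')).add ?_
      have e : m + a' * (p + 1) = m' + a * (p + 1) := by
        zify; rw [hm, hm']; ring
      rw [e]
      exact hfm'.mul (by simpa [mul_comm] using hx.pow a)
    · push_cast; rw [hm]; ring
    · rw [map_add, map_mul, map_mul, map_pow, map_pow, ← hs, ← hs']; ring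
  smul_mem' := by
    rintro c s ⟨a, m, f, hf, hfm, hm, hs⟩
    refine ⟨a, m, MvPolynomial.C c * f, I.mul_mem_left _ hf, ?_, hm, ?_⟩
    · simpa using (MvPolynomial.isHomogeneous_C (Fin (n + 1)) c).mul hfm
    · rw [smul_mul_assoc, hs, ← MvPolynomial.smul_eq_C_mul, map_smul]

/-- Deleting an index: `x_σ = x_{σ b} * x_{σ ∘ b.succAbove}`. -/
theorem coverMonomial_succAbove {p : ℕ} (σ : Fin (p + 2) → Fin (n + 1)) (b : Fin (p + 2)) :
    (coverMonomial σ : MvPolynomial (Fin (n + 1)) K) =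
      MvPolynomial.X (σ b) * coverMonomial (σ ∘ b.succAbove) := by
  simp only [coverMonomial, Function.comp_apply]
  exact Fin.prod_univ_succAbove _ b

theorem isUnit_toLocal (F : MvPolynomial (Fin (n + 1)) K) {p : ℕ} (σ : Fin (p + 2) → Fin (n + 1))
    (b : Fin (p + 2)) :
    IsUnit (IsScalarTower.toAlgHom K (CoordRing F) (LocalRing F σ)
      (toCoord F (coverMonomial (σ ∘ b.succAbove)))) := by
  have h : IsUnit (algebraMap (CoordRing F) (LocalRing F σ) (toCoord F (coverMonomial σ))) :=
    IsLocalization.Away.algebraMap_isUnit _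
  have e := congrArg (fun f => algebraMap (CoordRing F) (LocalRing F σ) (toCoord F f))
    (coverMonomial_succAbove (K := K) σ b)
  simp only [map_mul] at e
  rw [e] at h
  exact isUnit_of_mul_isUnit_right h

/-- Restriction of functions from `D₊(x_{σ ∘ b.succAbove})` to the smaller open set `D₊(x_σ)`. -/
def restrict (F : MvPolynomial (Fin (n + 1)) K) {p : ℕ} (σ : Fin (p + 2) → Fin (n + 1))
    (b : Fin (p + 2)) : LocalRing F (σ ∘ b.succAbove) →ₐ[K] LocalRing F σ :=
  IsLocalization.Away.liftAlgHom (toCoord F (coverMonomial (σ ∘ b.succAbove)))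
    (isUnit_toLocal F σ b)

theorem restrict_toLocal (F : MvPolynomial (Fin (n + 1)) K) {p : ℕ}
    (σ : Fin (p + 2) → Fin (n + 1)) (b : Fin (p + 2)) (f : MvPolynomial (Fin (n + 1)) K) :
    restrict F σ b (toLocal F (σ ∘ b.succAbove) f) = toLocal F σ f :=
  IsLocalization.Away.lift_eq _ (isUnit_toLocal F σ b) _

theorem restrict_mem (F : MvPolynomial (Fin (n + 1)) K)
    (I : Ideal (MvPolynomial (Fin (n + 1)) K)) (t : ℤ) {p : ℕ} (σ : Fin (p + 2) → Fin (n + 1))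
    (b : Fin (p + 2)) {s : LocalRing F (σ ∘ b.succAbove)}
    (hs : s ∈ idealSections F I t (σ ∘ b.succAbove)) :
    restrict F σ b s ∈ idealSections F I t σ := by
  obtain ⟨a, m, f, hf, hfm, hm, hs⟩ := hs
  refine ⟨a, m + a, f * MvPolynomial.X (σ b) ^ a, I.mul_mem_right _ hf,
    hfm.mul (by simpa using (MvPolynomial.isHomogeneous_X K (σ b)).pow a), ?_, ?_⟩
  · rw [Nat.cast_add, hm]; push_cast; ring
  · have h := congrArg (restrict F σ b) hs
    rw [map_mul, map_pow, restrict_toLocal, restrict_toLocal] at h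
    have e := congrArg (toLocal F σ) (coverMonomial_succAbove (K := K) σ b)
    rw [map_mul] at e
    rw [e, map_mul, map_pow, ← h]; ring

/-- The Čech cochains of degree `p` of the sheaf `𝓘_{Z,W}(t)` for the affine open cover of `W` by the
sets `W ∩ D₊(x_i)`, `0 ≤ i ≤ n`. -/
def CechCochain (F : MvPolynomial (Fin (n + 1)) K) (I : Ideal (MvPolynomial (Fin (n + 1)) K))
    (t : ℤ) (p : ℕ) : Type u :=
  (σ : Fin (p + 1) → Fin (n + 1)) → idealSections F I t σ

instance (F : MvPolynomial (Fin (n + 1)) K) (I : Ideal (MvPolynomial (Fin (n + 1)) K)) (t : ℤ)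
    (p : ℕ) : AddCommGroup (CechCochain F I t p) :=
  inferInstanceAs (AddCommGroup ((σ : Fin (p + 1) → Fin (n + 1)) → idealSections F I t σ))

instance (F : MvPolynomial (Fin (n + 1)) K) (I : Ideal (MvPolynomial (Fin (n + 1)) K)) (t : ℤ)
    (p : ℕ) : Module K (CechCochain F I t p) :=
  inferInstanceAs (Module K ((σ : Fin (p + 1) → Fin (n + 1)) → idealSections F I t σ))

/-- The Čech differential `(δ s)_σ = ∑_b (-1)^b s_{σ without σ b}` restricted to `D₊(x_σ)`. -/
def cechDifferential (F : MvPolynomial (Fin (n + 1)) K)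
    (I : Ideal (MvPolynomial (Fin (n + 1)) K)) (t : ℤ) (p : ℕ) :
    CechCochain F I t p →ₗ[K] CechCochain F I t (p + 1) where
  toFun s := fun σ => ⟨∑ b : Fin (p + 2), (-1 : ℤ) ^ (b : ℕ) •
      restrict F σ b (s (σ ∘ b.succAbove) : LocalRing F (σ ∘ b.succAbove)),
    Submodule.sum_mem _ fun b _ => zsmul_mem
      (restrict_mem F I t σ b (s (σ ∘ b.succAbove)).2) _⟩
  map_add' s s' := by
    funext σ
    apply Subtype.ext
    change ∑ b : Fin (p + 2), (-1 : ℤ) ^ (b : ℕ) • restrict F σ b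
        ((s (σ ∘ b.succAbove) : LocalRing F (σ ∘ b.succAbove)) + s' (σ ∘ b.succAbove)) =
      (∑ b : Fin (p + 2), (-1 : ℤ) ^ (b : ℕ) • restrict F σ b (s (σ ∘ b.succAbove)).1) +
        ∑ b : Fin (p + 2), (-1 : ℤ) ^ (b : ℕ) • restrict F σ b (s' (σ ∘ b.succAbove)).1
    simp only [map_add, smul_add, Finset.sum_add_distrib]
  map_smul' c s := by
    funext σ
    apply Subtype.ext
    change ∑ b : Fin (p + 2), (-1 : ℤ) ^ (b : ℕ) • restrict F σ b
        (c • (s (σ ∘ b.succAbove) : LocalRing F (σ ∘ b.succAbove))) =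
      c • ∑ b : Fin (p + 2), (-1 : ℤ) ^ (b : ℕ) • restrict F σ b (s (σ ∘ b.succAbove)).1
    simp only [map_smul, Finset.smul_sum]
    exact Finset.sum_congr rfl fun b _ => smul_comm _ _ _

/-- `hCoh F I t i` is `hⁱ(W, 𝓘_{Z,W}(t))`: the dimension over `K` of the `i`-th cohomology group (Čech
cohomology of the standard affine open cover) of the twisted ideal sheaf of the closed subscheme `Z` of
`W = {F = 0}` with homogeneous ideal `I`. -/
def hCoh (F : MvPolynomial (Fin (n + 1)) K) (I : Ideal (MvPolynomial (Fin (n + 1)) K))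
    (t : ℤ) : ℕ → Cardinal.{u}
  | 0 => Module.rank K (LinearMap.ker (cechDifferential F I t 0))
  | i + 1 => Module.rank K (LinearMap.ker (cechDifferential F I t (i + 1)) ⧸
      (LinearMap.range (cechDifferential F I t i)).submoduleOf
        (LinearMap.ker (cechDifferential F I t (i + 1))))

end Cohomology

/-! ### Trees of lines and their types -/

section Trees

variable {K : Type u} [Field K] {n d : ℕ}

/-- The dual graph of the lines `L i` of `ℙⁿ` (given as planes through the origin of the affine cone):
two different lines are joined when they have a common point. -/
def dualGraph (L : Fin d → Submodule K (Fin (n + 1) → K)) : SimpleGraph (Fin d) where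
  Adj i j := i ≠ j ∧ L i ⊓ L j ≠ ⊥
  symm := ⟨fun i j h => ⟨h.1.symm, by rw [inf_comm]; exact h.2⟩⟩
  loopless := ⟨fun _ h => h.1 rfl⟩

/-- The arithmetic genus `#nodes - d + 1` of a connected nodal union of `d` lines (its nodes are the
common points of the pairs of lines that meet). -/
def arithGenus (L : Fin d → Submodule K (Fin (n + 1) → K)) : ℤ :=
  ((dualGraph L).edgeSet.ncard : ℤ) - d + 1

/-- `L 0 ∪ ⋯ ∪ L (d - 1)` is a degree `d` tree: a connected nodal curve of arithmetic genus `0` whose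
irreducible components are the `d` different lines `L i`. (A union of different lines is nodal if and
only if no three of the lines have a common point.) -/
structure IsTree (L : Fin d → Submodule K (Fin (n + 1) → K)) : Prop where
  isLine : ∀ i, Module.finrank K (L i) = 2
  distinct : Function.Injective L
  nodal : ∀ i j l, i ≠ j → i ≠ l → j ≠ l → L i ⊓ L j ⊓ L l = ⊥
  connected : (dualGraph L).Connected
  genus_zero : arithGenus L = 0

/-- The ordering `L 0, …, L (d - 1)` is admissible: all the curves `L 0 ∪ ⋯ ∪ L i` are connected. -/
def IsAdmissible (L : Fin d → Submodule K (Fin (n + 1) → K)) : Prop :=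
  ∀ i : Fin d, ((dualGraph L).induce {j | j ≤ i}).Connected

/-- `L 0 ∪ ⋯ ∪ L (d - 1)` is a tree, the given ordering of its components is admissible and has type
`τ`: for every `i` other than the first index, `τ i` is the unique `j < i` such that `L i` and `L j`
meet. The indices `0, …, d - 1` stand for `1, …, d`. -/
structure IsTreeOfType (τ : {i : Fin d // 0 < (i : ℕ)} → Fin d)
    (L : Fin d → Submodule K (Fin (n + 1) → K)) : Prop where
  isTree : IsTree L
  isAdmissible : IsAdmissible L
  type_eq : ∀ (i : {i : Fin d // 0 < (i : ℕ)}) (j : Fin d), j < i.1 → (L i.1 ⊓ L j ≠ ⊥ ↔ j = τ i)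

/-- The homogeneous ideal of the (reduced) curve `Y = L 0 ∪ ⋯ ∪ L (d - 1)` of `ℙⁿ`. -/
def curveIdeal (L : Fin d → Submodule K (Fin (n + 1) → K)) :
    Ideal (MvPolynomial (Fin (n + 1)) K) :=
  MvPolynomial.vanishingIdeal K (⋃ i, (L i : Set (Fin (n + 1) → K)))

/-- The homogeneous ideal of the scheme-theoretic intersection `W ∩ Y`, where `W = {F = 0}` and
`Y = L 0 ∪ ⋯ ∪ L (d - 1)`. -/
def interIdeal (F : MvPolynomial (Fin (n + 1)) K) (L : Fin d → Submodule K (Fin (n + 1) → K)) :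
    Ideal (MvPolynomial (Fin (n + 1)) K) :=
  Ideal.span {F} ⊔ curveIdeal L

end Trees

/-! ### General pairs `(W, Y)` -/

section General

variable {K : Type u} [Field K]

/-- `P` holds for the general element of the family `X`, an irreducible variety by means of the
coordinates `coord`: it holds at all points of a non-empty Zariski open subset of `X`. The open sets
are unions of sets `{Φ ≠ 0}`, so that a single polynomial `Φ` in the coordinates, not identically zero
on `X`, suffices. -/
def HoldsForGeneral {α ι : Type*} (coord : α → ι → K) (X : Set α) (P : α → Prop) : Prop :=
  ∃ Φ : MvPolynomial ι K, (∃ x ∈ X, MvPolynomial.eval (coord x) Φ ≠ 0) ∧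
    ∀ x ∈ X, MvPolynomial.eval (coord x) Φ ≠ 0 → P x

/-- A form on `ℙⁿ` together with `d` ordered pairs of vectors; the `i`-th pair is meant to span the
`i`-th line. -/
abbrev PairData (K : Type u) [Field K] (n d : ℕ) : Type u :=
  MvPolynomial (Fin (n + 1)) K × (Fin d → Fin 2 → Fin (n + 1) → K)

/-- The `i`-th line: the span of the `i`-th pair of vectors. -/
def lines {n d : ℕ} (v : Fin d → Fin 2 → Fin (n + 1) → K) (i : Fin d) :
    Submodule K (Fin (n + 1) → K) :=
  Submodule.span K (Set.range (v i))

/-- The coordinates of a pair: the coefficients of the form and the entries of the vectors. -/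
def pairCoord {n d : ℕ} (x : PairData K n d) :
    (Fin (n + 1) →₀ ℕ) ⊕ (Fin d × Fin 2 × Fin (n + 1)) → K :=
  Sum.elim (fun m => x.1.coeff m) (fun q => x.2 q.1 q.2.1 q.2.2)

/-- All pairs of a degree `k` hypersurface of `ℙⁿ` (given by an equation) and a tree of type `τ` (given by
an admissible ordering of type `τ` of its lines and two spanning points of each line). Forgetting
these choices is an open surjection onto the variety of pairs `(W, Y)`. -/
def hypersurfaceTreePairs (K : Type u) [Field K] (n k : ℕ) {d : ℕ}
    (τ : {i : Fin d // 0 < (i : ℕ)} → Fin d) : Set (PairData K n d) :=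
  {x | x.1.IsHomogeneous k ∧ x.1 ≠ 0 ∧ IsTreeOfType τ (lines x.2)}

end General

end

end TreesOfLines

/-!
Let `S = K[x₀, …, xₙ]`, let `F` be an equation of `W` and `I` the ideal of the tree `Y`. Two reductions
and one degeneration prove the vanishing for a general pair.

*From cohomology to forms.* If `x₀ ^ k` occurs in `F`, then `S / (F)` is free over `K[x₁, …, xₙ]`
(division by `F`), so that `x₁, x₂, x₃` is a regular sequence on it. Hence Čech cocycles with values in
`𝓞_W(t)` are given by forms modulo `F` in degree `0` and are coboundaries in degree `1`
(`exists_global_numerator`, `exists_numerator_cobounding`). Suppose moreover that for some `b ≠ 0` the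
hyperplane `x_b = 0` contains no point of `W ∩ Y`, and that it meets the lines of `Y` in points which impose
independent conditions on the forms of degree `d - 1`. Fix a large `M` and put `J = (F) + I`. Then
multiplication by `x_b` is bijective on `S / J` in large degrees, and

* `h⁰(𝓘_{W ∩ Y, W}(t)) = 0` as soon as every form `f` of degree `t` with `x_b ^ (M - t) * f ∈ J` lies in `(F)`
  (`hCoh_zero_eq_zero_of_le`);
* `h¹(𝓘_{W ∩ Y, W}(t)) = 0` as soon as every form of degree `M` is, modulo `J`, the product of
  `x_b ^ (M - t)` and a form of degree `t` (`hCoh_one_eq_zero_of_le`).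

The first property passes to all smaller twists and the second to all larger ones, so one degree `t`
for each is enough: `t₁`, the greatest `t` with `(n - 1 + t).choose (n - 1) ≤ d`, for `h⁰`, and `e + k - 1`,
with `e` the least number such that `d ≤ (n - 1 + e).choose (n - 1)`, for `h¹`. This is also why a single
open set works for all `t`.

*Openness.* The forms of degree `m ≥ d - 1` on a tree of `d` lines make up a space of dimension `d * m + 1`
(`finrank_map_restrictLines`), whatever the tree. So the second property says that certain
vectors depending polynomially on the coefficients of `F` and the spanning vectors of the lines span a
space of known dimension, and the first that such vectors are linearly independent. Both follow from
the non-vanishing of a minor, so it suffices to find one pair with the two properties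
(`exists_polynomial_surjective`, `exists_polynomial_injective`).

*The special pair.* Take for `W` the multiple hyperplane `x₀ ^ k = 0` and for `Y` a tree of type `τ` whose
lines meet `x₀ = 0` in points which impose independent conditions on the forms of degree `e` of this
hyperplane, and on which no nonzero form of degree at most `t₁` vanishes (`exists_isGoodConfiguration`).
A form that vanishes at these points is a multiple of `x₀` modulo `I`, so that the copies of the
hyperplane can be removed one at a time, each lowering the degree by `1`
(`exists_sub_mem_interIdeal_X_pow`, `X_pow_dvd_of_sub_mem_curveIdeal`).
-/

namespace TreesOfLines

open MvPolynomial

/-! ### Division by a form that is monic in `x₀` -/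

section Division

variable {K : Type*} [Field K] {n k : ℕ}

theorem natDegree_finSuccEquiv_of_coeff_ne_zero {F : MvPolynomial (Fin (n + 1)) K}
    (hF : F.IsHomogeneous k) (hc : F.coeff (Finsupp.single 0 k) ≠ 0) :
    (finSuccEquiv K n F).natDegree = k ∧
      (finSuccEquiv K n F).leadingCoeff = C (F.coeff (Finsupp.single 0 k)) := by
  have hle : (finSuccEquiv K n F).natDegree ≤ k := by
    rw [natDegree_finSuccEquiv, degreeOf_le_iff]
    intro m hm
    have h := hF (mem_support_iff.mp hm)
    have h2 := Finsupp.le_weight (1 : Fin (n + 1) → ℕ) (s := 0) (by simp) m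
    exact h2.trans h.le
  have hck : (finSuccEquiv K n F).coeff k = C (F.coeff (Finsupp.single 0 k)) := by
    ext m
    rw [finSuccEquiv_coeff_coeff, coeff_C]
    split_ifs with h
    · subst h
      congr 1
      ext i
      refine Fin.cases ?_ (fun i => ?_) i <;> simp
    · by_contra h0
      have h1 := hF h0
      apply h
      rw [Finsupp.weight_apply, Finsupp.sum_fintype _ _ (by simp), Fin.sum_univ_succ] at h1
      simp only [Finsupp.cons_zero, Pi.one_apply, smul_eq_mul, mul_one, Finsupp.cons_succ] at h1
      have h2 : ∑ i, m i = 0 := by omega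
      ext i
      simpa using ((Finset.sum_eq_zero_iff.mp h2) i (Finset.mem_univ i)).symm
  have hk : k ≤ (finSuccEquiv K n F).natDegree := by
    apply Polynomial.le_natDegree_of_ne_zero
    rw [hck]
    simpa using hc
  have := le_antisymm hle hk
  exact ⟨this, by rw [Polynomial.leadingCoeff, this, hck]⟩

/-- Division with remainder by a form in which the pure power of `x₀` occurs. -/
theorem exists_eq_mul_add_of_coeff_ne_zero {F : MvPolynomial (Fin (n + 1)) K} (hk : 0 < k)
    (hF : F.IsHomogeneous k) (hc : F.coeff (Finsupp.single 0 k) ≠ 0)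
    (f : MvPolynomial (Fin (n + 1)) K) : ∃ q r, f = F * q + r ∧ degreeOf 0 r < k := by
  obtain ⟨h1, h2⟩ := natDegree_finSuccEquiv_of_coeff_ne_zero hF hc
  set c := F.coeff (Finsupp.single 0 k)
  have hmon : (finSuccEquiv K n (C c⁻¹ * F)).Monic := by
    rw [Polynomial.Monic, map_mul]
    have : finSuccEquiv K n (C c⁻¹) = Polynomial.C (C c⁻¹) := by
      rw [← finSuccEquiv_comp_C_eq_C]; simp
    rw [this, Polynomial.leadingCoeff_mul, h2, Polynomial.leadingCoeff_C, ← C_mul,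
      inv_mul_cancel₀ hc, C_1]
  have hd : (finSuccEquiv K n (C c⁻¹ * F)).natDegree = k := by
    rw [← h1, natDegree_finSuccEquiv, natDegree_finSuccEquiv, degreeOf_C_mul]
    exact mem_nonZeroDivisors_of_ne_zero (inv_ne_zero hc)
  refine ⟨C c⁻¹ * (finSuccEquiv K n).symm (finSuccEquiv K n f /ₘ finSuccEquiv K n (C c⁻¹ * F)),
    (finSuccEquiv K n).symm (finSuccEquiv K n f %ₘ finSuccEquiv K n (C c⁻¹ * F)), ?_, ?_⟩
  · apply (finSuccEquiv K n).injective
    conv_lhs => rw [← Polynomial.modByMonic_add_div (finSuccEquiv K n f) (finSuccEquiv K n (C c⁻¹ * F))]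
    simp only [map_add, map_mul, AlgEquiv.apply_symm_apply]
    ring
  · rw [← natDegree_finSuccEquiv, AlgEquiv.apply_symm_apply]
    have := Polynomial.natDegree_modByMonic_lt (finSuccEquiv K n f) hmon
      (fun h => by rw [h] at hd; simp at hd; omega)
    omega

theorem eq_zero_of_dvd_of_degreeOf_lt {F : MvPolynomial (Fin (n + 1)) K}
    (hF : F.IsHomogeneous k) (hc : F.coeff (Finsupp.single 0 k) ≠ 0)
    {r : MvPolynomial (Fin (n + 1)) K} (h : F ∣ r) (hr : degreeOf 0 r < k) : r = 0 := by
  obtain ⟨h1, -⟩ := natDegree_finSuccEquiv_of_coeff_ne_zero hF hc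
  obtain ⟨q, rfl⟩ := h
  by_contra h0
  rw [mul_eq_zero, not_or] at h0
  rw [← natDegree_finSuccEquiv, map_mul, Polynomial.natDegree_mul (by simpa using h0.1)
    (by simpa using h0.2), h1] at hr
  omega

theorem degreeOf_X_pow_mul_le {σ : Type*} {i j : σ} (h : i ≠ j) (N : ℕ) (f : MvPolynomial σ K) :
    degreeOf i (X j ^ N * f) ≤ degreeOf i f := by
  refine (degreeOf_mul_le _ _ _).trans ?_
  have := degreeOf_pow_le i (X j : MvPolynomial σ K) N
  rw [degreeOf_X_of_ne h, mul_zero] at this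
  omega

theorem mem_span_X_pow_of_X_pow_mul_mem {σ : Type*} {A : Set σ} {c : σ} (hcA : c ∉ A) {N : ℕ}
    {f : MvPolynomial σ K} (h : X c ^ N * f ∈ Ideal.span ((fun a => (X a : MvPolynomial σ K) ^ N) '' A)) :
    f ∈ Ideal.span ((fun a => (X a : MvPolynomial σ K) ^ N) '' A) := by
  classical
  have e : (fun a => (X a : MvPolynomial σ K) ^ N) '' A =
      (fun s => monomial s (1 : K)) '' ((fun a => Finsupp.single a N) '' A) := by
    simp only [Set.image_image, X_pow_eq_monomial]
  rw [e, mem_ideal_span_monomial_image] at h ⊢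
  intro m hm
  obtain ⟨_, ⟨a, ha, rfl⟩, hs⟩ := h (Finsupp.single c N + m) (by
    rw [mem_support_iff, X_pow_eq_monomial, coeff_monomial_mul]
    simpa using hm)
  refine ⟨_, ⟨a, ha, rfl⟩, ?_⟩
  have hac : a ≠ c := fun e => hcA (e ▸ ha)
  rw [Finsupp.single_le_iff] at hs ⊢
  simpa [Finsupp.single_apply, hac.symm] using hs

/-- Powers of the variables other than `x₀` form a regular sequence modulo a form in which the pure
power of `x₀` occurs. -/
theorem mem_span_sup_span_of_X_pow_mul_mem {F : MvPolynomial (Fin (n + 1)) K} (hk : 0 < k)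
    (hF : F.IsHomogeneous k) (hc : F.coeff (Finsupp.single 0 k) ≠ 0) {A : Set (Fin (n + 1))}
    {c : Fin (n + 1)} (hA : 0 ∉ A) (hcA : c ∉ A) (hc0 : c ≠ 0) {N : ℕ}
    {f : MvPolynomial (Fin (n + 1)) K}
    (h : X c ^ N * f ∈ Ideal.span {F} ⊔ Ideal.span ((fun a => X a ^ N) '' A)) :
    f ∈ Ideal.span {F} ⊔ Ideal.span ((fun a => X a ^ N) '' A) := by
  -- every element of the second ideal has a reduced representative in that ideal
  have key : ∀ p ∈ Ideal.span ((fun a => (X a : MvPolynomial (Fin (n + 1)) K) ^ N) '' A),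
      ∀ b : MvPolynomial (Fin (n + 1)) K, ∃ r ∈ Ideal.span ((fun a => X a ^ N) '' A),
        degreeOf 0 r < k ∧ F ∣ b * p - r := by
    intro p hp
    induction hp using Submodule.span_induction with
    | mem p hp =>
      obtain ⟨a, ha, rfl⟩ := hp
      intro b
      obtain ⟨q, r, rfl, hr⟩ := exists_eq_mul_add_of_coeff_ne_zero hk hF hc b
      refine ⟨X a ^ N * r, Ideal.mul_mem_right _ _ (Ideal.subset_span ⟨a, ha, rfl⟩), ?_, ?_⟩
      · exact (degreeOf_X_pow_mul_le (fun e : 0 = a => hA (by rwa [e])) _ _).trans_lt hr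
      · exact ⟨q * X a ^ N, by ring⟩
    | zero => exact fun b => ⟨0, zero_mem _, by simpa using hk, by simp⟩
    | add x y _ _ hx hy =>
      intro b
      obtain ⟨r, h1, h2, h3⟩ := hx b
      obtain ⟨r', h1', h2', h3'⟩ := hy b
      refine ⟨r + r', add_mem h1 h1', (degreeOf_add_le _ _ _).trans_lt (max_lt h2 h2'), ?_⟩
      convert dvd_add h3 h3' using 1
      ring
    | smul a x _ hx =>
      intro b
      obtain ⟨r, h1, h2, h3⟩ := hx (b * a)
      exact ⟨r, h1, h2, by rwa [smul_eq_mul, ← mul_assoc]⟩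
  obtain ⟨q, r, rfl, hr⟩ := exists_eq_mul_add_of_coeff_ne_zero hk hF hc f
  obtain ⟨u, hu, p, hp, hup⟩ := Submodule.mem_sup.mp h
  obtain ⟨w, rfl⟩ := Ideal.mem_span_singleton.mp hu
  obtain ⟨r', h1, h2, w', hw'⟩ := key p hp 1
  have hz : X c ^ N * r - r' = 0 := by
    apply eq_zero_of_dvd_of_degreeOf_lt hF hc
    · exact ⟨w + w' - X c ^ N * q, by linear_combination - hup + hw'⟩
    · refine (degreeOf_sub_le _ _ _).trans_lt (max_lt ?_ h2)
      exact (degreeOf_X_pow_mul_le (Ne.symm hc0) _ _).trans_lt hr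
  refine add_mem (Ideal.mem_sup_left (Ideal.mul_mem_right _ _ (Ideal.mem_span_singleton_self F))) ?_
  exact Ideal.mem_sup_right (mem_span_X_pow_of_X_pow_mul_mem hcA (by rwa [sub_eq_zero.mp hz]))

theorem homogeneousComponent_mul_of_isHomogeneous {σ : Type*} {F : MvPolynomial σ K}
    (hF : F.IsHomogeneous k) (q : MvPolynomial σ K) (m : ℕ) :
    homogeneousComponent (m + k) (F * q) = F * homogeneousComponent m q := by
  conv_lhs => rw [← sum_homogeneousComponent q, Finset.mul_sum, map_sum]
  have h : ∀ i, homogeneousComponent (m + k) (F * homogeneousComponent i q) =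
      if m = i then F * homogeneousComponent i q else 0 := by
    intro i
    rw [homogeneousComponent_of_mem (hF.mul (homogeneousComponent_isHomogeneous i q))]
    simp only [add_comm k i, Nat.add_right_cancel_iff]
  simp only [h, Finset.sum_ite_eq, Finset.mem_range]
  split_ifs with h1
  · rfl
  · rw [homogeneousComponent_eq_zero _ _ (by omega), mul_zero]

theorem homogeneousComponent_mul_eq_zero {σ : Type*} {F : MvPolynomial σ K}
    (hF : F.IsHomogeneous k) {q : MvPolynomial σ K} {m : ℕ} (hm : m < k) :
    homogeneousComponent m (F * q) = 0 := by
  conv_lhs => rw [← sum_homogeneousComponent q, Finset.mul_sum, map_sum]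
  refine Finset.sum_eq_zero fun i _ => ?_
  rw [homogeneousComponent_of_mem (hF.mul (homogeneousComponent_isHomogeneous i q)),
    if_neg (by omega)]

/-- A form of degree `t` is congruent modulo `F` to a form of degree `t` whose degree in `x₀` is
smaller than the degree of `F`. -/
theorem exists_homogeneous_remainder {F : MvPolynomial (Fin (n + 1)) K} (hk : 0 < k)
    (hF : F.IsHomogeneous k) (hc : F.coeff (Finsupp.single 0 k) ≠ 0) {t : ℕ}
    {f : MvPolynomial (Fin (n + 1)) K} (hf : f.IsHomogeneous t) :
    ∃ r, r.IsHomogeneous t ∧ (∀ m ∈ r.support, m 0 < k) ∧ F ∣ f - r := by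
  obtain ⟨q, r, rfl, hr⟩ := exists_eq_mul_add_of_coeff_ne_zero hk hF hc f
  refine ⟨homogeneousComponent t r, homogeneousComponent_isHomogeneous t r, ?_, ?_⟩
  · intro m hm
    rw [mem_support_iff, coeff_homogeneousComponent] at hm
    have : m ∈ r.support := by
      rw [mem_support_iff]; intro h; simp [h] at hm
    exact (monomial_le_degreeOf 0 this).trans_lt hr
  · have h1 := homogeneousComponent_of_mem (n := t) (m := t) hf
    rw [if_pos rfl, map_add] at h1
    rw [← h1, add_sub_cancel_right]
    by_cases hkt : k ≤ t
    · obtain ⟨m, rfl⟩ := Nat.exists_eq_add_of_le' hkt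
      rw [homogeneousComponent_mul_of_isHomogeneous hF]
      exact dvd_mul_right _ _
    · rw [homogeneousComponent_mul_eq_zero hF (by omega)]
      exact dvd_zero _

end Division

/-! ### Sections and first cohomology of `𝓞_W(t)` in terms of numerators -/

section Numerators

variable {K : Type*} [Field K] {n k : ℕ} {F : MvPolynomial (Fin (n + 1)) K}

theorem mem_span_singleton_of_X_pow_mul (hk : 0 < k) (hF : F.IsHomogeneous k)
    (hc : F.coeff (Finsupp.single 0 k) ≠ 0) {a : Fin (n + 1)} (ha : a ≠ 0) {N : ℕ}
    {u : MvPolynomial (Fin (n + 1)) K} (h : X a ^ N * u ∈ Ideal.span {F}) :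
    u ∈ Ideal.span {F} := by
  have := mem_span_sup_span_of_X_pow_mul_mem (A := ∅) (N := N) (f := u) hk hF hc
    (Set.notMem_empty _) (Set.notMem_empty _) ha (by simpa using h)
  simpa using this

theorem exists_of_X_pow_mul_sub_mem (hk : 0 < k) (hF : F.IsHomogeneous k)
    (hc : F.coeff (Finsupp.single 0 k) ≠ 0) {a b : Fin (n + 1)} (ha : a ≠ 0) (hb : b ≠ 0)
    (hab : a ≠ b) {N : ℕ} {u v : MvPolynomial (Fin (n + 1)) K}
    (h : X b ^ N * u - X a ^ N * v ∈ Ideal.span {F}) :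
    ∃ w, u - X a ^ N * w ∈ Ideal.span {F} := by
  have := mem_span_sup_span_of_X_pow_mul_mem (A := {a}) (c := b) (N := N) (f := u) hk hF hc
    (by simpa using ha.symm) (by simpa using hab.symm) hb (by
      rw [Set.image_singleton]
      rw [← sub_add_cancel (X b ^ N * u) (X a ^ N * v)]
      exact add_mem (Ideal.mem_sup_left h) (Ideal.mem_sup_right
        (Ideal.mul_mem_right _ _ (Ideal.mem_span_singleton_self _))))
  rw [Set.image_singleton] at this
  obtain ⟨p, hp, q, hq, rfl⟩ := Submodule.mem_sup.mp this
  obtain ⟨w, rfl⟩ := Ideal.mem_span_singleton.mp hq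
  exact ⟨w, by simpa using hp⟩

theorem exists_of_X_pow_mul_sub_sub_mem (hk : 0 < k) (hF : F.IsHomogeneous k)
    (hc : F.coeff (Finsupp.single 0 k) ≠ 0) {a b c : Fin (n + 1)} (ha : a ≠ 0) (hb : b ≠ 0)
    (hc0 : c ≠ 0) (hac : a ≠ c) (hbc : b ≠ c) {N : ℕ} {u v w : MvPolynomial (Fin (n + 1)) K}
    (h : X c ^ N * u - X a ^ N * v - X b ^ N * w ∈ Ideal.span {F}) :
    ∃ v' w', u - X a ^ N * v' - X b ^ N * w' ∈ Ideal.span {F} := by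
  have := mem_span_sup_span_of_X_pow_mul_mem (A := {a, b}) (c := c) (N := N) (f := u) hk hF hc
    (by simp [ha.symm, hb.symm]) (by simp [hac.symm, hbc.symm]) hc0 (by
      rw [Set.image_pair]
      rw [show X c ^ N * u = (X c ^ N * u - X a ^ N * v - X b ^ N * w) +
        (X a ^ N * v + X b ^ N * w) by ring]
      refine add_mem (Ideal.mem_sup_left h) (Ideal.mem_sup_right (add_mem ?_ ?_))
      · exact Ideal.mul_mem_right _ _ (Ideal.subset_span (by simp))
      · exact Ideal.mul_mem_right _ _ (Ideal.subset_span (by simp)))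
  rw [Set.image_pair] at this
  obtain ⟨p, hp, q, hq, rfl⟩ := Submodule.mem_sup.mp this
  obtain ⟨v', w', rfl⟩ := Ideal.mem_span_pair.mp hq
  exact ⟨v', w', by convert hp using 1; ring⟩

theorem homogeneousComponent_mem_span_singleton (hF : F.IsHomogeneous k)
    {u : MvPolynomial (Fin (n + 1)) K} (h : u ∈ Ideal.span {F}) (m : ℕ) :
    homogeneousComponent m u ∈ Ideal.span {F} := by
  obtain ⟨w, rfl⟩ := Ideal.mem_span_singleton.mp h
  by_cases hkt : k ≤ m
  · obtain ⟨m, rfl⟩ := Nat.exists_eq_add_of_le' hkt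
    rw [homogeneousComponent_mul_of_isHomogeneous hF]
    exact Ideal.mul_mem_right _ _ (Ideal.mem_span_singleton_self F)
  · rw [homogeneousComponent_mul_eq_zero hF (by omega)]
    exact zero_mem _

/-- Compatible fractions `g i / x_i ^ N` on `W` are the restrictions of one polynomial:
`H⁰(W, 𝓞_W(t)) = (K[x₀, …, xₙ] / (F))_t`, before taking degrees into account. -/
theorem exists_global_numerator (hk : 0 < k) (hF : F.IsHomogeneous k)
    (hc : F.coeff (Finsupp.single 0 k) ≠ 0) {a b : Fin (n + 1)} (ha : a ≠ 0) (hb : b ≠ 0)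
    (hab : a ≠ b) {N : ℕ} (g : Fin (n + 1) → MvPolynomial (Fin (n + 1)) K)
    (h : ∀ i j, X i ^ N * g j - X j ^ N * g i ∈ Ideal.span {F}) :
    ∃ f, ∀ i, g i - X i ^ N * f ∈ Ideal.span {F} := by
  obtain ⟨f, hf⟩ := exists_of_X_pow_mul_sub_mem hk hF hc ha hb hab (h b a)
  refine ⟨f, fun i => ?_⟩
  apply mem_span_singleton_of_X_pow_mul hk hF hc ha (N := N)
  convert add_mem (h a i) (Ideal.mul_mem_left _ (X i ^ N) hf) using 1
  ring

/-- A Čech `1`-cocycle `g i j / (x_i x_j) ^ N` of `𝓞_W(t)` is a coboundary: `H¹(W, 𝓞_W(t)) = 0`. The proof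
uses only that three of the variables form a regular sequence modulo `F`. -/
theorem exists_numerator_cobounding (hk : 0 < k) (hF : F.IsHomogeneous k)
    (hcF : F.coeff (Finsupp.single 0 k) ≠ 0) {a b c : Fin (n + 1)} (ha : a ≠ 0) (hb : b ≠ 0)
    (hc0 : c ≠ 0) (hab : a ≠ b) (hac : a ≠ c) (hbc : b ≠ c) {N D : ℕ}
    (g : Fin (n + 1) → Fin (n + 1) → MvPolynomial (Fin (n + 1)) K)
    (hg : ∀ i j, (g i j).IsHomogeneous (D + N))
    (h : ∀ i j l, X i ^ N * g j l - X j ^ N * g i l + X l ^ N * g i j ∈ Ideal.span {F}) :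
    ∃ r : Fin (n + 1) → MvPolynomial (Fin (n + 1)) K, (∀ i, (r i).IsHomogeneous D) ∧
      ∀ i j, g i j - (X i ^ N * r j - X j ^ N * r i) ∈ Ideal.span {F} := by
  suffices H : ∃ r : Fin (n + 1) → MvPolynomial (Fin (n + 1)) K,
      ∀ i j, g i j - (X i ^ N * r j - X j ^ N * r i) ∈ Ideal.span {F} by
    obtain ⟨r, hr⟩ := H
    refine ⟨fun i => homogeneousComponent D (r i),
      fun i => homogeneousComponent_isHomogeneous _ _, fun i j => ?_⟩
    have := homogeneousComponent_mem_span_singleton hF (hr i j) (D + N)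
    rw [map_sub, map_sub, homogeneousComponent_eq_self (hg i j),
      homogeneousComponent_mul_of_isHomogeneous (by simpa using (isHomogeneous_X K i).pow N),
      homogeneousComponent_mul_of_isHomogeneous (by simpa using (isHomogeneous_X K j).pow N)] at this
    exact this
  obtain ⟨v, w, hvw⟩ := exists_of_X_pow_mul_sub_sub_mem hk hF hcF ha hb hc0 hac hbc
    (u := g a b) (v := - g b c) (w := g a c) (N := N) (by convert h a b c using 1; ring)
  have hr : ∀ l, ∃ r, g a l - (X a ^ N * r + X l ^ N * w) ∈ Ideal.span {F} := by
    intro l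
    obtain ⟨r, hr⟩ := exists_of_X_pow_mul_sub_mem hk hF hcF ha hb hab (N := N)
      (u := g a l - X l ^ N * w) (v := g b l + X l ^ N * v) (by
        have := sub_mem (Ideal.mul_mem_left _ (X l ^ N) hvw) (h a b l)
        convert this using 1
        ring)
    exact ⟨r, by convert hr using 1; ring⟩
  choose r hr using hr
  refine ⟨r, fun i j => ?_⟩
  apply mem_span_singleton_of_X_pow_mul hk hF hcF ha (N := N)
  have h1 := Ideal.mul_mem_left _ (X j ^ N) (hr i)
  have h2 := Ideal.mul_mem_left _ (X i ^ N) (hr j)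
  have := add_mem (sub_mem (h a i j) h1) h2
  convert this using 1
  ring

end Numerators

/-! ### Vanishing criteria for the Čech cohomology of `𝓘_{Z,W}(t)` -/

section Criteria

variable {K : Type*} [Field K] {n k : ℕ} {F : MvPolynomial (Fin (n + 1)) K}

theorem toLocal_eq_zero_iff {p : ℕ} (σ : Fin (p + 1) → Fin (n + 1))
    (f : MvPolynomial (Fin (n + 1)) K) :
    toLocal F σ f = 0 ↔ ∃ N : ℕ, coverMonomial σ ^ N * f ∈ Ideal.span {F} := by
  change algebraMap (CoordRing F) (LocalRing F σ) (toCoord F f) = 0 ↔ _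
  rw [IsLocalization.map_eq_zero_iff (Submonoid.powers (toCoord F (coverMonomial σ)))]
  constructor
  · rintro ⟨⟨_, N, rfl⟩, h⟩
    refine ⟨N, Ideal.Quotient.eq_zero_iff_mem.mp ?_⟩
    simpa using h
  · rintro ⟨N, h⟩
    refine ⟨⟨_, N, rfl⟩, ?_⟩
    have := Ideal.Quotient.eq_zero_iff_mem.mpr h
    simpa using this

theorem toLocal_eq_zero_of_mem {p : ℕ} (σ : Fin (p + 1) → Fin (n + 1))
    {f : MvPolynomial (Fin (n + 1)) K} (h : f ∈ Ideal.span {F}) : toLocal F σ f = 0 :=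
  (toLocal_eq_zero_iff σ f).mpr ⟨0, by simpa using h⟩

theorem isUnit_toLocal_coverMonomial {p : ℕ} (σ : Fin (p + 1) → Fin (n + 1)) :
    IsUnit (toLocal F σ (coverMonomial σ)) :=
  IsLocalization.Away.algebraMap_isUnit (S := LocalRing F σ) (toCoord F (coverMonomial σ))

theorem coverMonomial_isHomogeneous {p : ℕ} (σ : Fin (p + 1) → Fin (n + 1)) :
    (coverMonomial σ : MvPolynomial (Fin (n + 1)) K).IsHomogeneous (p + 1) := by
  simpa [coverMonomial] using MvPolynomial.IsHomogeneous.prod Finset.univ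
    (fun a => (MvPolynomial.X (σ a) : MvPolynomial (Fin (n + 1)) K)) (fun _ => 1)
    (fun a _ => MvPolynomial.isHomogeneous_X K (σ a))

/-- The exponent of the denominator of a section can be enlarged at will. -/
theorem exists_numerator {I : Ideal (MvPolynomial (Fin (n + 1)) K)} {t : ℤ} {p : ℕ}
    {σ : Fin (p + 1) → Fin (n + 1)} {s : LocalRing F σ} (hs : s ∈ idealSections F I t σ) :
    ∃ A : ℕ, ∀ N, A ≤ N → ∃ f ∈ I, (∀ D : ℕ, (D : ℤ) = t + N * (p + 1) → f.IsHomogeneous D) ∧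
      s * toLocal F σ (coverMonomial σ) ^ N = toLocal F σ f := by
  obtain ⟨a, m, f, hf, hfm, hm, h⟩ := hs
  refine ⟨a, fun N hN => ?_⟩
  obtain ⟨c, rfl⟩ := Nat.exists_eq_add_of_le hN
  refine ⟨f * coverMonomial σ ^ c, I.mul_mem_right _ hf, fun D hD => ?_, ?_⟩
  · have e : D = m + (p + 1) * c := by
      zify; rw [hD, hm]; push_cast; ring
    rw [e]
    exact hfm.mul ((coverMonomial_isHomogeneous σ).pow c)
  · rw [map_mul, map_pow, ← h]; ring

/-- The numerators of a cocycle satisfy the cocycle relation modulo `F`, once the common exponent of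
their denominators is large. -/
theorem exists_numerators_of_mem_ker {I : Ideal (MvPolynomial (Fin (n + 1)) K)} {t : ℤ} {p : ℕ}
    {s : CechCochain F I t p} (hs : cechDifferential F I t p s = 0) (A : ℕ) :
    ∃ N, A ≤ N ∧ ∃ g : (Fin (p + 1) → Fin (n + 1)) → MvPolynomial (Fin (n + 1)) K,
      (∀ τ, g τ ∈ I ∧ (∀ D : ℕ, (D : ℤ) = t + N * (p + 1) → (g τ).IsHomogeneous D) ∧
        (s τ : LocalRing F τ) * toLocal F τ (coverMonomial τ) ^ N = toLocal F τ (g τ)) ∧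
      ∀ σ : Fin (p + 2) → Fin (n + 1), ∑ b : Fin (p + 2),
        (-1) ^ (b : ℕ) * (X (σ b) ^ N * g (σ ∘ b.succAbove)) ∈ Ideal.span {F} := by
  choose B hB using fun τ => exists_numerator (s τ).2
  set N₀ := A + t.natAbs + ∑ τ, B τ
  have hBN : ∀ τ, B τ ≤ N₀ := fun τ =>
    (Finset.single_le_sum (f := B) (fun _ _ => Nat.zero_le _) (Finset.mem_univ τ)).trans
      (Nat.le_add_left _ _)
  choose g hgI hgD hg using fun τ => hB τ N₀ (hBN τ)
  have hrel : ∀ σ : Fin (p + 2) → Fin (n + 1), toLocal F σ (∑ b : Fin (p + 2),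
      (-1) ^ (b : ℕ) * (X (σ b) ^ N₀ * g (σ ∘ b.succAbove))) = 0 := by
    intro σ
    have h : ∑ b : Fin (p + 2), (-1 : ℤ) ^ (b : ℕ) •
        restrict F σ b (s (σ ∘ b.succAbove) : LocalRing F (σ ∘ b.succAbove)) = 0 :=
      congrArg Subtype.val (congrFun hs σ)
    rw [map_sum]
    have h2 := congrArg (· * toLocal F σ (coverMonomial σ) ^ N₀) h
    simp only [zero_mul, Finset.sum_mul] at h2
    rw [← h2]
    refine Finset.sum_congr rfl fun b _ => ?_
    have h3 := congrArg (restrict F σ b) (hg (σ ∘ b.succAbove))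
    rw [map_mul, map_pow, restrict_toLocal, restrict_toLocal] at h3
    rw [map_mul, map_mul, ← h3, coverMonomial_succAbove σ b, map_mul, zsmul_eq_mul]
    simp only [map_pow, map_neg, map_one]
    push_cast
    ring
  choose E hE using fun σ => (toLocal_eq_zero_iff σ _).mp (hrel σ)
  set N₁ := ∑ σ, E σ
  refine ⟨N₀ + N₁, by omega, fun τ => coverMonomial τ ^ N₁ * g τ, fun τ => ⟨?_, ?_, ?_⟩, ?_⟩
  · exact I.mul_mem_left _ (hgI τ)
  · intro D hD
    obtain ⟨D', hD'⟩ : ∃ D' : ℕ, (D' : ℤ) = t + N₀ * (p + 1) := by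
      refine ⟨_, Int.toNat_of_nonneg ?_⟩
      have h1 : -t ≤ (N₀ : ℤ) := by omega
      have h2 : (0 : ℤ) ≤ N₀ * p := by positivity
      linarith
    have e : D = (p + 1) * N₁ + D' := by
      zify; rw [hD, hD']; push_cast; ring
    rw [e]
    exact ((coverMonomial_isHomogeneous τ).pow N₁).mul (hgD τ D' hD')
  · rw [map_mul, map_pow, ← hg]; ring
  · intro σ
    have h := hE σ
    have hle : E σ ≤ N₁ := Finset.single_le_sum (f := E) (fun _ _ => Nat.zero_le _) (Finset.mem_univ σ)
    have h' := Ideal.mul_mem_left _ (coverMonomial σ ^ (N₁ - E σ)) h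
    rw [← mul_assoc, ← pow_add, Nat.sub_add_cancel hle, Finset.mul_sum] at h'
    convert h' using 1
    refine Finset.sum_congr rfl fun b _ => ?_
    rw [coverMonomial_succAbove σ b]
    ring

/-- A global section of `𝓘_{Z,W}(t)` is a form `f` modulo `F` with `x_b ^ N * f ∈ I` for some `N`. -/
theorem hCoh_zero_eq_zero (hn : 2 ≤ n) (hk : 0 < k) (hF : F.IsHomogeneous k)
    (hc : F.coeff (Finsupp.single 0 k) ≠ 0) {I : Ideal (MvPolynomial (Fin (n + 1)) K)}
    {t : ℤ} (b : Fin (n + 1)) (hI : F ∈ I)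
    (h : ∀ m : ℕ, (m : ℤ) = t → ∀ f : MvPolynomial (Fin (n + 1)) K, f.IsHomogeneous m →
      ∀ N : ℕ, X b ^ N * f ∈ I → f ∈ Ideal.span {F}) :
    hCoh F I t 0 = 0 := by
  have hIF : Ideal.span {F} ≤ I := (Ideal.span_singleton_le_iff_mem I).mpr hI
  change Module.rank K (LinearMap.ker (cechDifferential F I t 0)) = 0
  rw [rank_zero_iff, Submodule.subsingleton_iff_eq_bot, LinearMap.ker_eq_bot']
  intro s hs
  obtain ⟨N, hN, g, hg, hrel⟩ := exists_numerators_of_mem_ker hs t.natAbs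
  set G : Fin (n + 1) → MvPolynomial (Fin (n + 1)) K := fun i => g (fun _ => i)
  have hG : ∀ i j, X i ^ N * G j - X j ^ N * G i ∈ Ideal.span {F} := by
    intro i j
    convert hrel ![i, j] using 1
    rw [Fin.sum_univ_two]
    have e0 : (![i, j] ∘ (0 : Fin 2).succAbove : Fin 1 → Fin (n + 1)) = fun _ => j := by
      funext x; fin_cases x; rfl
    have e1 : (![i, j] ∘ (1 : Fin 2).succAbove : Fin 1 → Fin (n + 1)) = fun _ => i := by
      funext x; fin_cases x; rfl
    simp only [e0, e1, G]
    simp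
    ring
  obtain ⟨f, hf⟩ := exists_global_numerator hk hF hc (a := ⟨1, by omega⟩) (b := ⟨2, by omega⟩)
    (by simp [Fin.ext_iff]) (by simp [Fin.ext_iff]) (by simp [Fin.ext_iff]) G hG
  have hGF : ∀ i, G i ∈ Ideal.span {F} := by
    obtain ⟨D, hD⟩ : ∃ D : ℕ, (D : ℤ) = t + N := ⟨(t + N).toNat, Int.toNat_of_nonneg (by omega)⟩
    have hGD : ∀ i, (G i).IsHomogeneous D := fun i => (hg _).2.1 D (by push_cast; linarith)
    have hcomp : ∀ i, G i - homogeneousComponent D (X i ^ N * f) ∈ Ideal.span {F} := fun i => by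
      have := homogeneousComponent_mem_span_singleton hF (hf i) D
      rwa [map_sub, homogeneousComponent_eq_self (hGD i)] at this
    by_cases ht : 0 ≤ t
    · obtain ⟨m, rfl⟩ := Int.eq_ofNat_of_zero_le ht
      obtain rfl : D = m + N := by omega
      have hcomp' : ∀ i, G i - X i ^ N * homogeneousComponent m f ∈ Ideal.span {F} := fun i => by
        have := hcomp i
        rwa [homogeneousComponent_mul_of_isHomogeneous
          (by simpa using (isHomogeneous_X K i).pow N)] at this
      have hm := h m rfl _ (homogeneousComponent_isHomogeneous m f) N (by
        have := sub_mem (hg fun _ => b).1 (hIF (hcomp' b))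
        simpa [G] using this)
      intro i
      simpa using add_mem (hcomp' i) (Ideal.mul_mem_left _ (X i ^ N) hm)
    · intro i
      have := hcomp i
      rwa [homogeneousComponent_mul_eq_zero (by simpa using (isHomogeneous_X K i).pow N)
        (by omega), sub_zero] at this
  funext τ
  apply Subtype.ext
  have h1 := (hg τ).2.2
  have e : τ = fun _ => τ 0 := by funext x; fin_cases x; rfl
  have h2 : g τ ∈ Ideal.span {F} := by
    have := hGF (τ 0)
    simp only [G] at this
    rwa [← e] at this
  rw [toLocal_eq_zero_of_mem τ h2] at h1
  exact ((isUnit_toLocal_coverMonomial τ).pow N).mul_left_eq_zero.mp h1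

/-- A cocycle of `𝓘_{Z,W}(t)` bounds a cochain of `𝓞_W(t)`, whose failure to lie in `𝓘_{Z,W}(t)` is a section
of `𝓞_Z(t)`. As `x_b` is injective on the coordinate ring of `Z` in large degrees, such a section is a
form divided by a power of `x_b`, and surjectivity turns it into the restriction of a form of degree `t`,
by which the cochain is corrected. -/
theorem hCoh_one_eq_zero (hn : 3 ≤ n) (hk : 0 < k) (hF : F.IsHomogeneous k)
    (hc : F.coeff (Finsupp.single 0 k) ≠ 0) {I : Ideal (MvPolynomial (Fin (n + 1)) K)}
    {t M : ℕ} (b : Fin (n + 1)) (hI : F ∈ I)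
    (hinj : ∀ m : ℕ, M ≤ m → ∀ f : MvPolynomial (Fin (n + 1)) K, f.IsHomogeneous m →
      X b * f ∈ I → f ∈ I)
    (hsurj : ∀ a : ℕ, M ≤ t + a → ∀ f : MvPolynomial (Fin (n + 1)) K, f.IsHomogeneous (t + a) →
      ∃ h : MvPolynomial (Fin (n + 1)) K, h.IsHomogeneous t ∧ f - X b ^ a * h ∈ I) :
    hCoh F I t 1 = 0 := by
  have hIF : Ideal.span {F} ≤ I := (Ideal.span_singleton_le_iff_mem I).mpr hI
  change Module.rank K (LinearMap.ker (cechDifferential F I t 1) ⧸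
      (LinearMap.range (cechDifferential F I t 0)).submoduleOf
        (LinearMap.ker (cechDifferential F I t 1))) = 0
  rw [rank_zero_iff, Submodule.Quotient.subsingleton_iff, eq_top_iff]
  rintro ⟨s, hs⟩ -
  rw [Submodule.submoduleOf, Submodule.mem_comap, Submodule.subtype_apply]
  obtain ⟨N, hN, g, hg, hrel⟩ := exists_numerators_of_mem_ker (LinearMap.mem_ker.mp hs) M
  have hpow : ∀ i, (X i ^ N : MvPolynomial (Fin (n + 1)) K).IsHomogeneous N := fun i => by
    simpa using (isHomogeneous_X K i).pow N
  have hpair : ∀ τ : Fin 2 → Fin (n + 1), τ = ![τ 0, τ 1] := fun τ => by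
    funext x; fin_cases x <;> rfl
  obtain ⟨r, hr, hgr⟩ := exists_numerator_cobounding hk hF hc (a := ⟨1, by omega⟩)
    (b := ⟨2, by omega⟩) (c := ⟨3, by omega⟩) (by simp [Fin.ext_iff]) (by simp [Fin.ext_iff])
    (by simp [Fin.ext_iff]) (by simp [Fin.ext_iff]) (by simp [Fin.ext_iff]) (by simp [Fin.ext_iff])
    (N := N) (D := t + N) (fun i j => g ![i, j])
    (fun i j => (hg _).2.1 _ (by push_cast; ring)) (fun i j l => by
      convert hrel ![i, j, l] using 1
      rw [Fin.sum_univ_three]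
      have e0 : (![i, j, l] ∘ (0 : Fin 3).succAbove : Fin 2 → Fin (n + 1)) = ![j, l] := by
        funext x; fin_cases x <;> rfl
      have e1 : (![i, j, l] ∘ (1 : Fin 3).succAbove : Fin 2 → Fin (n + 1)) = ![i, l] := by
        funext x; fin_cases x <;> rfl
      have e2 : (![i, j, l] ∘ (2 : Fin 3).succAbove : Fin 2 → Fin (n + 1)) = ![i, j] := by
        funext x; fin_cases x <;> rfl
      simp only [e0, e1, e2]
      simp
      ring)
  -- subtract a global form to move the cochain `r` into the ideal
  obtain ⟨f, hf, hfI⟩ := hsurj N (by omega) (r b) (hr b)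
  have hinjN : ∀ N m : ℕ, M ≤ m → ∀ f : MvPolynomial (Fin (n + 1)) K, f.IsHomogeneous m →
      X b ^ N * f ∈ I → f ∈ I := by
    intro N
    induction N with
    | zero => intro m _ f _ h; simpa using h
    | succ N ih =>
      intro m hm f hf h
      refine hinj m hm f hf (ih (m + 1) (by omega) _ (by simpa [add_comm] using (isHomogeneous_X K b).mul hf) ?_)
      rwa [← mul_assoc, ← pow_succ]
  set r' : Fin (n + 1) → MvPolynomial (Fin (n + 1)) K := fun i => r i - X i ^ N * f
  have hr'D : ∀ i, (r' i).IsHomogeneous (t + N) := fun i =>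
    (hr i).sub (by simpa [add_comm] using (hpow i).mul hf)
  have hgr' : ∀ i j, g ![i, j] - (X i ^ N * r' j - X j ^ N * r' i) ∈ Ideal.span {F} := by
    intro i j
    convert hgr i j using 1
    simp only [r']
    ring
  have hr'I : ∀ i, r' i ∈ I := by
    intro i
    apply hinjN N (t + N) (by omega) _ (hr'D i)
    have := sub_mem (hg ![b, i]).1 (hIF (hgr' b i))
    rw [sub_sub_cancel] at this
    convert add_mem this (Ideal.mul_mem_left _ (X i ^ N) hfI) using 1
    simp only [r']
    ring
  have hu : ∀ σ : Fin 1 → Fin (n + 1), ∃ x : LocalRing F σ,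
      x * toLocal F σ (coverMonomial σ) ^ N = toLocal F σ (r' (σ 0)) := by
    intro σ
    obtain ⟨u, hu⟩ := (isUnit_toLocal_coverMonomial (F := F) σ).pow N
    exact ⟨toLocal F σ (r' (σ 0)) * ↑u⁻¹, by rw [← hu, mul_assoc, Units.inv_mul, mul_one]⟩
  choose x hx using hu
  refine ⟨fun σ => ⟨x σ, N, t + N, r' (σ 0), hr'I _, hr'D _, by push_cast; ring, hx σ⟩, ?_⟩
  funext τ
  apply Subtype.ext
  change ∑ b : Fin 2, (-1 : ℤ) ^ (b : ℕ) • restrict F τ b (x (τ ∘ b.succAbove)) = (s τ).1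
  apply ((isUnit_toLocal_coverMonomial τ).pow N).mul_right_cancel
  rw [(hg τ).2.2, Finset.sum_mul]
  have key : ∀ b : Fin 2, restrict F τ b (x (τ ∘ b.succAbove)) *
      toLocal F τ (coverMonomial τ) ^ N =
        toLocal F τ (X (τ b) ^ N * r' (τ (b.succAbove 0))) := by
    intro b
    have h3 := congrArg (restrict F τ b) (hx (τ ∘ b.succAbove))
    rw [map_mul, map_pow, restrict_toLocal, restrict_toLocal] at h3
    rw [map_mul, ← Function.comp_apply (f := τ), ← h3, coverMonomial_succAbove τ b, map_mul,
      map_pow]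
    ring
  simp only [smul_mul_assoc, key]
  rw [Fin.sum_univ_two]
  have h4 := toLocal_eq_zero_of_mem τ (hgr' (τ 0) (τ 1))
  rw [← hpair τ, map_sub, sub_eq_zero] at h4
  rw [h4, map_sub]
  simp [sub_eq_add_neg]

end Criteria

/-! ### Forms on lines -/

section Forms

variable {K : Type*} [Field K] {σ : Type*}

theorem eval_smul_of_isHomogeneous {m : ℕ} {f : MvPolynomial σ K} (hf : f.IsHomogeneous m) (c : K)
    (x : σ → K) : eval (c • x) f = c ^ m * eval x f := by
  rw [eval_eq, eval_eq, Finset.mul_sum]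
  refine Finset.sum_congr rfl fun s hs => ?_
  have h : s.degree = m := by
    rw [← hf (mem_support_iff.mp hs), Finsupp.degree_eq_weight_one]
    rfl
  simp only [Pi.smul_apply, smul_eq_mul, mul_pow, Finset.prod_mul_distrib]
  rw [Finset.prod_pow_eq_pow_sum, ← h, Finsupp.degree_apply]
  ring

/-- A linear functional as a form of degree `1`, separating a point from a subspace. -/
theorem exists_linearForm [Fintype σ] {W : Submodule K (σ → K)} {y : σ → K} (hy : y ∉ W) :
    ∃ f : MvPolynomial σ K, f.IsHomogeneous 1 ∧ eval y f ≠ 0 ∧ ∀ x ∈ W, eval x f = 0 := by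
  classical
  obtain ⟨φ, hφy, hφ⟩ := Submodule.exists_le_ker_of_notMem hy
  have he : ∀ x, eval x (∑ j, C (φ (Pi.single j 1)) * X j : MvPolynomial σ K) = φ x := by
    intro x
    conv_rhs => rw [← Finset.univ_sum_single x]
    simp only [map_sum, map_mul, eval_C, eval_X]
    refine Finset.sum_congr rfl fun j _ => ?_
    rw [mul_comm, ← smul_eq_mul, ← map_smul, ← Pi.single_smul]
    simp
  refine ⟨∑ j, C (φ (Pi.single j 1)) * X j, ?_, by rwa [he], fun x hx => by
    rw [he]; exact hφ hx⟩
  exact IsHomogeneous.sum _ _ _ fun j _ => isHomogeneous_C_mul_X _ _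

/-- The restriction of a polynomial to the affine line `{x + T y}`. -/
theorem exists_polynomial_eval_add_smul {m : ℕ} {f : MvPolynomial σ K} (hf : f.IsHomogeneous m)
    (x y : σ → K) : ∃ Q : Polynomial K, Q.natDegree ≤ m ∧ ∀ c, Q.eval c = eval (x + c • y) f := by
  refine ⟨aeval (fun j => Polynomial.C (y j) * Polynomial.X + Polynomial.C (x j)) f, ?_, ?_⟩
  · simpa using aeval_natDegree_le (m := m) (n := 1) f hf.totalDegree_le _
      fun i => Polynomial.natDegree_linear_le
  · intro c
    rw [← Polynomial.coe_evalRingHom, aeval_def, ← coe_eval₂Hom, ← RingHom.comp_apply, eval,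
      ← RingHom.comp_id (Polynomial.evalRingHom c)]
    congr 1
    ext j
    · simp
    · simp; ring

variable [Infinite K]

/-- A form of degree `m` vanishes on a line as soon as it vanishes at `m + 1` points of it. -/
theorem eval_eq_zero_of_eval_points {m : ℕ} {f : MvPolynomial σ K} (hf : f.IsHomogeneous m)
    {p w : σ → K} {a : Fin (m + 1) → K} (ha : Function.Injective a)
    (h : ∀ l, eval (p + a l • w) f = 0) (b c : K) : eval (b • p + c • w) f = 0 := by
  have h1 : ∀ c : K, eval (p + c • w) f = 0 := by
    obtain ⟨Q, hQ, hQe⟩ := exists_polynomial_eval_add_smul hf p w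
    have := Polynomial.eq_zero_of_natDegree_lt_card_of_eval_eq_zero Q ha
      (fun i => by rw [hQe, h]) (by simpa using Nat.lt_succ_of_le hQ)
    intro c
    rw [← hQe, this, Polynomial.eval_zero]
  have h2 : ∀ b : K, b ≠ 0 → eval (c • w + b • p) f = 0 := by
    intro b hb
    have : c • w + b • p = b • (p + (b⁻¹ * c) • w) := by
      rw [smul_add, smul_smul, mul_inv_cancel_left₀ hb, add_comm]
    rw [this, eval_smul_of_isHomogeneous hf, h1, mul_zero]
  obtain ⟨Q, hQ, hQe⟩ := exists_polynomial_eval_add_smul hf (c • w) p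
  have : Q = 0 := by
    refine Polynomial.eq_zero_of_infinite_isRoot Q (Set.Infinite.mono (s := {0}ᶜ) ?_
      (Set.Finite.infinite_compl (Set.finite_singleton (0 : K))))
    intro b hb
    simp only [Set.mem_ofPred_eq, Polynomial.IsRoot, hQe]
    exact h2 b hb
  rw [add_comm, ← hQe, this, Polynomial.eval_zero]

/-- On a line there are `m + 1` distinct points, the first of them given, that detect forms of degree
`m`. -/
theorem exists_points_on_line {L : Submodule K (σ → K)} (hL : Module.finrank K L = 2)
    {p : σ → K} (hp : p ∈ L) (hp0 : p ≠ 0) (m : ℕ) :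
    ∃ z : Fin (m + 1) → σ → K, z 0 = p ∧ (∀ l, z l ∈ L) ∧
      (∀ l l', l ≠ l' → z l ∉ Submodule.span K {z l'}) ∧
      ∀ f : MvPolynomial σ K, f.IsHomogeneous m → (∀ l, eval (z l) f = 0) →
        ∀ y ∈ L, eval y f = 0 := by
  have : Module.Finite K L := Module.finite_of_finrank_pos (by omega)
  obtain ⟨w, hw, hwp⟩ : ∃ w ∈ L, w ∉ Submodule.span K {p} := by
    by_contra! hcon
    have h1 := Submodule.finrank_mono (show L ≤ Submodule.span K {p} from hcon)
    have h2 := finrank_span_singleton (K := K) hp0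
    omega
  have hli : LinearIndependent K ![p, w] := by
    rw [LinearIndependent.pair_iff]
    intro s t h
    have ht : t = 0 := by
      by_contra ht
      apply hwp
      rw [Submodule.mem_span_singleton]
      refine ⟨-(t⁻¹ * s), ?_⟩
      have : t • w = - (s • p) := eq_neg_of_add_eq_zero_right h
      rw [neg_smul, mul_smul, ← smul_neg, ← this, smul_smul, inv_mul_cancel₀ ht, one_smul]
    subst ht
    simpa [hp0] using h
  have hspan : L = Submodule.span K {p, w} := by
    symm
    apply Submodule.eq_of_le_of_finrank_eq
    · rw [Submodule.span_le, Set.insert_subset_iff, Set.singleton_subset_iff]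
      exact ⟨hp, hw⟩
    · have := finrank_span_eq_card hli
      rw [Matrix.range_cons, Matrix.range_cons, Matrix.range_empty, Set.union_empty,
        Set.singleton_union] at this
      rw [this, hL]; simp
  obtain ⟨a, ha, ha0⟩ : ∃ a : Fin (m + 1) → K, Function.Injective a ∧ a 0 = 0 := by
    let e : ℕ ↪ K := Infinite.natEmbedding K
    exact ⟨fun l => e l - e 0, fun l l' h => by simpa [Fin.ext_iff] using h, by simp⟩
  refine ⟨fun l => p + a l • w, by simp [ha0], fun l => L.add_mem hp (L.smul_mem _ hw), ?_, ?_⟩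
  · intro l l' hll h
    obtain ⟨c, hc⟩ := Submodule.mem_span_singleton.mp h
    have := (LinearIndependent.pair_iff.mp hli) (c - 1) (c * a l' - a l) (by
      rw [sub_smul, sub_smul, one_smul, mul_smul]
      rw [smul_add] at hc
      linear_combination (exp := 1) hc)
    apply hll
    apply ha
    have h1 : c = 1 := by linear_combination this.1
    have := this.2
    rw [h1] at this
    linear_combination -this
  · intro f hf h y hy
    rw [hspan] at hy
    obtain ⟨b, c, rfl⟩ := Submodule.mem_span_pair.mp hy
    exact eval_eq_zero_of_eval_points hf ha h b c

end Forms

/-! ### The Hilbert function of a tree -/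

section Hilbert

variable {K : Type*} [Field K] {n d : ℕ} {τ : {i : Fin d // 0 < (i : ℕ)} → Fin d}
  {L : Fin d → Submodule K (Fin (n + 1) → K)}

theorem IsTreeOfType.inf_eq_bot (hT : IsTreeOfType τ L) {i j : Fin d} (hj : j < i)
    (h : ∀ hi : 0 < (i : ℕ), j ≠ τ ⟨i, hi⟩) : L i ⊓ L j = ⊥ := by
  have hi : 0 < (i : ℕ) := lt_of_le_of_lt (Nat.zero_le _) hj
  by_contra h0
  exact h hi ((hT.type_eq ⟨i, hi⟩ j hj).mp h0)

/-- The common point of a line and its predecessor. -/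
theorem IsTreeOfType.exists_node (hT : IsTreeOfType τ L) (hτ : ∀ i, τ i < i.1) (i : Fin d) :
    ∃ p ∈ L i, p ≠ 0 ∧ ∀ hi : 0 < (i : ℕ), p ∈ L (τ ⟨i, hi⟩) ∧
      L i ⊓ L (τ ⟨i, hi⟩) ≤ Submodule.span K {p} := by
  by_cases hi : 0 < (i : ℕ)
  · obtain ⟨p, hp, hp0⟩ := Submodule.exists_mem_ne_zero_of_ne_bot
      ((hT.type_eq ⟨i, hi⟩ _ (hτ ⟨i, hi⟩)).mpr rfl)
    refine ⟨p, hp.1, hp0, fun _ => ⟨hp.2, ?_⟩⟩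
    have : Module.Finite K (L i) := Module.finite_of_finrank_pos (by rw [hT.isTree.isLine]; omega)
    have hlt : L i ⊓ L (τ ⟨i, hi⟩) < L i := by
      refine lt_of_le_of_ne inf_le_left fun h => ?_
      have h1 : L i ≤ L (τ ⟨i, hi⟩) := inf_eq_left.mp h
      have h2 := Submodule.eq_of_le_of_finrank_eq h1
        (by rw [hT.isTree.isLine, hT.isTree.isLine])
      exact (hτ ⟨i, hi⟩).ne' (hT.isTree.distinct h2)
    have h1 := Submodule.finrank_lt_finrank_of_lt hlt
    rw [hT.isTree.isLine] at h1
    have h2 : Submodule.span K {p} ≤ L i ⊓ L (τ ⟨i, hi⟩) := by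
      rw [Submodule.span_le, Set.singleton_subset_iff]; exact hp
    refine (Submodule.eq_of_le_of_finrank_le h2 ?_).ge
    rw [finrank_span_singleton hp0]
    omega
  · obtain ⟨p, hp, hp0⟩ := Submodule.exists_mem_ne_zero_of_ne_bot (p := L i) (fun h => by
      have := hT.isTree.isLine i
      rw [h] at this
      simp at this)
    exact ⟨p, hp, hp0, fun h => absurd h hi⟩

/-- Points of the `i`-th line that detect forms of degree `m`, the first being the node with the
preceding lines, and forms dual to them that vanish on the preceding lines. Each such form is a product
of `m` linear forms, one for each remaining point; the linear forms are chosen to vanish also on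
preceding lines. -/
theorem IsTreeOfType.exists_points_and_dual_forms [Infinite K] (hT : IsTreeOfType τ L)
    (hτ : ∀ i, τ i < i.1) {m : ℕ} (hm : d ≤ m + 1) (i : Fin d) :
    ∃ z : Fin (m + 1) → Fin (n + 1) → K, (∀ l, z l ∈ L i) ∧
      (∀ hi : 0 < (i : ℕ), z 0 ∈ L (τ ⟨i, hi⟩)) ∧
      (∀ f : MvPolynomial (Fin (n + 1)) K, f.IsHomogeneous m → (∀ l, eval (z l) f = 0) →
        ∀ y ∈ L i, eval y f = 0) ∧
      ∀ l, (l = 0 → (i : ℕ) = 0) → ∃ f : MvPolynomial (Fin (n + 1)) K, f.IsHomogeneous m ∧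
        eval (z l) f = 1 ∧ (∀ l', l' ≠ l → eval (z l') f = 0) ∧
        ∀ j < i, ∀ y ∈ L j, eval y f = 0 := by
  classical
  obtain ⟨p, hp, hp0, hnode⟩ := hT.exists_node hτ i
  obtain ⟨z, hz0, hzL, hzz, hdet⟩ := exists_points_on_line (hT.isTree.isLine i) hp hp0 m
  refine ⟨z, hzL, fun hi => hz0 ▸ (hnode hi).1, hdet, fun l hl => ?_⟩
  -- distribute the preceding lines other than the one through the node among the other points
  obtain ⟨e⟩ : Nonempty ({j : Fin d // j < i ∧ ∀ hi : 0 < (i : ℕ), j ≠ τ ⟨i, hi⟩} ↪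
      {l' : Fin (m + 1) // l' ≠ 0 ∧ l' ≠ l}) := by
    apply Function.Embedding.nonempty_of_card_le
    by_cases hi : 0 < (i : ℕ)
    · have h1 : Fintype.card {j : Fin d // j < i ∧ ∀ hi : 0 < (i : ℕ), j ≠ τ ⟨i, hi⟩} = i - 1 := by
        rw [Fintype.card_subtype]
        have : (Finset.univ.filter fun j : Fin d => j < i ∧ ∀ hi : 0 < (i : ℕ), j ≠ τ ⟨i, hi⟩) =
            (Finset.Iio i).erase (τ ⟨i, hi⟩) := by
          ext j
          simp [hi, and_comm]
        rw [this, Finset.card_erase_of_mem (by simpa using hτ ⟨i, hi⟩)]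
        simp
      have h2 : Fintype.card {l' : Fin (m + 1) // l' ≠ 0 ∧ l' ≠ l} = m - 1 := by
        rw [Fintype.card_subtype]
        have : (Finset.univ.filter fun l' : Fin (m + 1) => l' ≠ 0 ∧ l' ≠ l) =
            (Finset.univ.erase 0).erase l := by
          ext j
          simp [and_comm]
        rw [this, Finset.card_erase_of_mem, Finset.card_erase_of_mem (Finset.mem_univ _)]
        · simp
        · simp only [Finset.mem_erase, Finset.mem_univ, and_true]
          exact fun h => hi.ne' (hl h)
      rw [h1, h2]
      have := i.2
      omega
    · have : IsEmpty {j : Fin d // j < i ∧ ∀ hi : 0 < (i : ℕ), j ≠ τ ⟨i, hi⟩} :=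
        ⟨fun j => hi (lt_of_le_of_lt (Nat.zero_le _) j.2.1)⟩
      simp
  have hlin : ∀ l', l' ≠ l → ∃ f : MvPolynomial (Fin (n + 1)) K, f.IsHomogeneous 1 ∧
      eval (z l) f ≠ 0 ∧ eval (z l') f = 0 ∧
      (∀ hi : 0 < (i : ℕ), l' = 0 → ∀ y ∈ L (τ ⟨i, hi⟩), eval y f = 0) ∧
      ∀ j, (e j : Fin (m + 1)) = l' → ∀ y ∈ L j, eval y f = 0 := by
    intro l' hl'
    by_cases h : ∃ j, (e j : Fin (m + 1)) = l'
    · obtain ⟨j, hj⟩ := h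
      obtain ⟨f, hf, hfz, hfW⟩ := exists_linearForm (W := Submodule.span K {z l'} ⊔ L j)
        (y := z l) (by
          intro hmem
          obtain ⟨x, hx, y, hy, hxy⟩ := Submodule.mem_sup.mp hmem
          have hyi : y ∈ L i ⊓ L j := by
            refine ⟨?_, hy⟩
            rw [← eq_sub_iff_add_eq'] at hxy
            rw [hxy]
            refine sub_mem (hzL l) ?_
            exact (Submodule.span_le.mpr (Set.singleton_subset_iff.mpr (hzL l'))) hx
          rw [hT.inf_eq_bot j.2.1 j.2.2, Submodule.mem_bot] at hyi
          rw [hyi, add_zero] at hxy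
          exact hzz l l' hl'.symm (hxy ▸ hx))
      refine ⟨f, hf, hfz, hfW _ (Submodule.mem_sup_left (Submodule.mem_span_singleton_self _)),
        fun hi h0 => ?_, fun j' hj' y hy => ?_⟩
      · exact absurd (hj.trans h0) (e j).2.1
      · have : j' = j := e.injective (Subtype.ext (hj'.trans hj.symm))
        subst this
        exact hfW _ (Submodule.mem_sup_right hy)
    · by_cases h0 : l' = 0 ∧ 0 < (i : ℕ)
      · obtain ⟨rfl, hi⟩ := h0
        obtain ⟨f, hf, hfz, hfW⟩ := exists_linearForm (W := L (τ ⟨i, hi⟩)) (y := z l) (by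
          intro hmem
          exact hzz l 0 hl'.symm (hz0 ▸ (hnode hi).2 ⟨hzL l, hmem⟩))
        exact ⟨f, hf, hfz, hfW _ (hz0 ▸ (hnode hi).1), fun _ _ => hfW,
          fun j hj => absurd ⟨j, hj⟩ h⟩
      · obtain ⟨f, hf, hfz, hfW⟩ := exists_linearForm (hzz l l' hl'.symm)
        exact ⟨f, hf, hfz, hfW _ (Submodule.mem_span_singleton_self _),
          fun hi h1 => absurd ⟨h1, hi⟩ h0, fun j hj => absurd ⟨j, hj⟩ h⟩
  choose! g hg1 hgl hg0 hgτ hgj using hlin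
  set f : MvPolynomial (Fin (n + 1)) K := ∏ l' ∈ Finset.univ.erase l, g l'
  have hfm : f.IsHomogeneous m := by
    have := IsHomogeneous.prod (Finset.univ.erase l) g (fun _ => 1)
      (fun l' hl' => hg1 l' (Finset.ne_of_mem_erase hl'))
    simpa using this
  have hfl : eval (z l) f ≠ 0 := by
    rw [map_prod]
    exact Finset.prod_ne_zero_iff.mpr fun l' hl' => hgl l' (Finset.ne_of_mem_erase hl')
  have hvan : ∀ (l') (y : Fin (n + 1) → K), l' ≠ l → eval y (g l') = 0 → eval y f = 0 := by
    intro l' y hl' h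
    rw [map_prod]
    exact Finset.prod_eq_zero (Finset.mem_erase.mpr ⟨hl', Finset.mem_univ _⟩) h
  refine ⟨C (eval (z l) f)⁻¹ * f, hfm.C_mul _, ?_, ?_, ?_⟩
  · rw [map_mul, eval_C, inv_mul_cancel₀ hfl]
  · intro l' hl'
    rw [map_mul, hvan l' _ hl' (hg0 l' hl'), mul_zero]
  · intro j hj y hy
    have hi : 0 < (i : ℕ) := lt_of_le_of_lt (Nat.zero_le _) hj
    rw [map_mul]
    suffices h : eval y f = 0 by rw [h, mul_zero]
    by_cases hjτ : j = τ ⟨i, hi⟩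
    · have hl0 : (0 : Fin (m + 1)) ≠ l := fun h => hi.ne' (hl h.symm)
      exact hvan 0 y hl0 (hgτ 0 hl0 hi rfl y (hjτ ▸ hy))
    · let j' : {j : Fin d // j < i ∧ ∀ hi : 0 < (i : ℕ), j ≠ τ ⟨i, hi⟩} := ⟨j, hj, fun _ => hjτ⟩
      exact hvan (e j') y (e j').2.2 (hgj _ (e j').2.2 j' rfl y hy)

/-- In degrees `m ≥ d - 1` a tree of degree `d` imposes exactly `d * m + 1` conditions on forms: there
are `d * m + 1` points of the tree at which forms of degree `m` take arbitrary values and which detect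
the vanishing of such forms on the tree. -/
theorem IsTreeOfType.exists_evaluation [Infinite K] (hT : IsTreeOfType τ L)
    (hτ : ∀ i, τ i < i.1) (hd : 0 < d) {m : ℕ} (hm : d ≤ m + 1) :
    ∃ y : Option (Fin d × Fin m) → Fin (n + 1) → K, (∀ o, ∃ i, y o ∈ L i) ∧
      (∀ b : Option (Fin d × Fin m) → K, ∃ f : MvPolynomial (Fin (n + 1)) K,
        f.IsHomogeneous m ∧ ∀ o, eval (y o) f = b o) ∧
      ∀ f : MvPolynomial (Fin (n + 1)) K, f.IsHomogeneous m → (∀ o, eval (y o) f = 0) →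
        ∀ i, ∀ x ∈ L i, eval x f = 0 := by
  choose z hzL hzτ hdet hdual using hT.exists_points_and_dual_forms hτ hm
  choose! g hgm hg1 hg0 hgL using hdual
  let o : Fin d := ⟨0, hd⟩
  refine ⟨fun q => q.elim (z o 0) fun q => z q.1 q.2.succ, ?_, fun b => ?_, ?_⟩
  · rintro (_ | q)
    · exact ⟨o, hzL o 0⟩
    · exact ⟨q.1, hzL q.1 _⟩
  · suffices H : ∀ i ≤ d, ∃ f : MvPolynomial (Fin (n + 1)) K, f.IsHomogeneous m ∧
        eval (z o 0) f = b none ∧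
        ∀ j : Fin d, (j : ℕ) < i → ∀ l : Fin m, eval (z j l.succ) f = b (some (j, l)) by
      obtain ⟨f, hf, h0, h⟩ := H d le_rfl
      refine ⟨f, hf, ?_⟩
      rintro (_ | ⟨j, l⟩)
      · exact h0
      · exact h j j.2 l
    intro i
    induction i with
    | zero =>
      intro _
      refine ⟨C (b none) * g o 0, (hgm o 0 fun _ => rfl).C_mul _,
        ?_, fun j hj => absurd hj (by omega)⟩
      rw [map_mul, eval_C, hg1 o 0 fun _ => rfl, mul_one]
    | succ i ih =>
      intro hi
      obtain ⟨f, hf, h0, h⟩ := ih (by omega)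
      obtain ⟨i', hi'⟩ : ∃ i' : Fin d, (i' : ℕ) = i := ⟨⟨i, hi⟩, rfl⟩
      have hs : ∀ l : Fin m, l.succ = 0 → (i' : ℕ) = 0 := fun l h => absurd h (Fin.succ_ne_zero l)
      refine ⟨f + ∑ l : Fin m, C (b (some (i', l)) - eval (z i' l.succ) f) * g i' l.succ,
        hf.add (IsHomogeneous.sum _ _ _ fun l _ => (hgm i' l.succ (hs l)).C_mul _), ?_, ?_⟩
      · rw [map_add, map_sum, h0, add_eq_left]
        refine Finset.sum_eq_zero fun l _ => ?_
        rw [map_mul]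
        by_cases hio : i = 0
        · have e : i' = o := Fin.ext (hi'.trans hio)
          rw [e, hg0 o l.succ (by simp [o]) 0 (Fin.succ_ne_zero l).symm, mul_zero]
        · rw [hgL i' l.succ (hs l) o (Fin.lt_def.mpr (hi' ▸ Nat.pos_of_ne_zero hio)) _ (hzL o 0), mul_zero]
      · intro j hj l
        rw [map_add, map_sum]
        rcases Nat.lt_succ_iff_lt_or_eq.mp hj with hj' | hj'
        · rw [h j hj', add_eq_left]
          refine Finset.sum_eq_zero fun l' _ => ?_
          rw [map_mul, hgL i' l'.succ (hs l') j (Fin.lt_def.mpr (hi' ▸ hj')) _ (hzL j _), mul_zero]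
        · obtain rfl : j = i' := Fin.ext (hj'.trans hi'.symm)
          rw [Finset.sum_eq_single l]
          · rw [map_mul, eval_C, hg1 j l.succ (hs l)]
            ring
          · intro l' _ hl'
            rw [map_mul, hg0 j l'.succ (hs l') l.succ (by simpa using hl'.symm), mul_zero]
          · simp
  · intro f hf h
    suffices H : ∀ N, ∀ i : Fin d, (i : ℕ) < N → ∀ x ∈ L i, eval x f = 0 from
      fun i => H (i + 1) i (Nat.lt_succ_self _)
    intro N
    induction N with
    | zero => intro i hi; omega
    | succ N ih =>
      intro i hi
      apply hdet i f hf
      intro l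
      refine Fin.cases ?_ (fun l => h (some (i, l))) l
      by_cases hi0 : 0 < (i : ℕ)
      · exact ih (τ ⟨i, hi0⟩) (by exact (Fin.lt_def.mp (hτ ⟨i, hi0⟩)).trans_le (Nat.lt_succ_iff.mp hi)) _ (hzτ i hi0)
      · obtain rfl : i = o := Fin.ext (by simp [o]; omega)
        exact h none

end Hilbert

/-! ### Restriction of forms to a tree -/

section Restriction

variable {K : Type*} [Field K] {n d k : ℕ} (v : Fin d → Fin 2 → Fin (n + 1) → K)

/-- Restriction of polynomials to the lines of `v`: a polynomial goes to the function
`(i, a, b) ↦ f (a v_{i0} + b v_{i1})`. Its kernel is the ideal of the union of the lines, and its image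
in degree `m` stands for the degree `m` part of the homogeneous coordinate ring of this curve. -/
noncomputable def restrictLines : MvPolynomial (Fin (n + 1)) K →ₐ[K] (Fin d × K × K → K) :=
  AlgHom.pi
    fun q : Fin d × K × K => aeval (q.2.1 • v q.1 0 + q.2.2 • v q.1 1)

theorem restrictLines_apply (f : MvPolynomial (Fin (n + 1)) K) (q : Fin d × K × K) :
    restrictLines v f q = eval (q.2.1 • v q.1 0 + q.2.2 • v q.1 1) f := by
  change aeval (q.2.1 • v q.1 0 + q.2.2 • v q.1 1) f = _
  rw [aeval_eq_eval]

theorem mem_lines_iff (i : Fin d) (y : Fin (n + 1) → K) :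
    y ∈ lines v i ↔ ∃ a b : K, a • v i 0 + b • v i 1 = y := by
  rw [lines, ← Submodule.mem_span_pair]
  congr!
  ext x
  simp [eq_comm]

variable {v}

theorem restrictLines_eq_zero_iff {f : MvPolynomial (Fin (n + 1)) K} :
    restrictLines v f = 0 ↔ ∀ i, ∀ y ∈ lines v i, eval y f = 0 := by
  constructor
  · intro h i y hy
    obtain ⟨a, b, rfl⟩ := (mem_lines_iff v i y).mp hy
    rw [← restrictLines_apply v f (i, a, b), h, Pi.zero_apply]
  · intro h
    funext q
    rw [restrictLines_apply]
    exact h q.1 _ ((mem_lines_iff v _ _).mpr ⟨_, _, rfl⟩)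

theorem mem_curveIdeal_lines_iff {f : MvPolynomial (Fin (n + 1)) K} :
    f ∈ curveIdeal (lines v) ↔ restrictLines v f = 0 := by
  rw [curveIdeal, mem_vanishingIdeal_iff, restrictLines_eq_zero_iff]
  simp only [Set.mem_iUnion, SetLike.mem_coe, aeval_eq_eval]
  exact ⟨fun h i y hy => h y ⟨i, hy⟩, fun h y ⟨i, hy⟩ => h i y hy⟩

theorem finrank_map_eq_of_forall_eq_zero_iff {E A B : Type*} [AddCommGroup E] [Module K E]
    [AddCommGroup A] [Module K A] [AddCommGroup B] [Module K B] (f : E →ₗ[K] A) (g : E →ₗ[K] B)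
    (p : Submodule K E) (h : ∀ x ∈ p, f x = 0 ↔ g x = 0) :
    Module.finrank K (p.map f) = Module.finrank K (p.map g) := by
  have hker : LinearMap.ker (f.domRestrict p) = LinearMap.ker (g.domRestrict p) := by
    ext x
    simpa using h x x.2
  rw [← LinearMap.range_domRestrict, ← LinearMap.range_domRestrict]
  exact ((f.domRestrict p).quotKerEquivRange.symm.trans
    ((Submodule.quotEquivOfEq _ _ hker).trans (g.domRestrict p).quotKerEquivRange)).finrank_eq

instance (m : ℕ) : Module.Finite K (homogeneousSubmodule (Fin n) K m) :=
  Module.Finite.iff_fg.mpr (homogeneousSubmodule_fg _ _ m)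

section

variable [Infinite K]

/-- A form that vanishes identically on no line of the curve is a nonzerodivisor on its coordinate
ring. -/
theorem restrictLines_eq_zero_of_mul {m : ℕ} {G f : MvPolynomial (Fin (n + 1)) K}
    (hG : G.IsHomogeneous k) (hf : f.IsHomogeneous m)
    (h0 : ∀ i, ∃ y ∈ lines v i, eval y G ≠ 0) (h : restrictLines v (G * f) = 0) :
    restrictLines v f = 0 := by
  rw [restrictLines_eq_zero_iff] at h ⊢
  intro i y hy
  obtain ⟨x, hx, hGx⟩ := h0 i
  obtain ⟨P, -, hP⟩ := exists_polynomial_eval_add_smul hG x (y - x)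
  obtain ⟨Q, -, hQ⟩ := exists_polynomial_eval_add_smul hf x (y - x)
  have hPQ : P * Q = 0 := by
    apply Polynomial.funext
    intro c
    rw [Polynomial.eval_mul, hP, hQ, Polynomial.eval_zero, ← map_mul]
    exact h i _ (add_mem hx (Submodule.smul_mem _ _ (sub_mem hy hx)))
  have hP0 : P ≠ 0 := by
    rintro rfl
    apply hGx
    have := hP 0
    simpa using this.symm
  have hQ0 := (mul_eq_zero.mp hPQ).resolve_left hP0
  have := hQ 1
  rw [hQ0] at this
  simpa using this.symm

theorem homogeneousComponent_mem_curveIdeal {f : MvPolynomial (Fin (n + 1)) K}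
    (h : f ∈ curveIdeal (lines v)) (m : ℕ) : homogeneousComponent m f ∈ curveIdeal (lines v) := by
  rw [mem_curveIdeal_lines_iff, restrictLines_eq_zero_iff] at h ⊢
  intro i y hy
  -- `c ↦ f (c y)` is a polynomial function with coefficients the components of `f` at `y`
  let Q : Polynomial K := ∑ j ∈ Finset.range (f.totalDegree + 1),
    Polynomial.C (eval y (homogeneousComponent j f)) * Polynomial.X ^ j
  have hQ : Q = 0 := by
    apply Polynomial.funext
    intro c
    have h1 := h i (c • y) (Submodule.smul_mem _ _ hy)
    rw [← sum_homogeneousComponent f, map_sum] at h1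
    rw [Polynomial.eval_zero, ← h1, Polynomial.eval_finsetSum]
    refine Finset.sum_congr rfl fun j _ => ?_
    rw [eval_smul_of_isHomogeneous (homogeneousComponent_isHomogeneous j f)]
    rw [Polynomial.eval_mul, Polynomial.eval_C, Polynomial.eval_pow, Polynomial.eval_X, mul_comm]
  by_cases hm : m ≤ f.totalDegree
  · have h2 := congrArg (Polynomial.coeff · m) hQ
    simp only [Q, Polynomial.finsetSum_coeff, Polynomial.coeff_C_mul_X_pow, Polynomial.coeff_zero] at h2
    rwa [Finset.sum_ite_eq, if_pos (by simp; omega)] at h2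
  · rw [homogeneousComponent_eq_zero _ _ (by omega), map_zero]

theorem exists_sub_mul_mem_curveIdeal {F f : MvPolynomial (Fin (n + 1)) K} {m : ℕ}
    (hF : F.IsHomogeneous k) (hf : f.IsHomogeneous (m + k)) (h : f ∈ interIdeal F (lines v)) :
    ∃ g : MvPolynomial (Fin (n + 1)) K, g.IsHomogeneous m ∧ f - F * g ∈ curveIdeal (lines v) := by
  obtain ⟨p, hp, u, hu, rfl⟩ := Submodule.mem_sup.mp h
  obtain ⟨g, rfl⟩ := Ideal.mem_span_singleton.mp hp
  refine ⟨homogeneousComponent m g, homogeneousComponent_isHomogeneous _ _, ?_⟩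
  have h1 := homogeneousComponent_eq_self hf
  rw [map_add, homogeneousComponent_mul_of_isHomogeneous hF] at h1
  rw [← h1, add_sub_cancel_left]
  exact homogeneousComponent_mem_curveIdeal hu _

variable {τ : {i : Fin d // 0 < (i : ℕ)} → Fin d}

/-- The Hilbert function of a tree of degree `d` is `d * m + 1` in degrees `m ≥ d - 1`. -/
theorem finrank_map_restrictLines (hT : IsTreeOfType τ (lines v)) (hτ : ∀ i, τ i < i.1)
    (hd : 0 < d) {m : ℕ} (hm : d ≤ m + 1) :
    Module.finrank K ((homogeneousSubmodule (Fin (n + 1)) K m).map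
      (restrictLines v).toLinearMap) = d * m + 1 := by
  obtain ⟨y, hyL, hsurj, hdet⟩ := hT.exists_evaluation hτ hd hm
  let ev : MvPolynomial (Fin (n + 1)) K →ₗ[K] (Option (Fin d × Fin m) → K) :=
    LinearMap.pi fun o => (aeval (y o) : MvPolynomial (Fin (n + 1)) K →ₐ[K] K).toLinearMap
  have hev : ∀ f o, ev f o = eval (y o) f := fun f o => by
    change aeval (y o) f = _
    rw [aeval_eq_eval]
  rw [finrank_map_eq_of_forall_eq_zero_iff _ ev]
  · have : (homogeneousSubmodule (Fin (n + 1)) K m).map ev = ⊤ := by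
      rw [eq_top_iff]
      intro b _
      obtain ⟨f, hf, hfb⟩ := hsurj b
      exact ⟨f, hf, funext fun o => by rw [hev, hfb]⟩
    rw [this, finrank_top, Module.finrank_fintype_fun_eq_card]
    simp
  · intro f hf
    change restrictLines v f = 0 ↔ _
    rw [restrictLines_eq_zero_iff]
    constructor
    · intro h
      funext o
      obtain ⟨i, hi⟩ := hyL o
      rw [hev, h i _ hi, Pi.zero_apply]
    · intro h
      exact hdet f hf fun o => by rw [← hev, h, Pi.zero_apply]

/-- If a hyperplane `x_a = 0` meets the tree in `d` points which impose independent conditions on forms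
of degree `m + 1`, then the forms vanishing at these points are, on the tree, multiples of `x_a`. -/
theorem exists_sub_X_mul_mem_curveIdeal (hT : IsTreeOfType τ (lines v)) (hτ : ∀ i, τ i < i.1)
    (hd : 0 < d) {m : ℕ} (hm : d ≤ m + 1) {a : Fin (n + 1)} {z : Fin d → Fin (n + 1) → K}
    (hz : ∀ i, z i ∈ lines v i) (hza : ∀ i, z i a = 0) (hL : ∀ i, ∃ y ∈ lines v i, y a ≠ 0)
    (hsurj : ∀ b : Fin d → K, ∃ f : MvPolynomial (Fin (n + 1)) K, f.IsHomogeneous (m + 1) ∧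
      ∀ i, eval (z i) f = b i)
    {f : MvPolynomial (Fin (n + 1)) K} (hf : f.IsHomogeneous (m + 1))
    (hfz : ∀ i, eval (z i) f = 0) :
    ∃ g : MvPolynomial (Fin (n + 1)) K, g.IsHomogeneous m ∧
      f - X a * g ∈ curveIdeal (lines v) := by
  set ρ := (restrictLines v).toLinearMap
  set V := (homogeneousSubmodule (Fin (n + 1)) K (m + 1)).map ρ
  set A := (homogeneousSubmodule (Fin (n + 1)) K m).map (ρ ∘ₗ LinearMap.mulLeft K (X a))
  have hA : Module.finrank K A = d * m + 1 := by
    rw [← finrank_map_restrictLines hT hτ hd hm]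
    refine finrank_map_eq_of_forall_eq_zero_iff _ _ _ fun g hg => ?_
    change restrictLines v (X a * g) = 0 ↔ restrictLines v g = 0
    constructor
    · intro h
      exact restrictLines_eq_zero_of_mul (isHomogeneous_X K a) hg (by simpa using hL) h
    · intro h
      rw [map_mul, h, mul_zero]
  choose b c hbc using fun i => (mem_lines_iff v i (z i)).mp (hz i)
  let E : (Fin d × K × K → K) →ₗ[K] (Fin d → K) :=
    LinearMap.pi fun i => LinearMap.proj (i, b i, c i)
  have hE : ∀ g i, E (ρ g) i = eval (z i) g := fun g i => by
    change restrictLines v g (i, b i, c i) = _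
    rw [restrictLines_apply, hbc]
  have hAV : A ≤ V := by
    rintro _ ⟨g, hg, rfl⟩
    exact ⟨X a * g, by simpa [add_comm] using (isHomogeneous_X K a).mul hg, rfl⟩
  have hAE : A ≤ LinearMap.ker E := by
    rintro _ ⟨g, hg, rfl⟩
    rw [LinearMap.mem_ker]
    funext i
    change E (ρ (X a * g)) i = 0
    rw [hE, map_mul, eval_X, hza, zero_mul]
  have hV : Module.finrank K V = d * (m + 1) + 1 :=
    finrank_map_restrictLines hT hτ hd (by omega)
  have hrange : LinearMap.range (E.domRestrict V) = ⊤ := by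
    rw [eq_top_iff]
    intro t _
    obtain ⟨g, hg, hgt⟩ := hsurj t
    exact ⟨⟨ρ g, g, hg, rfl⟩, funext fun i => by
      rw [← hgt i, ← hE]; rfl⟩
  have hdim := LinearMap.finrank_range_add_finrank_ker (E.domRestrict V)
  rw [hrange, finrank_top, Module.finrank_fintype_fun_eq_card, Fintype.card_fin, hV] at hdim
  have hle : A.submoduleOf V ≤ LinearMap.ker (E.domRestrict V) := fun x hx => hAE hx
  have heq := Submodule.eq_of_le_of_finrank_le hle (by
    rw [(Submodule.submoduleOfEquivOfLe hAV).finrank_eq, hA]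
    have : d * (m + 1) = d * m + d := by ring
    omega)
  have hmem : (⟨ρ f, f, hf, rfl⟩ : V) ∈ LinearMap.ker (E.domRestrict V) := by
    rw [LinearMap.mem_ker]
    funext i
    change E (ρ f) i = 0
    rw [hE, hfz]
  rw [← heq] at hmem
  obtain ⟨g, hg, hgf⟩ := hmem
  refine ⟨g, hg, ?_⟩
  rw [mem_curveIdeal_lines_iff, map_sub, sub_eq_zero]
  exact hgf.symm

end

end Restriction

/-! ### Multiplication by a variable on the coordinate ring of `W ∩ Y` -/

section Intersection

variable {K : Type*} [Field K] {n d k : ℕ}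

theorem isHomogeneous_X_pow_mul {σ : Type*} (b : σ) (a : ℕ) {m : ℕ} {f : MvPolynomial σ K}
    (hf : f.IsHomogeneous m) : (X b ^ a * f).IsHomogeneous (m + a) := by
  have := ((isHomogeneous_X K b).pow a).mul hf
  rwa [one_mul, add_comm] at this

/-- The vector spanning the intersection of the `i`-th line with the hyperplane `x_b = 0` (it is `0` when
the line lies in this hyperplane). -/
def hyperplanePoint (v : Fin d → Fin 2 → Fin (n + 1) → K) (b : Fin (n + 1)) (i : Fin d) :
    Fin (n + 1) → K :=
  v i 1 b • v i 0 - v i 0 b • v i 1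

variable (v : Fin d → Fin 2 → Fin (n + 1) → K)

theorem hyperplanePoint_mem (b : Fin (n + 1)) (i : Fin d) :
    hyperplanePoint v b i ∈ lines v i :=
  (mem_lines_iff v i _).mpr ⟨v i 1 b, - v i 0 b, by rw [hyperplanePoint, neg_smul, sub_eq_add_neg]⟩

theorem hyperplanePoint_apply (b : Fin (n + 1)) (i : Fin d) : hyperplanePoint v b i b = 0 := by
  simp [hyperplanePoint, mul_comm]

variable {v}

theorem exists_mem_lines_apply_ne_zero {b : Fin (n + 1)} {i : Fin d}
    (h : hyperplanePoint v b i ≠ 0) : ∃ y ∈ lines v i, y b ≠ 0 := by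
  by_contra! hcon
  apply h
  have h0 := hcon (v i 0) ((mem_lines_iff v i _).mpr ⟨1, 0, by simp⟩)
  have h1 := hcon (v i 1) ((mem_lines_iff v i _).mpr ⟨0, 1, by simp⟩)
  simp [hyperplanePoint, h0, h1]

theorem ne_zero_of_eval_ne_zero {σ : Type*} {F : MvPolynomial σ K} (hk : 0 < k)
    (hF : F.IsHomogeneous k) {y : σ → K} (h : eval y F ≠ 0) : y ≠ 0 := by
  rintro rfl
  apply h
  have := eval_smul_of_isHomogeneous hF 0 (0 : σ → K)
  rwa [zero_smul, zero_pow hk.ne', zero_mul] at this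

/-- Points at which forms of degree `m` take arbitrary values have this property in all larger degrees,
provided that some variable vanishes at none of them. -/
theorem exists_form_eval_eq_of_le {ι : Type*} {z : ι → Fin (n + 1) → K} {c : Fin (n + 1)}
    (hz : ∀ i, z i c ≠ 0) {m m' : ℕ} (hm : m ≤ m')
    (h : ∀ b : ι → K, ∃ f : MvPolynomial (Fin (n + 1)) K, f.IsHomogeneous m ∧
      ∀ i, eval (z i) f = b i) (b : ι → K) :
    ∃ f : MvPolynomial (Fin (n + 1)) K, f.IsHomogeneous m' ∧ ∀ i, eval (z i) f = b i := by
  obtain ⟨e, rfl⟩ := Nat.exists_eq_add_of_le hm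
  obtain ⟨f, hf, hfb⟩ := h fun i => (z i c ^ e)⁻¹ * b i
  refine ⟨X c ^ e * f, isHomogeneous_X_pow_mul c e hf, fun i => ?_⟩
  rw [map_mul, map_pow, eval_X, hfb, mul_inv_cancel_left₀ (pow_ne_zero _ (hz i))]

variable {τ : {i : Fin d // 0 < (i : ℕ)} → Fin d} {F : MvPolynomial (Fin (n + 1)) K}
  {b : Fin (n + 1)}

theorem mem_interIdeal_of_sub_mul_mem {f g : MvPolynomial (Fin (n + 1)) K}
    {L : Fin d → Submodule K (Fin (n + 1) → K)} (h : f - F * g ∈ curveIdeal L) :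
    f ∈ interIdeal F L := by
  rw [← sub_add_cancel f (F * g)]
  exact add_mem (Ideal.mem_sup_right h) (Ideal.mem_sup_left
    (Ideal.mul_mem_right _ _ (Ideal.mem_span_singleton_self F)))

variable [Infinite K]

/-- In large degrees multiplication by `x_b` is injective on the coordinate ring of `W ∩ Y`, when no
point of this intersection lies on `x_b = 0`. -/
theorem mem_interIdeal_of_X_mul_mem (hT : IsTreeOfType τ (lines v)) (hτ : ∀ i, τ i < i.1)
    (hd : 0 < d) (hk : 0 < k) (hF : F.IsHomogeneous k)
    (hFr : ∀ i, eval (hyperplanePoint v b i) F ≠ 0)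
    (hr : ∀ m, d ≤ m + 1 → ∀ u : Fin d → K, ∃ f : MvPolynomial (Fin (n + 1)) K,
      f.IsHomogeneous m ∧ ∀ i, eval (hyperplanePoint v b i) f = u i)
    {m : ℕ} (hm : d + k ≤ m) {f : MvPolynomial (Fin (n + 1)) K} (hf : f.IsHomogeneous m)
    (h : X b * f ∈ interIdeal F (lines v)) : f ∈ interIdeal F (lines v) := by
  have hL : ∀ i, ∃ y ∈ lines v i, y b ≠ 0 := fun i =>
    exists_mem_lines_apply_ne_zero (ne_zero_of_eval_ne_zero hk hF (hFr i))
  obtain ⟨m, rfl⟩ : ∃ m', m = m' + k := ⟨m - k, by omega⟩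
  have hXf : (X b * f).IsHomogeneous (m + 1 + k) := by
    have := isHomogeneous_X_pow_mul b 1 hf
    rw [pow_one] at this
    convert this using 1
    ring
  obtain ⟨g, hg, hgY⟩ := exists_sub_mul_mem_curveIdeal hF hXf h
  have hgr : ∀ i, eval (hyperplanePoint v b i) g = 0 := by
    intro i
    have h1 := restrictLines_eq_zero_iff.mp (mem_curveIdeal_lines_iff.mp hgY) i _
      (hyperplanePoint_mem v b i)
    rw [map_sub, map_mul, map_mul, eval_X, hyperplanePoint_apply, zero_mul, zero_sub,
      neg_eq_zero] at h1
    exact (mul_eq_zero.mp h1).resolve_left (hFr i)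
  obtain ⟨g', hg', hgg'⟩ := exists_sub_X_mul_mem_curveIdeal hT hτ hd (by omega)
    (hyperplanePoint_mem v b) (hyperplanePoint_apply v b) hL (hr (m + 1) (by omega)) hg hgr
  apply mem_interIdeal_of_sub_mul_mem (g := g')
  have h2 : X b * (f - F * g') ∈ curveIdeal (lines v) := by
    convert add_mem hgY (Ideal.mul_mem_left _ F hgg') using 1
    ring
  rw [mem_curveIdeal_lines_iff] at h2 ⊢
  refine restrictLines_eq_zero_of_mul (isHomogeneous_X K b) (hf.sub ?_) (by simpa using hL) h2
  rw [add_comm m k]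
  exact hF.mul hg'

/-- In large degrees multiplication by `x_b` is surjective on the coordinate ring of `W ∩ Y`, when no
point of this intersection lies on `x_b = 0`. -/
theorem exists_sub_X_mul_mem_interIdeal (hT : IsTreeOfType τ (lines v)) (hτ : ∀ i, τ i < i.1)
    (hd : 0 < d) (hk : 0 < k) (hF : F.IsHomogeneous k)
    (hFr : ∀ i, eval (hyperplanePoint v b i) F ≠ 0)
    (hr : ∀ m, d ≤ m + 1 → ∀ u : Fin d → K, ∃ f : MvPolynomial (Fin (n + 1)) K,
      f.IsHomogeneous m ∧ ∀ i, eval (hyperplanePoint v b i) f = u i)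
    {m : ℕ} (hm : d + k ≤ m) {f : MvPolynomial (Fin (n + 1)) K} (hf : f.IsHomogeneous (m + 1)) :
    ∃ g : MvPolynomial (Fin (n + 1)) K, g.IsHomogeneous m ∧
      f - X b * g ∈ interIdeal F (lines v) := by
  have hL : ∀ i, ∃ y ∈ lines v i, y b ≠ 0 := fun i =>
    exists_mem_lines_apply_ne_zero (ne_zero_of_eval_ne_zero hk hF (hFr i))
  obtain ⟨m, rfl⟩ : ∃ m', m = m' + k := ⟨m - k, by omega⟩
  obtain ⟨h, hh, hhr⟩ := hr (m + 1) (by omega) fun i =>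
    (eval (hyperplanePoint v b i) F)⁻¹ * eval (hyperplanePoint v b i) f
  have hsub : (f - F * h).IsHomogeneous (m + k + 1) := by
    refine hf.sub ?_
    have := hF.mul hh
    rwa [show k + (m + 1) = m + k + 1 by omega] at this
  obtain ⟨g, hg, hgY⟩ := exists_sub_X_mul_mem_curveIdeal hT hτ hd (by omega)
    (hyperplanePoint_mem v b) (hyperplanePoint_apply v b) hL (hr (m + k + 1) (by omega)) hsub
    (fun i => by rw [map_sub, map_mul, hhr, mul_inv_cancel_left₀ (hFr i), sub_self])
  refine ⟨g, hg, mem_interIdeal_of_sub_mul_mem (g := h) ?_⟩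
  convert hgY using 1
  ring

/-- Maximal rank in one degree `t₀` gives `h¹ = 0` in all degrees `t ≥ t₀`. Here surjectivity of the
restriction of forms of degree `t₀` to `W ∩ Y` is stated in the large degree `M`, by means of the
variable `x_b`, which is invertible on `W ∩ Y`. -/
theorem hCoh_one_eq_zero_of_le (hn : 3 ≤ n) (hT : IsTreeOfType τ (lines v)) (hτ : ∀ i, τ i < i.1)
    (hd : 0 < d) (hk : 0 < k) (hF : F.IsHomogeneous k)
    (hc : F.coeff (Finsupp.single 0 k) ≠ 0)
    (hFr : ∀ i, eval (hyperplanePoint v b i) F ≠ 0)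
    (hr : ∀ m, d ≤ m + 1 → ∀ u : Fin d → K, ∃ f : MvPolynomial (Fin (n + 1)) K,
      f.IsHomogeneous m ∧ ∀ i, eval (hyperplanePoint v b i) f = u i)
    {M t₀ t : ℕ} (hM : d + k ≤ M) (ht₀ : t₀ ≤ M) (ht : t₀ ≤ t)
    (hsurj : ∀ f : MvPolynomial (Fin (n + 1)) K, f.IsHomogeneous M →
      ∃ g : MvPolynomial (Fin (n + 1)) K, g.IsHomogeneous t₀ ∧
        f - X b ^ (M - t₀) * g ∈ interIdeal F (lines v)) :
    hCoh F (interIdeal F (lines v)) t 1 = 0 := by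
  have hsurj' : ∀ j, ∀ f : MvPolynomial (Fin (n + 1)) K, f.IsHomogeneous (M + j) →
      ∃ g : MvPolynomial (Fin (n + 1)) K, g.IsHomogeneous t₀ ∧
        f - X b ^ (M + j - t₀) * g ∈ interIdeal F (lines v) := by
    intro j
    induction j with
    | zero => exact hsurj
    | succ j ih =>
      intro f hf
      obtain ⟨h, hh, hhI⟩ := exists_sub_X_mul_mem_interIdeal hT hτ hd hk hF hFr hr
        (m := M + j) (by omega) hf
      obtain ⟨g, hg, hgI⟩ := ih h hh
      refine ⟨g, hg, ?_⟩
      convert add_mem hhI (Ideal.mul_mem_left _ (X b) hgI) using 1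
      rw [show M + (j + 1) - t₀ = (M + j - t₀) + 1 by omega]
      ring
  refine hCoh_one_eq_zero (M := M) hn hk hF hc b
    (Ideal.mem_sup_left (Ideal.mem_span_singleton_self F)) ?_ ?_
  · intro m hm f hf
    exact mem_interIdeal_of_X_mul_mem hT hτ hd hk hF hFr hr (hM.trans hm) hf
  · intro a ha f hf
    obtain ⟨j, hj⟩ := Nat.exists_eq_add_of_le ha
    obtain ⟨g, hg, hgI⟩ := hsurj' j f (hj ▸ hf)
    refine ⟨X b ^ (t - t₀) * g, ?_, ?_⟩
    · have := isHomogeneous_X_pow_mul b (t - t₀) hg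
      rwa [Nat.add_sub_cancel' ht] at this
    · rw [← mul_assoc, ← pow_add]
      convert hgI using 4
      omega

/-- Injectivity of the restriction of forms in one degree `t₁` gives `h⁰ = 0` in all degrees
`t ≤ t₁`. -/
theorem hCoh_zero_eq_zero_of_le (hn : 2 ≤ n) (hT : IsTreeOfType τ (lines v))
    (hτ : ∀ i, τ i < i.1) (hd : 0 < d) (hk : 0 < k) (hF : F.IsHomogeneous k)
    (hc : F.coeff (Finsupp.single 0 k) ≠ 0) (hb : b ≠ 0)
    (hFr : ∀ i, eval (hyperplanePoint v b i) F ≠ 0)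
    (hr : ∀ m, d ≤ m + 1 → ∀ u : Fin d → K, ∃ f : MvPolynomial (Fin (n + 1)) K,
      f.IsHomogeneous m ∧ ∀ i, eval (hyperplanePoint v b i) f = u i)
    {M t₁ : ℕ} (hM : d + k ≤ M) (ht₁ : t₁ ≤ M) {t : ℤ} (ht : t ≤ t₁)
    (hinj : ∀ f : MvPolynomial (Fin (n + 1)) K, f.IsHomogeneous t₁ →
      X b ^ (M - t₁) * f ∈ interIdeal F (lines v) → f ∈ Ideal.span {F}) :
    hCoh F (interIdeal F (lines v)) t 0 = 0 := by
  have hdesc : ∀ j, ∀ f : MvPolynomial (Fin (n + 1)) K, f.IsHomogeneous M →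
      X b ^ j * f ∈ interIdeal F (lines v) → f ∈ interIdeal F (lines v) := by
    intro j
    induction j with
    | zero => intro f _ h; simpa using h
    | succ j ih =>
      intro f hf h
      apply ih f hf
      refine mem_interIdeal_of_X_mul_mem hT hτ hd hk hF hFr hr (m := M + j) (by omega)
        (isHomogeneous_X_pow_mul b j hf) ?_
      rwa [← mul_assoc, ← pow_succ']
  refine hCoh_zero_eq_zero hn hk hF hc b
    (Ideal.mem_sup_left (Ideal.mem_span_singleton_self F)) ?_
  rintro m rfl f hf N h
  have ht' : m ≤ t₁ := by exact_mod_cast ht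
  have hf1 : (X b ^ (t₁ - m) * f).IsHomogeneous t₁ := by
    have := isHomogeneous_X_pow_mul b (t₁ - m) hf
    rwa [Nat.add_sub_cancel' ht'] at this
  refine mem_span_singleton_of_X_pow_mul hk hF hc hb (hinj _ hf1 ?_)
  apply hdesc N
  · have := isHomogeneous_X_pow_mul b (M - t₁) hf1
    rwa [Nat.add_sub_cancel' ht₁] at this
  · rw [show X b ^ N * (X b ^ (M - t₁) * (X b ^ (t₁ - m) * f)) =
      X b ^ (M - t₁) * X b ^ (t₁ - m) * (X b ^ N * f) by ring]
    exact Ideal.mul_mem_left _ _ h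

end Intersection

/-! ### Openness of linear independence -/

section Minors

variable {K : Type*} [Field K] {ι J : Type*}

theorem span_range_columns_eq_top [Finite ι] {w : ι → J → K} (hw : LinearIndependent K w) :
    Submodule.span K (Set.range fun j a => w a j) = ⊤ := by
  classical
  cases nonempty_fintype ι
  by_contra h
  obtain ⟨φ, hφ0, hφ⟩ := Submodule.exists_le_ker_of_lt_top _ (lt_top_iff_ne_top.mpr h)
  apply hφ0
  have hφe : ∀ y : ι → K, φ y = ∑ a, y a * φ (Pi.single a 1) := by
    intro y
    conv_lhs => rw [← Finset.univ_sum_single y]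
    rw [map_sum]
    refine Finset.sum_congr rfl fun a _ => ?_
    rw [← smul_eq_mul, ← map_smul, ← Pi.single_smul]
    simp
  have h0 := Fintype.linearIndependent_iff.mp hw (fun a => φ (Pi.single a 1)) (by
    funext j
    have h1 := hφ (Submodule.subset_span ⟨j, rfl⟩)
    rw [LinearMap.mem_ker, hφe] at h1
    rw [Pi.zero_apply, ← h1, Finset.sum_apply]
    refine Finset.sum_congr rfl fun a _ => ?_
    rw [Pi.smul_apply, smul_eq_mul, mul_comm])
  ext a
  simpa using h0 a

/-- Finitely many independent vectors in a function space have a nonzero maximal minor. -/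
theorem exists_det_ne_zero [Fintype ι] [DecidableEq ι] {w : ι → J → K}
    (hw : LinearIndependent K w) :
    ∃ g : ι → J, (Matrix.of fun a b => w a (g b)).det ≠ 0 := by
  obtain ⟨κ, g, -, hspan, hind⟩ := exists_linearIndependent' K fun (j : J) (a : ι) => w a j
  rw [span_range_columns_eq_top hw] at hspan
  let B := Module.Basis.mk hind hspan.ge
  have : Fintype κ := FiniteDimensional.fintypeBasisIndex B
  let e : ι ≃ κ := (Pi.basisFun K ι).indexEquiv B
  refine ⟨g ∘ e, ?_⟩
  rw [← isUnit_iff_ne_zero, ← Matrix.isUnit_iff_isUnit_det, ← Matrix.linearIndependent_cols_iff_isUnit]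
  exact hind.comp e e.injective

theorem linearIndependent_of_det_ne_zero [Fintype ι] [DecidableEq ι] {w : ι → J → K} {g : ι → J}
    (h : (Matrix.of fun a b => w a (g b)).det ≠ 0) : LinearIndependent K w := by
  have := Matrix.linearIndependent_rows_of_det_ne_zero h
  exact LinearIndependent.of_comp (LinearMap.funLeft K K g) this

/-- If the coordinates of the vectors `w x a` are polynomials in the coordinates of `x`, their linear
independence is an open condition on `x`. -/
theorem exists_polynomial_linearIndependent {α κ : Type*} [Finite ι] {coord : α → κ → K} {X : Set α}
    {w : α → ι → J → K} (P : ι → J → MvPolynomial κ K)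
    (hP : ∀ x ∈ X, ∀ a j, w x a j = eval (coord x) (P a j)) {x₀ : α} (hx₀ : x₀ ∈ X)
    (hw : LinearIndependent K (w x₀)) :
    ∃ Φ : MvPolynomial κ K, eval (coord x₀) Φ ≠ 0 ∧
      ∀ x ∈ X, eval (coord x) Φ ≠ 0 → LinearIndependent K (w x) := by
  classical
  cases nonempty_fintype ι
  obtain ⟨g, hg⟩ := exists_det_ne_zero hw
  have hdet : ∀ x ∈ X, eval (coord x) (Matrix.of fun a b => P a (g b)).det =
      (Matrix.of fun a b => w x a (g b)).det := by
    intro x hx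
    rw [RingHom.map_det]
    congr 1
    ext a b
    simp [hP x hx]
  refine ⟨(Matrix.of fun a b => P a (g b)).det, by rwa [hdet x₀ hx₀], fun x hx h => ?_⟩
  rw [hdet x hx] at h
  exact linearIndependent_of_det_ne_zero h

end Minors

/-! ### Polynomial dependence on the coordinates of a pair -/

section Generic

variable {K : Type*} [Field K] {n d k : ℕ}

/-- The value at `Y` of the form of degree `k` whose coefficients are the coordinates of a pair. -/
noncomputable def genericForm (d k : ℕ)
    (Y : Fin (n + 1) → MvPolynomial ((Fin (n + 1) →₀ ℕ) ⊕ (Fin d × Fin 2 × Fin (n + 1))) K) :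
    MvPolynomial ((Fin (n + 1) →₀ ℕ) ⊕ (Fin d × Fin 2 × Fin (n + 1))) K :=
  ∑ m ∈ Finset.univ.finsuppAntidiag k, X (Sum.inl m) * ∏ j, Y j ^ m j

theorem mem_finsuppAntidiag_univ_iff {m : Fin n →₀ ℕ} :
    m ∈ Finset.univ.finsuppAntidiag k ↔ m.degree = k := by
  rw [Finset.mem_finsuppAntidiag, Finsupp.degree_eq_sum]
  simp

theorem eval_genericForm {x : PairData K n d} (hx : x.1.IsHomogeneous k)
    (Y : Fin (n + 1) → MvPolynomial ((Fin (n + 1) →₀ ℕ) ⊕ (Fin d × Fin 2 × Fin (n + 1))) K) :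
    eval (pairCoord x) (genericForm d k Y) = eval (fun j => eval (pairCoord x) (Y j)) x.1 := by
  rw [eval_eq' (fun j => eval (pairCoord x) (Y j)), genericForm, map_sum]
  symm
  apply Finset.sum_subset_zero_on_sdiff
  · intro m hm
    rw [mem_finsuppAntidiag_univ_iff, Finsupp.degree_eq_weight_one]
    exact hx (mem_support_iff.mp hm)
  · intro m hm
    rw [Finset.mem_sdiff, notMem_support_iff] at hm
    rw [map_mul, eval_X, pairCoord, Sum.elim_inl, hm.2, zero_mul]
  · intro m _
    simp [pairCoord]

/-- The point `a v_{i0} + b v_{i1}`, as a vector of polynomials in the coordinates of a pair. -/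
noncomputable def genericPoint (q : Fin d × K × K) (j : Fin (n + 1)) :
    MvPolynomial ((Fin (n + 1) →₀ ℕ) ⊕ (Fin d × Fin 2 × Fin (n + 1))) K :=
  C q.2.1 * X (Sum.inr (q.1, 0, j)) + C q.2.2 * X (Sum.inr (q.1, 1, j))

theorem eval_genericPoint (x : PairData K n d) (q : Fin d × K × K) :
    (fun j => eval (pairCoord x) (genericPoint q j)) =
      q.2.1 • x.2 q.1 0 + q.2.2 • x.2 q.1 1 := by
  funext j
  simp [genericPoint, pairCoord]

/-- The point of the `i`-th line on `x_b = 0`, as a vector of polynomials in the coordinates of a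
pair. -/
noncomputable def genericHyperplanePoint (b : Fin (n + 1)) (i : Fin d) (j : Fin (n + 1)) :
    MvPolynomial ((Fin (n + 1) →₀ ℕ) ⊕ (Fin d × Fin 2 × Fin (n + 1))) K :=
  X (Sum.inr (i, 1, b)) * X (Sum.inr (i, 0, j)) - X (Sum.inr (i, 0, b)) * X (Sum.inr (i, 1, j))

theorem eval_genericHyperplanePoint (x : PairData K n d) (b : Fin (n + 1)) (i : Fin d) :
    (fun j => eval (pairCoord x) (genericHyperplanePoint b i j)) = hyperplanePoint x.2 b i := by
  funext j
  simp [genericHyperplanePoint, pairCoord, hyperplanePoint]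

theorem eval_aeval {σ κ : Type*} (c : κ → K) (Y : σ → MvPolynomial κ K) (f : MvPolynomial σ K) :
    eval c (aeval Y f) = eval (fun j => eval c (Y j)) f := by
  induction f using MvPolynomial.induction_on with
  | C a => simp
  | add p q hp hq => rw [map_add, map_add, map_add, hp, hq]
  | mul_X p i hp => rw [map_mul, map_mul, map_mul, hp, aeval_X, eval_X]

theorem exists_polynomial_linearIndependent_restrictLines {ι : Type*} [Finite ι]
    (f h : ι → MvPolynomial (Fin (n + 1)) K) {x₀ : PairData K n d} (hx₀ : x₀.1.IsHomogeneous k)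
    (hind : LinearIndependent K fun a => restrictLines x₀.2 (f a + x₀.1 * h a)) :
    ∃ Φ : MvPolynomial ((Fin (n + 1) →₀ ℕ) ⊕ (Fin d × Fin 2 × Fin (n + 1))) K,
      eval (pairCoord x₀) Φ ≠ 0 ∧ ∀ x : PairData K n d, x.1.IsHomogeneous k →
        eval (pairCoord x) Φ ≠ 0 →
          LinearIndependent K fun a => restrictLines x.2 (f a + x.1 * h a) := by
  refine exists_polynomial_linearIndependent (X := {x : PairData K n d | x.1.IsHomogeneous k})
    (w := fun x a => restrictLines x.2 (f a + x.1 * h a))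
    (fun a q => aeval (genericPoint q) (f a) +
      genericForm d k (genericPoint q) * aeval (genericPoint q) (h a)) ?_ hx₀ hind
  intro x hx a q
  rw [restrictLines_apply, map_add, map_mul, map_add, map_mul, eval_genericForm hx, eval_aeval,
    eval_aeval, eval_genericPoint]

/-- That the points of the lines on `x_b = 0` impose independent conditions on forms of degree `m` is
an open condition. -/
theorem exists_polynomial_interpolation (b : Fin (n + 1)) (m : ℕ) {x₀ : PairData K n d}
    (h : ∀ u : Fin d → K, ∃ f : MvPolynomial (Fin (n + 1)) K,
      f.IsHomogeneous m ∧ ∀ i, eval (hyperplanePoint x₀.2 b i) f = u i) :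
    ∃ Φ : MvPolynomial ((Fin (n + 1) →₀ ℕ) ⊕ (Fin d × Fin 2 × Fin (n + 1))) K,
      eval (pairCoord x₀) Φ ≠ 0 ∧ ∀ x : PairData K n d, eval (pairCoord x) Φ ≠ 0 →
        ∀ u : Fin d → K, ∃ f : MvPolynomial (Fin (n + 1)) K,
          f.IsHomogeneous m ∧ ∀ i, eval (hyperplanePoint x.2 b i) f = u i := by
  let w : PairData K n d → Fin d → {s : Fin (n + 1) →₀ ℕ // s.degree = m} → K :=
    fun x i s => eval (hyperplanePoint x.2 b i) (monomial s.1 1)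
  have hw₀ : LinearIndependent K (w x₀) := by
    rw [Fintype.linearIndependent_iff]
    intro c hc i
    obtain ⟨f, hf, hfu⟩ := h (Pi.single i 1)
    have h1 : ∑ l, c l * eval (hyperplanePoint x₀.2 b l) f = 0 := by
      have h2 : ∀ y : Fin (n + 1) → K, eval y f = ∑ s ∈ f.support, coeff s f * eval y (monomial s 1) := by
        intro y
        conv_lhs => rw [f.as_sum, map_sum]
        simp [eval_monomial]
      simp only [h2, Finset.mul_sum]
      rw [Finset.sum_comm]
      refine Finset.sum_eq_zero fun s hs => ?_
      have h3 := congrFun hc ⟨s, by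
        rw [Finsupp.degree_eq_weight_one]; exact hf (mem_support_iff.mp hs)⟩
      simp only [Finset.sum_apply, Pi.smul_apply, smul_eq_mul, Pi.zero_apply, w] at h3
      calc _ = coeff s f * ∑ l, c l * eval (hyperplanePoint x₀.2 b l) (monomial s 1) := by
            rw [Finset.mul_sum]
            exact Finset.sum_congr rfl fun l _ => by ring
        _ = 0 := by rw [h3, mul_zero]
    simpa [hfu, Pi.single_apply] using h1
  obtain ⟨Φ, hΦ₀, hΦ⟩ := exists_polynomial_linearIndependent (coord := pairCoord) (X := Set.univ)
    (w := w) (fun i s => aeval (genericHyperplanePoint b i) (monomial s.1 (1 : K)))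
    (fun x _ i s => by rw [eval_aeval, eval_genericHyperplanePoint]) (Set.mem_univ x₀) hw₀
  refine ⟨Φ, hΦ₀, fun x hx u => ?_⟩
  have hspan := span_range_columns_eq_top (hΦ x (Set.mem_univ x) hx)
  obtain ⟨c, hc⟩ := Finsupp.mem_span_range_iff_exists_finsupp.mp
    (hspan ▸ Submodule.mem_top (x := u))
  refine ⟨c.sum fun s r => monomial s.1 r, ?_, fun i => ?_⟩
  · exact IsHomogeneous.sum _ _ _ fun s _ => isHomogeneous_monomial _ s.2
  · rw [← hc, Finsupp.sum, Finsupp.sum, map_sum, Finset.sum_apply]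
    refine Finset.sum_congr rfl fun s _ => ?_
    simp [w, eval_monomial]

end Generic

/-! ### Openness of maximal rank -/

section MaximalRank

variable {K : Type*} [Field K] {n d k : ℕ}

instance (m : ℕ) : Finite {s : Fin n →₀ ℕ // s.degree = m} :=
  Set.Finite.to_subtype ((Finset.univ.finsuppAntidiag m).finite_toSet.subset fun _ hs =>
    mem_finsuppAntidiag_univ_iff.mpr hs)

theorem homogeneousSubmodule_eq_span_monomial {σ : Type*} (m : ℕ) :
    homogeneousSubmodule σ K m =
      Submodule.span K (Set.range fun s : {s : σ →₀ ℕ // s.degree = m} => monomial s.1 1) := by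
  apply le_antisymm
  · intro f hf
    rw [f.as_sum]
    refine Submodule.sum_mem _ fun s hs => ?_
    rw [← mul_one (coeff s f), ← smul_eq_mul, ← smul_monomial]
    refine Submodule.smul_mem _ _ (Submodule.subset_span ⟨⟨s, ?_⟩, rfl⟩)
    rw [Finsupp.degree_eq_weight_one]
    exact hf (mem_support_iff.mp hs)
  · rw [Submodule.span_le]
    rintro _ ⟨s, rfl⟩
    exact isHomogeneous_monomial _ s.2

theorem span_range_map_monomial {V σ : Type*} [AddCommGroup V] [Module K V]
    (φ : MvPolynomial σ K →ₗ[K] V) (m : ℕ) :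
    Submodule.span K (Set.range fun s : {s : σ →₀ ℕ // s.degree = m} => φ (monomial s.1 1)) =
      (homogeneousSubmodule σ K m).map φ := by
  rw [homogeneousSubmodule_eq_span_monomial, Submodule.map_span, ← Set.range_comp]
  rfl

variable [Infinite K] {τ : {i : Fin d // 0 < (i : ℕ)} → Fin d}

/-- Surjectivity of the restriction of forms of degree `t` to `W ∩ Y` is an open condition. -/
theorem exists_polynomial_surjective (hτ : ∀ i, τ i < i.1) (hd : 0 < d) (b : Fin (n + 1))
    {M t : ℕ} (hM : d + k ≤ M) (ht : t ≤ M) {x₀ : PairData K n d}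
    (hx₀ : x₀ ∈ hypersurfaceTreePairs K n k τ)
    (h : ∀ f : MvPolynomial (Fin (n + 1)) K, f.IsHomogeneous M →
      ∃ g : MvPolynomial (Fin (n + 1)) K, g.IsHomogeneous t ∧
        f - X b ^ (M - t) * g ∈ interIdeal x₀.1 (lines x₀.2)) :
    ∃ Φ : MvPolynomial ((Fin (n + 1) →₀ ℕ) ⊕ (Fin d × Fin 2 × Fin (n + 1))) K,
      eval (pairCoord x₀) Φ ≠ 0 ∧ ∀ x ∈ hypersurfaceTreePairs K n k τ,
        eval (pairCoord x) Φ ≠ 0 →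
          ∀ f : MvPolynomial (Fin (n + 1)) K, f.IsHomogeneous M →
            ∃ g : MvPolynomial (Fin (n + 1)) K, g.IsHomogeneous t ∧
              f - X b ^ (M - t) * g ∈ interIdeal x.1 (lines x.2) := by
  obtain ⟨m, rfl⟩ : ∃ m, M = m + k := ⟨M - k, by omega⟩
  let p : {s : Fin (n + 1) →₀ ℕ // s.degree = t} ⊕ {s : Fin (n + 1) →₀ ℕ // s.degree = m} →
    MvPolynomial (Fin (n + 1)) K := Sum.elim (fun s => X b ^ (m + k - t) * monomial s.1 1) 0
  let q : {s : Fin (n + 1) →₀ ℕ // s.degree = t} ⊕ {s : Fin (n + 1) →₀ ℕ // s.degree = m} →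
    MvPolynomial (Fin (n + 1)) K := Sum.elim 0 (fun s => monomial s.1 1)
  let u := fun (x : PairData K n d) a => restrictLines x.2 (p a + x.1 * q a)
  have hspan : ∀ x, Submodule.span K (Set.range (u x)) =
      (homogeneousSubmodule (Fin (n + 1)) K t).map
        ((restrictLines x.2).toLinearMap ∘ₗ LinearMap.mulLeft K (X b ^ (m + k - t))) ⊔
      (homogeneousSubmodule (Fin (n + 1)) K m).map
        ((restrictLines x.2).toLinearMap ∘ₗ LinearMap.mulLeft K x.1) := by
    intro x
    rw [← span_range_map_monomial, ← span_range_map_monomial, ← Submodule.span_union,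
      ← Set.Sum.elim_range]
    congr 2
    funext a
    rcases a with s | s <;> simp [u, p, q]
  have hV : ∀ x ∈ hypersurfaceTreePairs K n k τ,
      Module.finrank K ((homogeneousSubmodule (Fin (n + 1)) K (m + k)).map
        (restrictLines x.2).toLinearMap) = d * (m + k) + 1 := fun x hx =>
    finrank_map_restrictLines hx.2.2 hτ hd (by omega)
  have hle₀ : (homogeneousSubmodule (Fin (n + 1)) K (m + k)).map (restrictLines x₀.2).toLinearMap ≤
      Submodule.span K (Set.range (u x₀)) := by
    rw [hspan]
    rintro _ ⟨f, hf, rfl⟩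
    obtain ⟨g, hg, hgI⟩ := h f hf
    have hg' := isHomogeneous_X_pow_mul b (m + k - t) hg
    rw [Nat.add_sub_cancel' ht] at hg'
    obtain ⟨e, he, heY⟩ := exists_sub_mul_mem_curveIdeal hx₀.1 (hf.sub hg') hgI
    rw [mem_curveIdeal_lines_iff, sub_sub, map_sub, sub_eq_zero] at heY
    refine Submodule.mem_sup.mpr ⟨_, ⟨g, hg, rfl⟩, _, ⟨e, he, rfl⟩, ?_⟩
    change restrictLines x₀.2 _ + restrictLines x₀.2 _ = restrictLines x₀.2 _
    rw [heY, map_add]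
    rfl
  obtain ⟨κ, a, ha, haspan, hind⟩ := exists_linearIndependent' K (u x₀)
  have : Finite κ := Finite.of_injective a ha
  cases nonempty_fintype κ
  obtain ⟨Φ, hΦ₀, hΦ⟩ := exists_polynomial_linearIndependent_restrictLines (p ∘ a) (q ∘ a)
    hx₀.1 hind
  refine ⟨Φ, hΦ₀, fun x hx hxΦ f hf => ?_⟩
  have hindx : LinearIndependent K (u x ∘ a) := hΦ x hx.1 hxΦ
  have hcard : d * (m + k) + 1 ≤ Fintype.card κ := by
    rw [← hV x₀ hx₀, ← finrank_span_eq_card hind, haspan]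
    have := Module.Finite.span_of_finite K (Set.finite_range (u x₀))
    exact Submodule.finrank_mono hle₀
  have hle : Submodule.span K (Set.range (u x)) ≤
      (homogeneousSubmodule (Fin (n + 1)) K (m + k)).map (restrictLines x.2).toLinearMap := by
    rw [hspan]
    apply sup_le
    · rintro _ ⟨g, hg, rfl⟩
      have hg' := isHomogeneous_X_pow_mul b (m + k - t) hg
      rw [Nat.add_sub_cancel' ht] at hg'
      exact ⟨_, hg', rfl⟩
    · rintro _ ⟨g, hg, rfl⟩
      exact ⟨x.1 * g, by rw [add_comm m k]; exact hx.1.mul hg, rfl⟩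
  have heq : Submodule.span K (Set.range (u x)) =
      (homogeneousSubmodule (Fin (n + 1)) K (m + k)).map (restrictLines x.2).toLinearMap := by
    refine Submodule.eq_of_le_of_finrank_le hle ?_
    rw [hV x hx]
    have := Module.Finite.span_of_finite K (Set.finite_range (u x))
    refine (hcard.trans (finrank_span_eq_card hindx).ge).trans (Submodule.finrank_mono ?_)
    exact Submodule.span_mono (Set.range_comp_subset_range a (u x))
  rw [hspan] at heq
  have hmem : restrictLines x.2 f ∈
      (homogeneousSubmodule (Fin (n + 1)) K (m + k)).map (restrictLines x.2).toLinearMap :=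
    ⟨f, hf, rfl⟩
  rw [← heq] at hmem
  obtain ⟨_, ⟨g, hg, rfl⟩, _, ⟨e, he, rfl⟩, hge⟩ := Submodule.mem_sup.mp hmem
  refine ⟨g, hg, mem_interIdeal_of_sub_mul_mem (g := e) ?_⟩
  rw [mem_curveIdeal_lines_iff, sub_sub, map_sub, sub_eq_zero, ← hge, map_add]
  rfl

/-- Injectivity of the restriction of forms of degree `t` (modulo `F`) to `W ∩ Y` is an open
condition. -/
theorem exists_polynomial_injective (hτ : ∀ i, τ i < i.1) (hd : 0 < d) (hk : 0 < k)
    (b : Fin (n + 1)) {M t : ℕ} (hM : d + k ≤ M) (ht : t ≤ M) {x₀ : PairData K n d}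
    (hx₀ : x₀ ∈ hypersurfaceTreePairs K n k τ)
    (hc : x₀.1.coeff (Finsupp.single 0 k) ≠ 0)
    (hL : ∀ i, ∃ y ∈ lines x₀.2 i, eval y x₀.1 ≠ 0)
    (h : ∀ f : MvPolynomial (Fin (n + 1)) K, f.IsHomogeneous t →
      X b ^ (M - t) * f ∈ interIdeal x₀.1 (lines x₀.2) → f ∈ Ideal.span {x₀.1}) :
    ∃ Φ : MvPolynomial ((Fin (n + 1) →₀ ℕ) ⊕ (Fin d × Fin 2 × Fin (n + 1))) K,
      eval (pairCoord x₀) Φ ≠ 0 ∧ ∀ x ∈ hypersurfaceTreePairs K n k τ,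
        eval (pairCoord x) Φ ≠ 0 → x.1.coeff (Finsupp.single 0 k) ≠ 0 →
          ∀ f : MvPolynomial (Fin (n + 1)) K, f.IsHomogeneous t →
            X b ^ (M - t) * f ∈ interIdeal x.1 (lines x.2) → f ∈ Ideal.span {x.1} := by
  obtain ⟨m, rfl⟩ : ∃ m, M = m + k := ⟨M - k, by omega⟩
  -- monomials of degree `m` that restrict to a basis of the coordinate ring of the curve in `x₀`
  obtain ⟨κ, a, ha, haspan, hind⟩ := exists_linearIndependent' K
    fun s : {s : Fin (n + 1) →₀ ℕ // s.degree = m} => restrictLines x₀.2 (monomial s.1 1)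
  have : Finite κ := Finite.of_injective a ha
  cases nonempty_fintype κ
  have hcard : Fintype.card κ = d * m + 1 := by
    rw [← finrank_map_restrictLines hx₀.2.2 hτ hd (m := m) (by omega), ← finrank_span_eq_card hind,
      haspan, ← span_range_map_monomial]
    rfl
  let ι₁ := {s : {s : Fin (n + 1) →₀ ℕ // s.degree = t} // s.1 0 < k}
  have : Finite ι₁ := Subtype.finite
  have : Fintype ι₁ := Fintype.ofFinite ι₁
  let p : ι₁ ⊕ κ → MvPolynomial (Fin (n + 1)) K :=
    Sum.elim (fun s => X b ^ (m + k - t) * monomial s.1.1 1) 0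
  let q : ι₁ ⊕ κ → MvPolynomial (Fin (n + 1)) K := Sum.elim 0 (fun j => monomial (a j).1 1)
  have hsum : ∀ (x : PairData K n d) (c : ι₁ ⊕ κ → K), ∑ j, c j • restrictLines x.2 (p j + x.1 * q j) =
      restrictLines x.2 (X b ^ (m + k - t) * ∑ s, monomial s.1.1 (c (Sum.inl s)) +
        x.1 * ∑ j, monomial (a j).1 (c (Sum.inr j))) := by
    intro x c
    rw [Fintype.sum_sum_type, map_add, Finset.mul_sum, Finset.mul_sum, map_sum, map_sum]
    congr 1
    · refine Finset.sum_congr rfl fun s _ => ?_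
      rw [← map_smul]
      congr 1
      simp only [p, q, Sum.elim_inl, Pi.zero_apply, mul_zero, add_zero]
      rw [← mul_smul_comm, smul_monomial, smul_eq_mul, mul_one]
    · refine Finset.sum_congr rfl fun s _ => ?_
      rw [← map_smul]
      congr 1
      simp only [p, q, Sum.elim_inr, Pi.zero_apply, zero_add]
      rw [← mul_smul_comm, smul_monomial, smul_eq_mul, mul_one]
  have hcoeff : ∀ (c : ι₁ → K) (s : ι₁), coeff s.1.1 (∑ s, monomial s.1.1 (c s)) = c s := by
    intro c s
    rw [coeff_sum, Finset.sum_eq_single s]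
    · simp
    · intro s' _ hs'
      rw [coeff_monomial, if_neg fun e => hs' (Subtype.ext (Subtype.ext e))]
    · simp
  have hind₀ : LinearIndependent K fun j => restrictLines x₀.2 (p j + x₀.1 * q j) := by
    rw [Fintype.linearIndependent_iff]
    intro c hc0
    rw [hsum] at hc0
    set f : MvPolynomial (Fin (n + 1)) K := ∑ s : ι₁, monomial s.1.1 (c (Sum.inl s)) with hf_def
    set g : MvPolynomial (Fin (n + 1)) K := ∑ j, monomial (a j).1 (c (Sum.inr j)) with hg_def
    have hf : f.IsHomogeneous t := IsHomogeneous.sum _ _ _ fun s _ => isHomogeneous_monomial _ s.1.2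
    have hg : g.IsHomogeneous m := IsHomogeneous.sum _ _ _ fun j _ => isHomogeneous_monomial _ (a j).2
    have hfF := h f hf (mem_interIdeal_of_sub_mul_mem (g := -g) (by
      rw [mem_curveIdeal_lines_iff, mul_neg, sub_neg_eq_add, hc0]))
    have hf0 : f = 0 := by
      refine eq_zero_of_dvd_of_degreeOf_lt hx₀.1 hc (Ideal.mem_span_singleton.mp hfF) ?_
      rw [degreeOf_lt_iff hk]
      intro s hs
      by_contra hsk
      rw [mem_support_iff] at hs
      apply hs
      rw [hf_def, coeff_sum]
      refine Finset.sum_eq_zero fun s' _ => ?_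
      rw [coeff_monomial, if_neg fun e : s'.1.1 = s => hsk (by rw [← e]; exact s'.2)]
    rw [hf0, mul_zero, zero_add] at hc0
    have hg0 := restrictLines_eq_zero_of_mul hx₀.1 hg hL hc0
    have hinr := Fintype.linearIndependent_iff.mp hind (fun j => c (Sum.inr j)) (by
      rw [← hg0, hg_def, map_sum]
      refine Finset.sum_congr rfl fun j _ => ?_
      rw [Function.comp_apply, ← map_smul, smul_monomial, smul_eq_mul, mul_one])
    rintro (s | j)
    · have := hcoeff (fun s => c (Sum.inl s)) s
      rw [← hf_def, hf0, coeff_zero] at this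
      exact this.symm
    · exact hinr j
  obtain ⟨Φ, hΦ₀, hΦ⟩ := exists_polynomial_linearIndependent_restrictLines p q hx₀.1 hind₀
  refine ⟨Φ, hΦ₀, fun x hx hxΦ hxc f hf hfI => ?_⟩
  have hindx := hΦ x hx.1 hxΦ
  obtain ⟨r, hr, hrk, hfr⟩ := exists_homogeneous_remainder hk hx.1 hxc hf
  rw [← Ideal.mem_span_singleton] at hfr
  suffices hr0 : r = 0 by simpa [hr0] using hfr
  have hrI : X b ^ (m + k - t) * r ∈ interIdeal x.1 (lines x.2) := by
    convert sub_mem hfI (Ideal.mul_mem_left _ (X b ^ (m + k - t)) (Ideal.mem_sup_left hfr)) using 1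
    ring
  have hr' := isHomogeneous_X_pow_mul b (m + k - t) hr
  rw [Nat.add_sub_cancel' ht] at hr'
  obtain ⟨g, hg, hgY⟩ := exists_sub_mul_mem_curveIdeal hx.1 hr' hrI
  rw [mem_curveIdeal_lines_iff, map_sub, sub_eq_zero] at hgY
  -- the multiples of the equation of `W` are spanned by the second part of the independent family
  set V := (homogeneousSubmodule (Fin (n + 1)) K m).map
    ((restrictLines x.2).toLinearMap ∘ₗ LinearMap.mulLeft K x.1)
  have hVfin : Module.finrank K V ≤ d * m + 1 := by
    have e : V = ((homogeneousSubmodule (Fin (n + 1)) K m).map (restrictLines x.2).toLinearMap).map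
        (LinearMap.mulLeft K (restrictLines x.2 x.1)) := by
      rw [← Submodule.map_comp]
      refine congrArg (Submodule.map · _) (LinearMap.ext fun g => ?_)
      simp
    rw [e, ← finrank_map_restrictLines hx.2.2 hτ hd (m := m) (by omega)]
    exact Submodule.finrank_map_le _ _
  have hindκ := hindx.comp Sum.inr Sum.inr_injective
  have hspan : Submodule.span K (Set.range ((fun j => restrictLines x.2 (p j + x.1 * q j)) ∘ Sum.inr)) =
      V := by
    refine Submodule.eq_of_le_of_finrank_le ?_ ?_
    · rw [Submodule.span_le]
      rintro _ ⟨j, rfl⟩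
      exact ⟨monomial (a j).1 1, isHomogeneous_monomial _ (a j).2, by simp [p, q]⟩
    · rw [finrank_span_eq_card hindκ, hcard]
      exact hVfin
  have hgV : restrictLines x.2 (x.1 * g) ∈ V := ⟨g, hg, rfl⟩
  rw [← hspan, Submodule.mem_span_range_iff_exists_fun] at hgV
  obtain ⟨c, hcg⟩ := hgV
  have hzero := Fintype.linearIndependent_iff.mp hindx
    (Sum.elim (fun s => coeff s.1.1 r) (fun j => - c j)) (by
      rw [Fintype.sum_sum_type]
      simp only [Sum.elim_inl, Sum.elim_inr, neg_smul, Finset.sum_neg_distrib]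
      simp only [Function.comp_apply] at hcg
      rw [hcg, ← hgY, add_neg_eq_zero]
      have hr_sum : r = ∑ s : ι₁, monomial s.1.1 (coeff s.1.1 r) := by
        ext s
        by_cases hs : s ∈ r.support
        · exact (hcoeff (fun s => coeff s.1.1 r) ⟨⟨s, by
            rw [Finsupp.degree_eq_weight_one]; exact hr (mem_support_iff.mp hs)⟩, hrk s hs⟩).symm
        · rw [coeff_sum]
          rw [notMem_support_iff] at hs
          rw [hs]
          symm
          refine Finset.sum_eq_zero fun s' _ => ?_
          rw [coeff_monomial]
          split_ifs with e
          · rw [e, hs]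
          · rfl
      conv_rhs => rw [hr_sum, Finset.mul_sum, map_sum]
      refine Finset.sum_congr rfl fun s _ => ?_
      rw [← map_smul]
      congr 1
      simp only [p, q, Sum.elim_inl, Pi.zero_apply, mul_zero, add_zero]
      rw [← mul_smul_comm, smul_monomial, smul_eq_mul, mul_one])
  ext s
  rw [coeff_zero]
  by_contra hs
  apply hs
  exact hzero (Sum.inl ⟨⟨s, by rw [Finsupp.degree_eq_weight_one]; exact hr hs⟩,
    hrk s (mem_support_iff.mpr hs)⟩)

end MaximalRank

/-! ### Configurations of lines with a prescribed type -/

section Configurations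

theorem connected_of_forall_exists_adj {V : Type*} {G : SimpleGraph V} (r : V → ℕ) (o : V)
    (h : ∀ x, x ≠ o → ∃ y, r y < r x ∧ G.Adj x y) : G.Connected := by
  have key : ∀ N x, r x < N → G.Reachable x o := by
    intro N
    induction N with
    | zero => intro x hx; omega
    | succ N ih =>
      intro x hx
      by_cases hxo : x = o
      · rw [hxo]
      · obtain ⟨y, hy, hxy⟩ := h x hxo
        exact hxy.reachable.trans (ih y (by omega))
  have : Nonempty V := ⟨o⟩
  exact ⟨fun x y => (key _ x (Nat.lt_succ_self _)).trans (key _ y (Nat.lt_succ_self _)).symm⟩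

variable {K : Type*} [Field K] {n d : ℕ} {τ : {i : Fin d // 0 < (i : ℕ)} → Fin d}

/-- Different lines whose incidences are those prescribed by a type form a tree of this type. -/
theorem isTreeOfType_of_inf_ne_bot_iff (hd : 0 < d) (hτ : ∀ i, τ i < i.1)
    {L : Fin d → Submodule K (Fin (n + 1) → K)} (hL : ∀ i, Module.finrank K (L i) = 2)
    (hinj : Function.Injective L)
    (h : ∀ (i : {i : Fin d // 0 < (i : ℕ)}) (j : Fin d), j < i.1 → (L i.1 ⊓ L j ≠ ⊥ ↔ j = τ i)) :
    IsTreeOfType τ L := by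
  have hadj : ∀ (i : Fin d) (hi : 0 < (i : ℕ)), (dualGraph L).Adj i (τ ⟨i, hi⟩) := fun i hi =>
    ⟨(hτ ⟨i, hi⟩).ne', (h ⟨i, hi⟩ _ (hτ ⟨i, hi⟩)).mpr rfl⟩
  have hthree : ∀ i j l : Fin d, j < i → l < i → j ≠ l → L i ⊓ L j ≠ ⊥ → L i ⊓ L l ≠ ⊥ → False := by
    intro i j l hj hl hjl hij hil
    have hi : 0 < (i : ℕ) := lt_of_le_of_lt (Nat.zero_le _) hj
    exact hjl (((h ⟨i, hi⟩ j hj).mp hij).trans ((h ⟨i, hi⟩ l hl).mp hil).symm)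
  let o : Fin d := ⟨0, hd⟩
  have ho : ∀ i : Fin d, i ≠ o → 0 < (i : ℕ) := fun i hi =>
    Nat.pos_of_ne_zero fun h => hi (Fin.ext h)
  refine ⟨⟨hL, hinj, ?_, ?_, ?_⟩, ?_, h⟩
  · intro i j l hij hil hjl
    by_contra hne
    have h1 : L i ⊓ L j ≠ ⊥ := fun h => hne (by rw [h, bot_inf_eq])
    have h2 : L i ⊓ L l ≠ ⊥ := fun h => hne (by
      rw [inf_assoc, inf_comm (L j), ← inf_assoc, h, bot_inf_eq])
    have h3 : L j ⊓ L l ≠ ⊥ := fun h => hne (by rw [inf_assoc, h, inf_bot_eq])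
    rcases lt_or_gt_of_ne hij with h4 | h4
    · rcases lt_or_gt_of_ne hjl with h5 | h5
      · exact hthree l i j (h4.trans h5) h5 hij (by rwa [inf_comm]) (by rwa [inf_comm])
      · exact hthree j i l h4 h5 hil (by rwa [inf_comm]) h3
    · rcases lt_or_gt_of_ne hil with h5 | h5
      · exact hthree l i j h5 (h4.trans h5) hij (by rwa [inf_comm]) (by rwa [inf_comm])
      · exact hthree i j l h4 h5 hjl h1 h2
  · refine connected_of_forall_exists_adj (fun i => (i : ℕ)) o fun i hi => ?_
    exact ⟨τ ⟨i, ho i hi⟩, hτ ⟨i, ho i hi⟩, hadj i (ho i hi)⟩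
  · have hedge : (dualGraph L).edgeSet =
        (fun i : {i : Fin d // 0 < (i : ℕ)} => s(i.1, τ i)) '' Set.univ := by
      ext e
      induction e using Sym2.ind with
      | _ i j =>
        rw [SimpleGraph.mem_edgeSet]
        constructor
        · rintro ⟨hij, hne⟩
          rcases lt_or_gt_of_ne hij with h4 | h4
          · have hj : 0 < (j : ℕ) := lt_of_le_of_lt (Nat.zero_le _) h4
            refine ⟨⟨j, hj⟩, trivial, ?_⟩
            rw [inf_comm] at hne
            have := (h ⟨j, hj⟩ i h4).mp hne
            simp only [← this]
            exact Sym2.eq_swap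
          · have hi : 0 < (i : ℕ) := lt_of_le_of_lt (Nat.zero_le _) h4
            refine ⟨⟨i, hi⟩, trivial, ?_⟩
            have := (h ⟨i, hi⟩ j h4).mp hne
            simp only [← this]
        · rintro ⟨⟨l, hl⟩, -, hlij⟩
          rw [← SimpleGraph.mem_edgeSet, ← hlij, SimpleGraph.mem_edgeSet]
          exact hadj l hl
    have hinj' : Function.Injective (fun i : {i : Fin d // 0 < (i : ℕ)} => s(i.1, τ i)) := by
      intro i j hij
      rcases Sym2.eq_iff.mp hij with ⟨h1, -⟩ | ⟨h1, h2⟩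
      · exact Subtype.ext h1
      · have h3 := hτ i
        have h4 := hτ j
        rw [h2] at h3
        rw [← h1] at h4
        exact absurd h3 h4.asymm
    have hcard : Fintype.card {i : Fin d // 0 < (i : ℕ)} = d - 1 := by
      rw [Fintype.card_subtype]
      have : (Finset.univ.filter fun i : Fin d => 0 < (i : ℕ)) = Finset.univ.erase o := by
        ext i
        simp [o, Fin.ext_iff, Nat.pos_iff_ne_zero]
      rw [this, Finset.card_erase_of_mem (Finset.mem_univ _), Finset.card_univ, Fintype.card_fin]
    rw [arithGenus, hedge, Set.ncard_image_of_injective _ hinj', Set.ncard_univ,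
      Nat.card_eq_fintype_card, hcard]
    omega
  · intro i
    refine connected_of_forall_exists_adj (fun j : {j | j ≤ i} => (j.1 : ℕ))
      ⟨o, Fin.le_def.mpr (Nat.zero_le _)⟩ fun j hj => ?_
    have hj0 := ho j.1 fun h => hj (Subtype.ext h)
    exact ⟨⟨τ ⟨j, hj0⟩, (hτ ⟨j, hj0⟩).le.trans j.2⟩, hτ ⟨j, hj0⟩, hadj j hj0⟩

/-- `d` different points of a projective space impose independent conditions on forms of degree
`d - 1`. -/
theorem exists_form_eval_eq_of_notMem_span {z : Fin d → Fin (n + 1) → K}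
    (hz : ∀ i j, i ≠ j → z i ∉ Submodule.span K {z j}) (u : Fin d → K) :
    ∃ f : MvPolynomial (Fin (n + 1)) K, f.IsHomogeneous (d - 1) ∧ ∀ i, eval (z i) f = u i := by
  classical
  choose! g hg1 hg0 hgz using fun i j hij => exists_linearForm (hz i j hij)
  have hne : ∀ i, eval (z i) (∏ j ∈ Finset.univ.erase i, g i j) ≠ 0 := fun i => by
    rw [map_prod]
    exact Finset.prod_ne_zero_iff.mpr fun j hj => hg0 i j (Finset.ne_of_mem_erase hj).symm
  refine ⟨∑ i, C (u i * (eval (z i) (∏ j ∈ Finset.univ.erase i, g i j))⁻¹) *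
    ∏ j ∈ Finset.univ.erase i, g i j, ?_, fun i => ?_⟩
  · refine IsHomogeneous.sum _ _ _ fun i _ => IsHomogeneous.C_mul ?_ _
    have := IsHomogeneous.prod (Finset.univ.erase i) (g i) (fun _ => 1)
      (fun j hj => hg1 i j (Finset.ne_of_mem_erase hj).symm)
    simpa using this
  · rw [map_sum, Finset.sum_eq_single i]
    · rw [map_mul, eval_C, inv_mul_cancel_right₀ (hne i)]
    · intro l _ hl
      rw [map_mul]
      refine mul_eq_zero_of_right _ ?_
      rw [map_prod]
      exact Finset.prod_eq_zero (Finset.mem_erase.mpr ⟨hl.symm, Finset.mem_univ i⟩)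
        (hgz l i hl _ (Submodule.mem_span_singleton_self _))
    · simp

end Configurations

/-! ### Points in general position -/

section GeneralPoints

variable {K : Type*} [Field K] {n d : ℕ}

theorem finrank_homogeneousSubmodule (c : ℕ) :
    Module.finrank K (homogeneousSubmodule (Fin (n + 1)) K c) = (n + c).choose n := by
  have hli : LinearIndependent K
      fun s : {s : Fin (n + 1) →₀ ℕ // s.degree = c} => monomial s.1 (1 : K) := by
    have := (basisMonomials (Fin (n + 1)) K).linearIndependent
    rw [coe_basisMonomials] at this
    exact this.comp _ Subtype.val_injective
  have : Fintype {s : Fin (n + 1) →₀ ℕ // s.degree = c} := Fintype.ofFinite _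
  rw [homogeneousSubmodule_eq_span_monomial, finrank_span_eq_card hli]
  have h : Fintype.card {s : Fin (n + 1) →₀ ℕ // s.degree = c} =
      ((Finset.univ : Finset (Fin (n + 1))).finsuppAntidiag c).card :=
    Fintype.card_of_subtype _ fun s => mem_finsuppAntidiag_univ_iff
  rw [h, Finset.card_finsuppAntidiag_nat_eq_choose, Finset.card_univ, Fintype.card_fin,
    show n + 1 + c - 1 = n + c by omega, ← Nat.choose_symm_add]

/-- The first `N` of the points `y i` have maximal rank with respect to forms of degree `c`: either
such forms take arbitrary values at them, or a form vanishing at all of them is zero. -/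
def HasMaximalRank (c N : ℕ) (y : Fin d → Fin n → K) : Prop :=
  (∀ u : Fin d → K, ∃ f : MvPolynomial (Fin n) K, f.IsHomogeneous c ∧
    ∀ i : Fin d, (i : ℕ) < N → eval (y i) f = u i) ∨
  ∀ f : MvPolynomial (Fin n) K, f.IsHomogeneous c → (∀ i : Fin d, (i : ℕ) < N → eval (y i) f = 0) →
    f = 0

theorem hasMaximalRank_zero (c : ℕ) (y : Fin d → Fin n → K) : HasMaximalRank c 0 y :=
  Or.inl fun _ => ⟨0, isHomogeneous_zero _ _ _, fun i hi => absurd hi (by omega)⟩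

/-- Maximal rank is preserved when a general point is added. -/
theorem HasMaximalRank.exists_polynomial {c N : ℕ} {y : Fin d → Fin n → K}
    (h : HasMaximalRank c N y) (hN : N < d) :
    ∃ φ : MvPolynomial (Fin n) K, φ ≠ 0 ∧ ∀ y' : Fin d → Fin n → K,
      (∀ i : Fin d, (i : ℕ) < N → y' i = y i) → eval (y' ⟨N, hN⟩) φ ≠ 0 →
        HasMaximalRank c (N + 1) y' := by
  by_cases hinj : ∀ f : MvPolynomial (Fin n) K, f.IsHomogeneous c →
      (∀ i : Fin d, (i : ℕ) < N → eval (y i) f = 0) → f = 0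
  · refine ⟨1, one_ne_zero, fun y' hy' _ => Or.inr fun f hf hfy => hinj f hf fun i hi => ?_⟩
    rw [← hy' i hi]
    exact hfy i (by omega)
  · have hsurj := h.resolve_right hinj
    push Not at hinj
    obtain ⟨φ, hφ, hφy, hφ0⟩ := hinj
    refine ⟨φ, hφ0, fun y' hy' hne => Or.inl fun u => ?_⟩
    obtain ⟨f, hf, hfu⟩ := hsurj u
    refine ⟨f + C ((u ⟨N, hN⟩ - eval (y' ⟨N, hN⟩) f) * (eval (y' ⟨N, hN⟩) φ)⁻¹) * φ,
      hf.add (hφ.C_mul _), fun i hi => ?_⟩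
    rcases Nat.lt_succ_iff_lt_or_eq.mp hi with hi | hi
    · rw [map_add, map_mul, hy' i hi, hφy i hi, mul_zero, add_zero, hfu i hi]
    · obtain rfl : i = ⟨N, hN⟩ := Fin.ext hi
      rw [map_add, map_mul, eval_C, inv_mul_cancel_right₀ hne]
      ring

theorem HasMaximalRank.surjective {c : ℕ} {y : Fin d → Fin (n + 1) → K} (h : HasMaximalRank c d y)
    (hd : d ≤ (n + c).choose n) (u : Fin d → K) :
    ∃ f : MvPolynomial (Fin (n + 1)) K, f.IsHomogeneous c ∧ ∀ i, eval (y i) f = u i := by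
  rcases h with h | h
  · obtain ⟨f, hf, hfu⟩ := h u
    exact ⟨f, hf, fun i => hfu i i.2⟩
  · let ev : homogeneousSubmodule (Fin (n + 1)) K c →ₗ[K] (Fin d → K) :=
      (LinearMap.pi fun i => (aeval (y i) : MvPolynomial (Fin (n + 1)) K →ₐ[K] K).toLinearMap).domRestrict _
    have hev : ∀ f i, ev f i = eval (y i) f.1 := fun f i => by
      change aeval (y i) f.1 = _
      rw [aeval_eq_eval]
    have hinj : Function.Injective ev := by
      rw [← LinearMap.ker_eq_bot, LinearMap.ker_eq_bot']
      intro f hf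
      refine Subtype.ext (h f.1 f.2 fun i _ => ?_)
      rw [← hev, hf, Pi.zero_apply]
    have hle := LinearMap.finrank_le_finrank_of_injective hinj
    rw [finrank_homogeneousSubmodule, Module.finrank_fintype_fun_eq_card, Fintype.card_fin] at hle
    have hsurj := (LinearMap.injective_iff_surjective_of_finrank_eq_finrank (f := ev) (by
      rw [finrank_homogeneousSubmodule, Module.finrank_fintype_fun_eq_card, Fintype.card_fin]
      omega)).mp hinj
    obtain ⟨f, hf⟩ := hsurj u
    exact ⟨f.1, f.2, fun i => by rw [← hev, hf]⟩

theorem HasMaximalRank.injective {c : ℕ} {y : Fin d → Fin (n + 1) → K} (h : HasMaximalRank c d y)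
    (hd : (n + c).choose n ≤ d) {f : MvPolynomial (Fin (n + 1)) K} (hf : f.IsHomogeneous c)
    (hfy : ∀ i, eval (y i) f = 0) : f = 0 := by
  rcases h with h | h
  · let ev : homogeneousSubmodule (Fin (n + 1)) K c →ₗ[K] (Fin d → K) :=
      (LinearMap.pi fun i => (aeval (y i) : MvPolynomial (Fin (n + 1)) K →ₐ[K] K).toLinearMap).domRestrict _
    have hev : ∀ f i, ev f i = eval (y i) f.1 := fun f i => by
      change aeval (y i) f.1 = _
      rw [aeval_eq_eval]
    have hsurj : Function.Surjective ev := by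
      intro u
      obtain ⟨f, hf, hfu⟩ := h u
      exact ⟨⟨f, hf⟩, funext fun i => by rw [hev, hfu i i.2]⟩
    have hle := LinearMap.finrank_le_finrank_of_surjective hsurj
    rw [finrank_homogeneousSubmodule, Module.finrank_fintype_fun_eq_card, Fintype.card_fin] at hle
    have hinj := (LinearMap.injective_iff_surjective_of_finrank_eq_finrank (f := ev) (by
      rw [finrank_homogeneousSubmodule, Module.finrank_fintype_fun_eq_card, Fintype.card_fin]
      omega)).mpr hsurj
    have := @hinj ⟨f, hf⟩ 0 (by
      rw [map_zero]
      exact funext fun i => by rw [hev, hfy, Pi.zero_apply])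
    exact congrArg Subtype.val this
  · exact h f hf fun i _ => hfy i

end GeneralPoints

/-! ### A tree whose points on a hyperplane are in general position -/

section GeneralTree

variable {K : Type*} [Field K] {n d : ℕ}

/-- The embedding of the hyperplane `x₀ = 0`. -/
def hyperplaneEmbedding (K : Type*) [Field K] (n : ℕ) : (Fin n → K) →ₗ[K] (Fin (n + 1) → K) where
  toFun y := Fin.cons 0 y
  map_add' y z := by
    funext j
    refine Fin.cases ?_ (fun j => ?_) j <;> simp
  map_smul' c y := by
    funext j
    refine Fin.cases ?_ (fun j => ?_) j <;> simp

@[simp]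
theorem hyperplaneEmbedding_zero (y : Fin n → K) : hyperplaneEmbedding K n y 0 = 0 := rfl

@[simp]
theorem hyperplaneEmbedding_succ (y : Fin n → K) (j : Fin n) :
    hyperplaneEmbedding K n y j.succ = y j := rfl

theorem hyperplaneEmbedding_injective : Function.Injective (hyperplaneEmbedding K n) := by
  intro y z h
  funext j
  simpa using congrFun h j.succ

/-- The conditions on the first `N` lines of a configuration: the `i`-th line joins `p i` and the point
`(0, y i)` of the hyperplane `x₀ = 0`. -/
structure IsGoodConfiguration (τ : {i : Fin d // 0 < (i : ℕ)} → Fin d) (b : Fin n) (c₁ c₂ N : ℕ)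
    (y : Fin d → Fin n → K) (p : Fin d → Fin (n + 1) → K) : Prop where
  y_ne : ∀ i : Fin d, (i : ℕ) < N → y i b ≠ 0
  p_zero : ∀ i : Fin d, (i : ℕ) < N → p i 0 = 1
  p_ne : ∀ i : Fin d, (i : ℕ) < N → p i b.succ ≠ 0
  p_mem : ∀ i : Fin d, (i : ℕ) < N → ∀ hi : 0 < (i : ℕ), ∃ c : K,
    p i = p (τ ⟨i, hi⟩) + c • hyperplaneEmbedding K n (y (τ ⟨i, hi⟩))
  p_notMem : ∀ i : Fin d, (i : ℕ) < N → ∀ hi : 0 < (i : ℕ), ∀ l < i, l ≠ τ ⟨i, hi⟩ →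
    p i ∉ Submodule.span K {p l, hyperplaneEmbedding K n (y l)}
  y_notMem : ∀ i : Fin d, (i : ℕ) < N → ∀ l < i,
    hyperplaneEmbedding K n (y i) ∉ Submodule.span K {p i - p l, hyperplaneEmbedding K n (y l)}
  maximalRank₁ : HasMaximalRank c₁ N y
  maximalRank₂ : HasMaximalRank c₂ N y

theorem exists_eval_ne_zero_of_ne_zero [Infinite K] {σ : Type*} {φ : MvPolynomial σ K} (h : φ ≠ 0) :
    ∃ y, eval y φ ≠ 0 := by
  by_contra! hcon
  exact h (MvPolynomial.funext fun y => by rw [hcon, map_zero])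

/-- A plane through the origin does not contain the hyperplane `x₀ = 0` when `n ≥ 3`. -/
theorem exists_polynomial_hyperplaneEmbedding_notMem (hn : 3 ≤ n) (a b : Fin (n + 1) → K) :
    ∃ φ : MvPolynomial (Fin n) K, φ ≠ 0 ∧ ∀ y, eval y φ ≠ 0 →
      hyperplaneEmbedding K n y ∉ Submodule.span K {a, b} := by
  set W := (Submodule.span K {a, b}).comap (hyperplaneEmbedding K n)
  have hW : Module.finrank K W ≤ 2 := by
    rw [(Submodule.equivMapOfInjective _ hyperplaneEmbedding_injective W).finrank_eq]
    refine (Submodule.finrank_mono (Submodule.map_comap_le _ _)).trans ?_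
    classical
    have := finrank_span_finset_le_card (R := K) ({a, b} : Finset (Fin (n + 1) → K))
    rw [Finset.coe_pair] at this
    exact this.trans Finset.card_le_two
  obtain ⟨y, hy⟩ : ∃ y, y ∉ W := by
    by_contra! hcon
    rw [(Submodule.eq_top_iff').mpr hcon, finrank_top, Module.finrank_fintype_fun_eq_card,
      Fintype.card_fin] at hW
    omega
  obtain ⟨φ, -, hφy, hφW⟩ := exists_linearForm hy
  exact ⟨φ, fun h => hφy (by rw [h, map_zero]), fun z hz hmem => hz (hφW z hmem)⟩

variable {τ : {i : Fin d // 0 < (i : ℕ)} → Fin d} {b : Fin n} {c₁ c₂ : ℕ}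

theorem IsGoodConfiguration.exists_succ [Infinite K] (hn : 3 ≤ n) (hτ : ∀ i, τ i < i.1) {N : ℕ}
    {y : Fin d → Fin n → K} {p : Fin d → Fin (n + 1) → K}
    (h : IsGoodConfiguration τ b c₁ c₂ N y p) (hN : N < d) :
    ∃ y' p', IsGoodConfiguration (K := K) τ b c₁ c₂ (N + 1) y' p' := by
  classical
  let ι := hyperplaneEmbedding K n
  let o : Fin d := ⟨N, hN⟩
  -- the new node: a general point of the line chosen by the type
  obtain ⟨p₀, hp0, hpb, hpτ, hpl⟩ : ∃ p₀ : Fin (n + 1) → K, p₀ 0 = 1 ∧ p₀ b.succ ≠ 0 ∧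
      (∀ hi : 0 < N, ∃ c : K, p₀ = p (τ ⟨o, hi⟩) + c • ι (y (τ ⟨o, hi⟩))) ∧
      ∀ hi : 0 < N, ∀ l < o, l ≠ τ ⟨o, hi⟩ → p₀ ∉ Submodule.span K {p l, ι (y l)} := by
    by_cases hi : 0 < N
    · set j := τ ⟨o, hi⟩
      have hj : (j : ℕ) < N := hτ ⟨o, hi⟩
      have hyj := h.y_ne j hj
      have hbad : (⋃ l : Fin d, {c : K | (l < o ∧ l ≠ j) ∧
          p j + c • ι (y j) ∈ Submodule.span K {p l, ι (y l)}}).Finite := by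
        refine Set.finite_iUnion fun l => Set.Subsingleton.finite ?_
        rintro c ⟨⟨hl, hlj⟩, hc⟩ c' ⟨-, hc'⟩
        by_contra hcc
        -- otherwise the direction of the line `j` lies on the line `l`
        have h1 : ι (y j) ∈ Submodule.span K {p l, ι (y l)} := by
          have h2 := sub_mem hc hc'
          rw [add_sub_add_left_eq_sub, ← sub_smul] at h2
          exact (Submodule.smul_mem_iff _ (sub_ne_zero.mpr hcc)).mp h2
        obtain ⟨r, s, hrs⟩ := Submodule.mem_span_pair.mp h1
        have hr : r = 0 := by
          have := congrFun hrs 0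
          simpa [ι, h.p_zero l hl] using this
        rw [hr, zero_smul, zero_add] at hrs
        rcases lt_or_gt_of_ne hlj with hlt | hlt
        · exact h.y_notMem j hj l hlt (hrs ▸ Submodule.smul_mem _ _ (Submodule.subset_span (by simp [ι])))
        · refine h.y_notMem l hl j hlt ?_
          have hs : s ≠ 0 := by
            rintro rfl
            apply hyj
            have := congrFun hrs b.succ
            simpa [ι] using this.symm
          rw [← Submodule.smul_mem_iff _ hs, hrs]
          exact Submodule.subset_span (by simp [ι])
      obtain ⟨c, hc⟩ := (hbad.union (Set.finite_singleton (- p j b.succ / y j b))).exists_notMem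
      rw [Set.mem_union, not_or, Set.mem_singleton_iff, Set.mem_iUnion, not_exists] at hc
      refine ⟨p j + c • ι (y j), by simp [ι, h.p_zero j hj], ?_, fun _ => ⟨c, rfl⟩,
        fun _ l hl hlj hmem => hc.1 l ⟨⟨hl, hlj⟩, hmem⟩⟩
      intro h0
      apply hc.2
      rw [eq_div_iff hyj]
      simp only [Pi.add_apply, Pi.smul_apply, smul_eq_mul, ι, hyperplaneEmbedding_succ] at h0
      linear_combination h0
    · exact ⟨fun _ => 1, rfl, one_ne_zero, fun h => absurd h hi, fun h => absurd h hi⟩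
  -- the new point on the hyperplane avoids finitely many hypersurfaces
  obtain ⟨φ₁, hφ₁0, hφ₁⟩ := h.maximalRank₁.exists_polynomial hN
  obtain ⟨φ₂, hφ₂0, hφ₂⟩ := h.maximalRank₂.exists_polynomial hN
  choose ψ hψ0 hψ using fun l => exists_polynomial_hyperplaneEmbedding_notMem hn (p₀ - p l) (ι (y l))
  obtain ⟨y₀, hy₀⟩ := exists_eval_ne_zero_of_ne_zero
    (mul_ne_zero (mul_ne_zero (mul_ne_zero hφ₁0 hφ₂0) (X_ne_zero (R := K) b))
      (Finset.prod_ne_zero_iff.mpr fun l (_ : l ∈ Finset.univ) => hψ0 l))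
  rw [map_mul, map_mul, map_mul, eval_X, map_prod] at hy₀
  obtain ⟨⟨⟨hy1, hy2⟩, hyb⟩, hyψ⟩ : ((eval y₀ φ₁ ≠ 0 ∧ eval y₀ φ₂ ≠ 0) ∧ y₀ b ≠ 0) ∧
      ∀ l, eval y₀ (ψ l) ≠ 0 := by
    simp only [mul_ne_zero_iff, Finset.prod_ne_zero_iff, Finset.mem_univ, true_imp_iff] at hy₀
    exact hy₀
  have hold : ∀ i : Fin d, (i : ℕ) < N → i ≠ o := fun i hi e => by
    rw [e] at hi; exact lt_irrefl _ hi
  have hcases : ∀ i : Fin d, (i : ℕ) < N + 1 → (i : ℕ) < N ∨ i = o := fun i hi =>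
    (Nat.lt_succ_iff_lt_or_eq.mp hi).imp_right fun h => Fin.ext h
  refine ⟨Function.update y o y₀, Function.update p o p₀, ?_, ?_, ?_, ?_, ?_, ?_, ?_, ?_⟩
  · intro i hi
    rcases hcases i hi with hi | rfl
    · rw [Function.update_of_ne (hold i hi)]; exact h.y_ne i hi
    · rwa [Function.update_self]
  · intro i hi
    rcases hcases i hi with hi | rfl
    · rw [Function.update_of_ne (hold i hi)]; exact h.p_zero i hi
    · rwa [Function.update_self]
  · intro i hi
    rcases hcases i hi with hi | rfl
    · rw [Function.update_of_ne (hold i hi)]; exact h.p_ne i hi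
    · rwa [Function.update_self]
  · intro i hi hi0
    have hτi : (τ ⟨i, hi0⟩ : ℕ) < i := hτ ⟨i, hi0⟩
    have hτo := hold (τ ⟨i, hi0⟩) (by omega)
    rw [Function.update_of_ne hτo, Function.update_of_ne hτo]
    rcases hcases i hi with hi | rfl
    · rw [Function.update_of_ne (hold i hi)]; exact h.p_mem i hi hi0
    · rw [Function.update_self]; exact hpτ hi0
  · intro i hi hi0 l hl hlτ
    have hlo := hold l (by have : (l : ℕ) < i := hl; omega)
    rw [Function.update_of_ne hlo, Function.update_of_ne hlo]
    rcases hcases i hi with hi | rfl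
    · rw [Function.update_of_ne (hold i hi)]; exact h.p_notMem i hi hi0 l hl hlτ
    · rw [Function.update_self]; exact hpl hi0 l hl hlτ
  · intro i hi l hl
    have hlo := hold l (by have : (l : ℕ) < i := hl; omega)
    rw [Function.update_of_ne hlo, Function.update_of_ne hlo]
    rcases hcases i hi with hi | rfl
    · rw [Function.update_of_ne (hold i hi), Function.update_of_ne (hold i hi)]
      exact h.y_notMem i hi l hl
    · rw [Function.update_self, Function.update_self]
      exact hψ l y₀ (hyψ l)
  · refine hφ₁ _ (fun i hi => Function.update_of_ne (hold i hi) _ _) ?_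
    rwa [Function.update_self]
  · refine hφ₂ _ (fun i hi => Function.update_of_ne (hold i hi) _ _) ?_
    rwa [Function.update_self]

variable (K) in
theorem exists_isGoodConfiguration [Infinite K] (hn : 3 ≤ n) (hτ : ∀ i, τ i < i.1) (b : Fin n)
    (c₁ c₂ : ℕ) :
    ∃ (y : Fin d → Fin n → K) (p : Fin d → Fin (n + 1) → K),
      IsGoodConfiguration τ b c₁ c₂ d y p := by
  suffices H : ∀ N ≤ d, ∃ (y : Fin d → Fin n → K) (p : Fin d → Fin (n + 1) → K),
      IsGoodConfiguration τ b c₁ c₂ N y p from H d le_rfl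
  intro N
  induction N with
  | zero =>
    intro _
    refine ⟨0, 0, ?_, ?_, ?_, ?_, ?_, ?_, hasMaximalRank_zero _ _, hasMaximalRank_zero _ _⟩ <;>
    · intro i hi
      exact absurd hi (by omega)
  | succ N ih =>
    intro hN
    obtain ⟨y, p, h⟩ := ih (by omega)
    exact h.exists_succ hn hτ hN

end GeneralTree

section ConfigurationTree

variable {K : Type*} [Field K] {n d : ℕ} {τ : {i : Fin d // 0 < (i : ℕ)} → Fin d} {b : Fin n}
  {c₁ c₂ : ℕ} {y : Fin d → Fin n → K} {p : Fin d → Fin (n + 1) → K}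

/-- The spanning vectors of the lines of a configuration. -/
def configurationVectors (y : Fin d → Fin n → K) (p : Fin d → Fin (n + 1) → K) (i : Fin d) :
    Fin 2 → Fin (n + 1) → K :=
  ![p i, hyperplaneEmbedding K n (y i)]

theorem mem_lines_configurationVectors {i : Fin d} {x : Fin (n + 1) → K} :
    x ∈ lines (configurationVectors y p) i ↔
      ∃ r s : K, r • p i + s • hyperplaneEmbedding K n (y i) = x :=
  mem_lines_iff _ _ _

theorem lines_configurationVectors (i : Fin d) :
    lines (configurationVectors y p) i = Submodule.span K {p i, hyperplaneEmbedding K n (y i)} := by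
  ext x
  rw [mem_lines_configurationVectors, Submodule.mem_span_pair]

theorem base_mem_lines (i : Fin d) : p i ∈ lines (configurationVectors y p) i :=
  mem_lines_configurationVectors.mpr ⟨1, 0, by simp⟩

theorem direction_mem_lines (i : Fin d) :
    hyperplaneEmbedding K n (y i) ∈ lines (configurationVectors y p) i :=
  mem_lines_configurationVectors.mpr ⟨0, 1, by simp⟩

variable (h : IsGoodConfiguration τ b c₁ c₂ d y p)
include h

theorem IsGoodConfiguration.direction_notMem_lines {i l : Fin d} (hl : l < i) :
    hyperplaneEmbedding K n (y i) ∉ lines (configurationVectors y p) l := by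
  intro hmem
  obtain ⟨r, s, hrs⟩ := mem_lines_configurationVectors.mp hmem
  have hr : r = 0 := by
    have := congrFun hrs 0
    simpa [h.p_zero l l.2] using this
  rw [hr, zero_smul, zero_add] at hrs
  exact h.y_notMem i i.2 l hl (hrs ▸ Submodule.smul_mem _ _ (Submodule.subset_span (by simp)))

theorem IsGoodConfiguration.inf_ne_bot_iff (i : {i : Fin d // 0 < (i : ℕ)}) (j : Fin d)
    (hj : j < i.1) : lines (configurationVectors y p) i.1 ⊓ lines (configurationVectors y p) j ≠ ⊥ ↔
      j = τ i := by
  obtain ⟨i, hi⟩ := i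
  have hpi : p i ≠ 0 := fun h0 => by
    have := h.p_zero i i.2
    rw [h0] at this
    exact zero_ne_one this
  constructor
  · intro hne
    obtain ⟨x, ⟨hxi, hxj⟩, hx0⟩ := Submodule.exists_mem_ne_zero_of_ne_bot hne
    by_contra hjτ
    obtain ⟨r, s, rfl⟩ := mem_lines_configurationVectors.mp hxi
    by_cases hs : s = 0
    · subst hs
      rw [zero_smul, add_zero] at hxj hx0
      have hr : r ≠ 0 := fun hr => hx0 (by rw [hr, zero_smul])
      refine h.p_notMem i i.2 hi j hj hjτ ?_
      rw [← lines_configurationVectors]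
      exact (Submodule.smul_mem_iff _ hr).mp hxj
    · obtain ⟨r', s', hrs⟩ := mem_lines_configurationVectors.mp hxj
      have hr : r' = r := by
        have := congrFun hrs 0
        simpa [h.p_zero i i.2, h.p_zero j j.2] using this
      subst hr
      refine h.y_notMem i i.2 j hj ((Submodule.smul_mem_iff _ hs).mp ?_)
      refine Submodule.mem_span_pair.mpr ⟨-r', s', ?_⟩
      rw [neg_smul, smul_sub, neg_sub]
      rw [← sub_eq_iff_eq_add'] at hrs
      rw [← hrs]
      abel
  · rintro rfl hbot
    obtain ⟨c, hc⟩ := h.p_mem i i.2 hi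
    have hmem : p i ∈ lines (configurationVectors y p) i ⊓
        lines (configurationVectors y p) (τ ⟨i, hi⟩) :=
      ⟨base_mem_lines i, mem_lines_configurationVectors.mpr ⟨1, c, by rw [one_smul, ← hc]⟩⟩
    rw [hbot] at hmem
    exact hpi hmem

theorem IsGoodConfiguration.isTreeOfType (hd : 0 < d) (hτ : ∀ i, τ i < i.1) :
    IsTreeOfType τ (lines (configurationVectors y p)) := by
  refine isTreeOfType_of_inf_ne_bot_iff hd hτ (fun i => ?_) ?_ h.inf_ne_bot_iff
  · have hli : LinearIndependent K (configurationVectors y p i) := by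
      rw [configurationVectors, LinearIndependent.pair_iff]
      intro r s hrs
      have hr : r = 0 := by
        have := congrFun hrs 0
        simpa [h.p_zero i i.2] using this
      have := congrFun hrs b.succ
      exact ⟨hr, by simpa [hr, h.y_ne i i.2] using this⟩
    rw [lines, finrank_span_eq_card hli, Fintype.card_fin]
  · intro i j hij
    by_contra hne
    rcases lt_or_gt_of_ne hne with hlt | hlt
    · exact h.direction_notMem_lines hlt (hij ▸ direction_mem_lines j)
    · exact h.direction_notMem_lines hlt (hij ▸ direction_mem_lines i)

theorem IsGoodConfiguration.hyperplanePoint_zero_ne (i : Fin d) :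
    hyperplanePoint (configurationVectors y p) b.succ i 0 ≠ 0 := by
  simp [hyperplanePoint, configurationVectors, h.p_zero i i.2, h.y_ne i i.2]

theorem IsGoodConfiguration.hyperplanePoint_notMem_lines {i j : Fin d} (hj : j < i) :
    hyperplanePoint (configurationVectors y p) b.succ i ∉ lines (configurationVectors y p) j := by
  intro hmem
  have hi : 0 < (i : ℕ) := lt_of_le_of_lt (Nat.zero_le _) hj
  have hjτ : j = τ ⟨i, hi⟩ := (h.inf_ne_bot_iff ⟨i, hi⟩ j hj).mp fun hbot => by
    have h1 : hyperplanePoint (configurationVectors y p) b.succ i ∈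
        lines (configurationVectors y p) i ⊓ lines (configurationVectors y p) j :=
      ⟨hyperplanePoint_mem _ _ _, hmem⟩
    rw [hbot, Submodule.mem_bot] at h1
    exact h.hyperplanePoint_zero_ne i (by rw [h1]; rfl)
  obtain ⟨c, hc⟩ := h.p_mem i i.2 hi
  have hp : p i ∈ lines (configurationVectors y p) j :=
    mem_lines_configurationVectors.mpr ⟨1, c, by rw [one_smul, hjτ, ← hc]⟩
  refine h.direction_notMem_lines hj ((Submodule.smul_mem_iff _ (h.p_ne i i.2)).mp ?_)
  have h2 := sub_mem (Submodule.smul_mem _ (y i b) hp) hmem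
  convert h2 using 1
  simp [hyperplanePoint, configurationVectors]

theorem IsGoodConfiguration.exists_form_eval_hyperplanePoint_eq (u : Fin d → K) :
    ∃ f : MvPolynomial (Fin (n + 1)) K, f.IsHomogeneous (d - 1) ∧
      ∀ i, eval (hyperplanePoint (configurationVectors y p) b.succ i) f = u i := by
  refine exists_form_eval_eq_of_notMem_span (fun i j hij hmem => ?_) u
  rcases lt_or_gt_of_ne hij with hlt | hlt
  · obtain ⟨r, hr⟩ := Submodule.mem_span_singleton.mp hmem
    have hr0 : r ≠ 0 := by
      rintro rfl
      rw [zero_smul] at hr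
      exact h.hyperplanePoint_zero_ne i (by rw [← hr]; rfl)
    refine h.hyperplanePoint_notMem_lines hlt ((Submodule.smul_mem_iff _ hr0).mp ?_)
    rw [hr]
    exact hyperplanePoint_mem _ _ _
  · refine h.hyperplanePoint_notMem_lines hlt ?_
    exact (Submodule.span_le.mpr (Set.singleton_subset_iff.mpr (hyperplanePoint_mem _ _ _))) hmem

end ConfigurationTree

/-! ### Maximal rank for a multiple hyperplane -/

section MultipleHyperplane

variable {K : Type*} [Field K] {n d : ℕ}

theorem eval_hyperplaneEmbedding (y : Fin n → K) (f : MvPolynomial (Fin (n + 1)) K) :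
    eval (hyperplaneEmbedding K n y) f = eval y ((finSuccEquiv K n f).coeff 0) := by
  have := eval_eq_eval_mv_eval' y 0 f
  rw [← Polynomial.coeff_zero_eq_eval_zero, Polynomial.coeff_map] at this
  exact this

/-- A form of degree `c` on the hyperplane `x₀ = 0` extends to a form on the whole space. -/
theorem exists_form_eval_hyperplaneEmbedding_eq {c : ℕ} {f : MvPolynomial (Fin n) K}
    (hf : f.IsHomogeneous c) : ∃ g : MvPolynomial (Fin (n + 1)) K, g.IsHomogeneous c ∧
      ∀ y, eval (hyperplaneEmbedding K n y) g = eval y f :=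
  ⟨rename Fin.succ f, hf.rename_isHomogeneous, fun y => by
    rw [eval_rename]
    rfl⟩

theorem exists_eq_X_zero_mul_of_eval_hyperplaneEmbedding [Infinite K]
    {f : MvPolynomial (Fin (n + 1)) K} {t : ℕ} (hf : f.IsHomogeneous t)
    (h : ∀ y, eval (hyperplaneEmbedding K n y) f = 0) :
    f = 0 ∨ ∃ (m : ℕ) (g : MvPolynomial (Fin (n + 1)) K), t = m + 1 ∧ g.IsHomogeneous m ∧
      f = X 0 * g := by
  have h0 : (finSuccEquiv K n f).coeff 0 = 0 :=
    MvPolynomial.funext fun y => by rw [← eval_hyperplaneEmbedding, h, map_zero]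
  obtain ⟨Q, hQ⟩ := Polynomial.X_dvd_iff.mpr h0
  have hfg : f = X 0 * (finSuccEquiv K n).symm Q := by
    apply (finSuccEquiv K n).injective
    rw [map_mul, finSuccEquiv_X_zero, AlgEquiv.apply_symm_apply, hQ]
  rcases t with _ | m
  · left
    rw [← homogeneousComponent_eq_self hf, hfg,
      homogeneousComponent_mul_eq_zero (isHomogeneous_X K 0) one_pos]
  · refine Or.inr ⟨m, _, rfl, homogeneousComponent_isHomogeneous m ((finSuccEquiv K n).symm Q), ?_⟩
    conv_lhs => rw [← homogeneousComponent_eq_self hf, hfg]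
    rw [homogeneousComponent_mul_of_isHomogeneous (isHomogeneous_X K 0)]

variable [Infinite K] {k : ℕ} {τ : {i : Fin d // 0 < (i : ℕ)} → Fin d}
  {v : Fin d → Fin 2 → Fin (n + 1) → K} {y : Fin d → Fin n → K} {b : Fin n}

/-- If the points of the tree on `x₀ = 0` impose independent conditions on forms of degree `e`, then
forms of degree `e + k - 1` restrict surjectively to the intersection of the tree with the multiple
hyperplane `x₀ ^ k = 0`. The proof peels off one copy of the hyperplane at a time. -/
theorem exists_sub_mem_interIdeal_X_pow (hT : IsTreeOfType τ (lines v)) (hτ : ∀ i, τ i < i.1)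
    (hd : 0 < d) (hk : 0 < k) (hy : ∀ i, hyperplaneEmbedding K n (y i) ∈ lines v i)
    (hyb : ∀ i, y i b ≠ 0) (hL : ∀ i, ∃ x ∈ lines v i, x 0 ≠ 0) {e : ℕ}
    (he : ∀ u : Fin d → K, ∃ f : MvPolynomial (Fin n) K, f.IsHomogeneous e ∧ ∀ i, eval (y i) f = u i)
    {M : ℕ} (hM : d + k ≤ M) (heM : e + k - 1 ≤ M) {f : MvPolynomial (Fin (n + 1)) K}
    (hf : f.IsHomogeneous M) :
    ∃ g : MvPolynomial (Fin (n + 1)) K, g.IsHomogeneous (e + k - 1) ∧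
      f - X b.succ ^ (M - (e + k - 1)) * g ∈ interIdeal (X 0 ^ k) (lines v) := by
  have hsurj : ∀ m, e ≤ m → ∀ u : Fin d → K, ∃ f : MvPolynomial (Fin (n + 1)) K,
      f.IsHomogeneous m ∧ ∀ i, eval (hyperplaneEmbedding K n (y i)) f = u i := by
    intro m hm u
    refine exists_form_eval_eq_of_le (c := b.succ) (m := e) hyb hm (fun u => ?_) u
    obtain ⟨f, hf, hfu⟩ := he u
    obtain ⟨g, hg, hgf⟩ := exists_form_eval_hyperplaneEmbedding_eq hf
    exact ⟨g, hg, fun i => by rw [hgf, hfu]⟩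
  suffices H : ∀ j ≤ k, ∃ g h : MvPolynomial (Fin (n + 1)) K, g.IsHomogeneous (e + k - 1) ∧
      h.IsHomogeneous (M - j) ∧
      f - X b.succ ^ (M - (e + k - 1)) * g - X 0 ^ j * h ∈ curveIdeal (lines v) by
    obtain ⟨g, h, hg, -, hY⟩ := H k le_rfl
    exact ⟨g, hg, mem_interIdeal_of_sub_mul_mem hY⟩
  intro j
  induction j with
  | zero => exact fun _ => ⟨0, f, isHomogeneous_zero _ _ _, by simpa using hf, by simp⟩
  | succ j ih =>
    intro hj
    obtain ⟨g, h, hg, hh, hY⟩ := ih (by omega)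
    obtain ⟨g', hg', hgu⟩ := hsurj (e + k - 1 - j) (by omega) fun i =>
      (y i b ^ (M - (e + k - 1)))⁻¹ * eval (hyperplaneEmbedding K n (y i)) h
    have hsub : (h - X b.succ ^ (M - (e + k - 1)) * g').IsHomogeneous (M - (j + 1) + 1) := by
      rw [show M - (j + 1) + 1 = M - j by omega]
      refine hh.sub ?_
      have := isHomogeneous_X_pow_mul b.succ (M - (e + k - 1)) hg'
      rwa [show e + k - 1 - j + (M - (e + k - 1)) = M - j by omega] at this
    obtain ⟨h', hh', hY'⟩ := exists_sub_X_mul_mem_curveIdeal hT hτ hd (a := 0) (by omega) hy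
      (fun i => rfl) hL (hsurj _ (by omega)) hsub (fun i => by
        rw [map_sub, map_mul, map_pow, eval_X, hyperplaneEmbedding_succ, hgu,
          mul_inv_cancel_left₀ (pow_ne_zero _ (hyb i)), sub_self])
    refine ⟨g + X 0 ^ j * g', h', hg.add ?_, hh', ?_⟩
    · have := isHomogeneous_X_pow_mul (0 : Fin (n + 1)) j hg'
      rwa [show e + k - 1 - j + j = e + k - 1 by omega] at this
    · convert add_mem hY (Ideal.mul_mem_left _ (X 0 ^ j) hY') using 1
      ring

/-- If no nonzero form of degree `t₁` on the hyperplane `x₀ = 0` vanishes at the points of the tree on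
this hyperplane, then a form of degree `t ≤ t₁` vanishing on the intersection of the tree with
`x₀ ^ j = 0` is a multiple of `x₀ ^ j`. -/
theorem X_pow_dvd_of_sub_mem_curveIdeal
    (hy : ∀ i, hyperplaneEmbedding K n (y i) ∈ lines v i)
    (hyb : ∀ i, y i b ≠ 0) (hL : ∀ i, ∃ x ∈ lines v i, x 0 ≠ 0) {t₁ : ℕ}
    (ht₁ : ∀ f : MvPolynomial (Fin n) K, f.IsHomogeneous t₁ → (∀ i, eval (y i) f = 0) → f = 0)
    (N j : ℕ) : ∀ {t e : ℕ} {f h : MvPolynomial (Fin (n + 1)) K}, t ≤ t₁ → e + j = t + N →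
      f.IsHomogeneous t → h.IsHomogeneous e →
      X b.succ ^ N * f - X 0 ^ j * h ∈ curveIdeal (lines v) → X 0 ^ j ∣ f := by
  induction j with
  | zero => intros; simp
  | succ j ih =>
    intro t e f h ht hej hf hh hY
    have hvan : ∀ z, eval (hyperplaneEmbedding K n z) f = 0 := by
      have h1 : (finSuccEquiv K n (X b.succ ^ (t₁ - t) * f)).coeff 0 = 0 := by
        have h2 := isHomogeneous_X_pow_mul b.succ (t₁ - t) hf
        rw [Nat.add_sub_cancel' ht] at h2
        refine ht₁ _ (h2.finSuccEquiv_coeff_isHomogeneous 0 t₁ (zero_add _)) fun i => ?_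
        rw [← eval_hyperplaneEmbedding, map_mul]
        have h3 := restrictLines_eq_zero_iff.mp (mem_curveIdeal_lines_iff.mp hY) i _ (hy i)
        rw [map_sub, map_mul, map_mul, map_pow, map_pow, eval_X, eval_X, hyperplaneEmbedding_zero,
          zero_pow (Nat.succ_ne_zero j), zero_mul, sub_zero, hyperplaneEmbedding_succ] at h3
        rw [(mul_eq_zero.mp h3).resolve_left (pow_ne_zero _ (hyb i)), mul_zero]
      rw [map_mul, map_pow, finSuccEquiv_X_succ, ← Polynomial.C_pow, Polynomial.coeff_C_mul] at h1
      have h4 := (mul_eq_zero.mp h1).resolve_left (pow_ne_zero _ (X_ne_zero b))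
      intro z
      rw [eval_hyperplaneEmbedding, h4, map_zero]
    rcases exists_eq_X_zero_mul_of_eval_hyperplaneEmbedding hf hvan with rfl | ⟨m, g, rfl, hg, rfl⟩
    · exact dvd_zero _
    · rw [pow_succ']
      refine mul_dvd_mul_left _ (ih (t := m) (e := e) (h := h) (by omega) (by omega) hg hh ?_)
      rw [mem_curveIdeal_lines_iff] at hY ⊢
      have h5 : (X b.succ ^ N * g - X 0 ^ j * h).IsHomogeneous (m + N) := by
        refine (isHomogeneous_X_pow_mul b.succ N hg).sub ?_
        have := isHomogeneous_X_pow_mul (0 : Fin (n + 1)) j hh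
        rwa [show e + j = m + N by omega] at this
      refine restrictLines_eq_zero_of_mul (isHomogeneous_X K 0) h5 (by simpa using hL) ?_
      rw [← hY]
      congr 1
      ring

end MultipleHyperplane

/-! ### Vanishing for the general pair -/

/-- Since `e < (m + e).choose m`, there are a least `e` with `d ≤ (m + e).choose m` and a greatest `t` with
`(m + t).choose m ≤ d`. -/
theorem exists_degree_bounds (m d : ℕ) (hm : 1 ≤ m) (hd : 1 ≤ d) :
    ∃ e t : ℕ, (d ≤ (m + e).choose m ∧ ∀ e' : ℕ, d ≤ (m + e').choose m → e ≤ e') ∧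
      (m + t).choose m ≤ d ∧ ∀ t' : ℕ, (m + t').choose m ≤ d → t' ≤ t := by
  classical
  have hlow : ∀ e : ℕ, e < (m + e).choose m := by
    intro e
    have h1 : (1 + e).choose e ≤ (m + e).choose e := Nat.choose_le_choose _ (by omega)
    rw [Nat.choose_symm_add]
    have h2 : (1 + e).choose e = e + 1 := by rw [add_comm, Nat.choose_succ_self_right]
    omega
  have hex : ∃ e, d ≤ (m + e).choose m := ⟨d, (hlow d).le⟩
  refine ⟨Nat.find hex, Nat.findGreatest (fun t => (m + t).choose m ≤ d) d,
    ⟨Nat.find_spec hex, fun e' he' => Nat.find_min' hex he'⟩, ?_, ?_⟩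
  · exact Nat.findGreatest_spec (P := fun t => (m + t).choose m ≤ d) (Nat.zero_le d)
      (by simpa using hd)
  · intro t' ht'
    exact Nat.le_findGreatest ((hlow t').le.trans ht') ht'

/-- One open condition settles all twists: `h¹` vanishes in the degrees from `e + k - 1` on once a
surjectivity holds in degree `e + k - 1`, and `h⁰` vanishes in the degrees up to `t₁` once an injectivity
holds in degree `t₁`. The condition is satisfied by the multiple hyperplane `x₀ ^ k = 0` and a tree whose
points on it are in general position. -/
theorem holdsForGeneral_hCoh_eq_zero {K : Type*} [Field K] [Infinite K] {n d k : ℕ} (hn : 3 ≤ n)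
    (hd : 1 ≤ d) (hk : 0 < k) {τ : {i : Fin d // 0 < (i : ℕ)} → Fin d} (hτ : ∀ i, τ i < i.1) {e t₁ : ℕ}
    (he : d ≤ (n - 1 + e).choose (n - 1)) (ht₁ : (n - 1 + t₁).choose (n - 1) ≤ d) :
    HoldsForGeneral pairCoord (hypersurfaceTreePairs K n k τ) fun x =>
      (∀ t : ℕ, e + k - 1 ≤ t → hCoh x.1 (interIdeal x.1 (lines x.2)) t 1 = 0) ∧
      ∀ t : ℤ, t ≤ t₁ → hCoh x.1 (interIdeal x.1 (lines x.2)) t 0 = 0 := by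
  obtain ⟨n, rfl⟩ : ∃ m, n = m + 1 := ⟨n - 1, by omega⟩
  rw [Nat.add_sub_cancel] at he ht₁
  let b : Fin (n + 1) := 0
  obtain ⟨y, p, hg⟩ := exists_isGoodConfiguration K hn hτ b e t₁
  set v := configurationVectors y p with hv
  have hT : IsTreeOfType τ (lines v) := hg.isTreeOfType hd hτ
  have hL : ∀ i, ∃ x ∈ lines v i, x 0 ≠ 0 := fun i =>
    ⟨p i, base_mem_lines i, by rw [hg.p_zero i i.2]; exact one_ne_zero⟩
  have hyb : ∀ i, y i b ≠ 0 := fun i => hg.y_ne i i.2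
  have hF : (X 0 ^ k : MvPolynomial (Fin (n + 1 + 1)) K).IsHomogeneous k := by
    simpa using (isHomogeneous_X K (0 : Fin (n + 1 + 1))).pow k
  set M := d + k + (e + k - 1) + t₁ with hM
  let x₀ : PairData K (n + 1) d := (X 0 ^ k, v)
  have hx₀ : x₀ ∈ hypersurfaceTreePairs K (n + 1) k τ := ⟨hF, pow_ne_zero _ (X_ne_zero 0), hT⟩
  have hc₀ : x₀.1.coeff (Finsupp.single 0 k) ≠ 0 := by
    simp [x₀, X_pow_eq_monomial]
  obtain ⟨Φ₁, hΦ₁0, hΦ₁⟩ := exists_polynomial_interpolation (x₀ := x₀) b.succ (d - 1)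
    hg.exists_form_eval_hyperplanePoint_eq
  obtain ⟨Φ₂, hΦ₂0, hΦ₂⟩ := exists_polynomial_surjective hτ hd b.succ (M := M) (t := e + k - 1)
    (by omega) (by omega) hx₀ fun f hf =>
      exists_sub_mem_interIdeal_X_pow hT hτ hd hk (fun i => direction_mem_lines i) hyb hL
        (hg.maximalRank₁.surjective he) (by omega) (by omega) hf
  obtain ⟨Φ₃, hΦ₃0, hΦ₃⟩ := exists_polynomial_injective hτ hd hk b.succ (M := M) (t := t₁)
    (by omega) (by omega) hx₀ hc₀ (fun i => by
      obtain ⟨x, hx, hx0⟩ := hL i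
      exact ⟨x, hx, by simpa [x₀] using fun h => absurd h hx0⟩) fun f hf hfI => by
      have h1 := isHomogeneous_X_pow_mul b.succ (M - t₁) hf
      rw [show t₁ + (M - t₁) = (M - k) + k by omega] at h1
      obtain ⟨h, hh, hY⟩ := exists_sub_mul_mem_curveIdeal hF h1 hfI
      exact Ideal.mem_span_singleton.mpr (X_pow_dvd_of_sub_mem_curveIdeal
        (fun i => direction_mem_lines i) hyb hL (fun f hf => hg.maximalRank₂.injective ht₁ hf)
        (M - t₁) k le_rfl (by omega) hf hh hY)
  -- the remaining factors say that `x₀ ^ k` occurs in the equation of `W`, and that the points of the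
  -- lines on `x_b = 0` lie neither on `W` nor on `x₀ = 0`
  refine ⟨X (Sum.inl (Finsupp.single 0 k)) *
    (∏ i, (genericForm d k (genericHyperplanePoint b.succ i) * genericHyperplanePoint b.succ i 0)) *
    (Φ₁ * Φ₂ * Φ₃), ⟨x₀, hx₀, ?_⟩, fun x hx hxΦ => ?_⟩
  · have hr : ∀ i, hyperplanePoint v b.succ i 0 ≠ 0 := hg.hyperplanePoint_zero_ne
    simp only [map_mul, map_prod, mul_ne_zero_iff, Finset.prod_ne_zero_iff]
    refine ⟨⟨by rw [eval_X]; exact hc₀, fun i _ => ⟨?_, ?_⟩⟩, ⟨hΦ₁0, hΦ₂0⟩, hΦ₃0⟩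
    · rw [eval_genericForm hx₀.1, eval_genericHyperplanePoint, map_pow, eval_X]
      exact pow_ne_zero _ (hr i)
    · have := congrFun (eval_genericHyperplanePoint x₀ b.succ i) 0
      rw [this]
      exact hr i
  · simp only [map_mul, map_prod, mul_ne_zero_iff, Finset.prod_ne_zero_iff] at hxΦ
    obtain ⟨⟨hc, hr⟩, ⟨h1, h2⟩, h3⟩ := hxΦ
    rw [eval_X] at hc
    have hFr : ∀ i, eval (hyperplanePoint x.2 b.succ i) x.1 ≠ 0 := fun i => by
      have := (hr i (Finset.mem_univ i)).1
      rwa [eval_genericForm hx.1, eval_genericHyperplanePoint] at this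
    have hr0 : ∀ i, hyperplanePoint x.2 b.succ i 0 ≠ 0 := fun i => by
      rw [← eval_genericHyperplanePoint]
      exact (hr i (Finset.mem_univ i)).2
    have hint : ∀ m, d ≤ m + 1 → ∀ u : Fin d → K, ∃ f : MvPolynomial (Fin (n + 1 + 1)) K,
        f.IsHomogeneous m ∧ ∀ i, eval (hyperplanePoint x.2 b.succ i) f = u i := fun m hm =>
      exists_form_eval_eq_of_le hr0 (by omega) (hΦ₁ x h1)
    refine ⟨fun t ht => ?_, fun t ht => ?_⟩
    · exact hCoh_one_eq_zero_of_le (b := b.succ) hn hx.2.2 hτ hd hk hx.1 hc hFr hint (M := M)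
        (by omega) (by omega) ht (hΦ₂ x hx h2)
    · exact hCoh_zero_eq_zero_of_le (b := b.succ) (by omega) hx.2.2 hτ hd hk hx.1 hc
        (Fin.succ_ne_zero b) hFr hint (M := M) (by omega) (by omega) ht (hΦ₃ x hx h3 hc)

end TreesOfLines

theorem proposition1 {K : Type*} [Field K] [IsAlgClosed K] (n d k : ℕ) (hn : 3 ≤ n) (hd : 1 ≤ d)
    (hk : 3 ≤ k) (τ : {i : Fin d // 0 < (i : ℕ)} → Fin d) (hτ : ∀ i, τ i < i.1) :
    TreesOfLines.HoldsForGeneral TreesOfLines.pairCoord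
      (TreesOfLines.hypersurfaceTreePairs K n k τ)
      (fun x => ∀ t : ℤ,
        (d ≤ ((n : ℤ) + t - k).toNat.choose (n - 1) →
          TreesOfLines.hCoh x.1 (TreesOfLines.interIdeal x.1 (TreesOfLines.lines x.2)) t 1 = 0) ∧
        (((n : ℤ) + t + k - 2).toNat.choose (n - 1) ≤ d →
          TreesOfLines.hCoh x.1 (TreesOfLines.interIdeal x.1 (TreesOfLines.lines x.2)) t 0 = 0)) := by
  have : Infinite K := IsAlgClosed.instInfinite
  obtain ⟨e, t₁, ⟨he, hemin⟩, ht₁, ht₁max⟩ := TreesOfLines.exists_degree_bounds (n - 1) d (by omega) hd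
  obtain ⟨Φ, hΦ, hall⟩ :=
    TreesOfLines.holdsForGeneral_hCoh_eq_zero (K := K) (k := k) hn hd (by omega) hτ he ht₁
  refine ⟨Φ, hΦ, fun x hx hxΦ t => ⟨fun h => ?_, fun h => ?_⟩⟩
  · -- the binomial coefficient is positive, so that `t ≥ k - 1`
    have hpos := Nat.choose_ne_zero_iff.mp (lt_of_lt_of_le hd h).ne'
    obtain ⟨e', he'⟩ : ∃ e' : ℕ, t = e' + k - 1 := ⟨(t + 1 - k).toNat, by omega⟩
    have hee' := hemin e' (by convert h using 2; omega)
    obtain ⟨t, rfl⟩ := Int.eq_ofNat_of_zero_le (a := t) (by omega)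
    exact (hall x hx hxΦ).1 t (by omega)
  · apply (hall x hx hxΦ).2
    by_contra! hlt
    obtain ⟨t, rfl⟩ := Int.eq_ofNat_of_zero_le (a := t) (by omega)
    have := ht₁max t ((Nat.choose_le_choose _ (by omega)).trans h)
    omega
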